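/- Conventions. Let $S$ be a scheme. Valuations on fields are non-archimedean, of arbitrary rank, and may be trivial; $\mathcal O_v$ is the valuation ring of $v$, and $K_v^{sh}$ denotes the quotient field of the strict henselization of $\mathcal O_v$. If $w$ is an extension of a valuation $v$ on $K$ to a finite separable extension $L/K$, then $w/v$ is \emph{(at most) tamely ramified} if the degree of $L_w^{sh}/K_v^{sh}$ is prime to the residue characteristic of $v$ (no condition if this is $0$). If $X$ is an $S$-scheme and $\operatorname{Spec} K\to X$ a morphism with $K$ a field, an \emph{$S$-valuation} on $K$ is a valuation $v$ on $K$ such that $\operatorname{Spec}K\to X\to S$ extends to a morphism $\operatorname{Spec}\mathcal O_v\to S$; $\mathrm{Val}_S X$ is the set of pairs $(x,v)$ with $x\in X$ and $v$ an $S$-valuation on the residue field $k(x)$. The \emph{tame site} $(X/S)_t$ has as underlying category the étale $X$-schemes; its coverings are the étale coverings $(U_i\to U)_i$ such that every $(u,v)\in \mathrm{Val}_S U$ is the image of some $(u_i,v_i)\in\mathrm{Val}_S U_i$, for some $i$, with $v_i/v$ at most tamely ramified. A \emph{tame sheaf} is a sheaf of abelian groups on $(X/S)_t$. It is \emph{locally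 constant} if there is a covering $(U_i\to X)_i$ in $(X/S)_t$ such that for each $i$ its restriction to $U_i$ is isomorphic to a constant sheaf $\underline{A_i}$, the Zariski sheafification on the category of étale $U_i$-schemes of the constant presheaf of an abelian group $A_i$. A \emph{tame point} $(\bar x,\bar v)$ of $X/S$ is a morphism $\bar x\colon \operatorname{Spec}k(\bar x)\to X$ with $k(\bar x)$ a field, together with an $S$-valuation $\bar v$ on $k(\bar x)$ such that $k(\bar x)$ has no nontrivial finite separable extension to which $\bar v$ has a tamely ramified extension. It induces by base change a morphism of sites $(\operatorname{Spec}k(\bar x)/\operatorname{Spec}\mathcal O_{\bar v})_t\to (X/S)_t$, and the \emph{stalk} of a tame sheaf $\mathcal F$ at $(\bar x,\bar v)$ is $\Gamma(\operatorname{Spec}k(\bar x),\bar x^*\mathcal F)$. We say that $\mathcal F$ \emph{has finite stalks} if its stalks at all tame points are finite. For a connected $S$-scheme $X$, a \emph{finite tame cover} of $X$ is a finite étale morphism $f\colon Y\to X$ such that for every $(y,w)\in \mathrm{Val}_S Y$ the extension $k(y)/k(f(y))$ is at most tamely ramified at $w$. Proposition. Let $X$ be a connected $S$-scheme and let $\mathcal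 F$ be a locally constant tame sheaf on $(X/S)_t$. Then $\mathcal F$ has finite stalks if and only if there is a commutative group scheme $G\to X$ which is a finite tame cover of $X$ and represents $\mathcal F$, i.e. $\mathcal F$ is isomorphic, as a sheaf of abelian groups, to $U\mapsto \operatorname{Hom}_X(U,G)$. -/

import Mathlib

open CategoryTheory AlgebraicGeometry Opposite
open scoped MonObj

universe u

namespace TameSite

noncomputable section

/-! ### Tame ramification

A valuation on a field `K` (up to equivalence, trivial valuation and arbitrary rank allowed) is
given by its valuation ring, an element of `ValuationSubring K`. The restriction of a valuation
along a field homomorphism is `ValuationSubring.comap`. -/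

/-- Let `Ω` be a separable closure of `K` via `j`, let `W` be a valuation on `Ω`, with restriction
`v` to `K`. The strict henselization of `O_v` with respect to the residue field of `W` is the
colimit of all étale `O_v`-algebras `C` equipped with an `O_v`-homomorphism from `C` to the residue
field of `W`. Since `W` is strictly henselian, every such homomorphism lifts uniquely to
a homomorphism from `C` to `W`, so the strict henselization is the union of the images of
étale `O_v`-algebras in `W`. -/
def strictHenselization {K Ω : Type u} [Field K] [Field Ω] (j : K →+* Ω)
    (W : ValuationSubring Ω) : Set Ω :=
  {a | ∃ (C : Type u) (_ : CommRing C) (_ : Algebra (W.comap j) C) (φ : C →+* Ω),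
    Algebra.Etale (W.comap j) C ∧
    φ.comp (algebraMap (W.comap j) C) = j.comp (W.comap j).subtype ∧
    (∀ c, φ c ∈ W) ∧ a ∈ Set.range φ}

/-- The field `K_v^sh`: the quotient field, inside `Ω`, of the strict henselization of `O_v`. -/
def strictHenselizationField {K Ω : Type u} [Field K] [Field Ω] (j : K →+* Ω)
    (W : ValuationSubring Ω) : Subfield Ω :=
  Subfield.closure (strictHenselization j W)

/-- Let `i : K → L` be a finite separable field extension, `w` a valuation on `L` and `v` its
restriction to `K`. Then `w / v` is (at most) tamely ramified if the degree of
`L_w^sh / K_v^sh` is prime to the residue characteristic of `v` (no condition if this is `0`).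
Both fields are formed inside the separable closure of `L` with respect to an extension `W`
of `w`; all choices of `W` are conjugate over `L`. -/
def IsTamelyRamified {K L : Type u} [Field K] [Field L] (i : K →+* L)
    (w : ValuationSubring L) : Prop :=
  ∃ W : ValuationSubring (SeparableClosure L),
    W.comap (algebraMap L (SeparableClosure L)) = w ∧
    (Subfield.relfinrank
      (strictHenselizationField ((algebraMap L (SeparableClosure L)).comp i) W)
      (strictHenselizationField (algebraMap L (SeparableClosure L)) W)).Coprime
      (ringExpChar (IsLocalRing.ResidueField (w.comap i)))

/-! ### `S`-valuations -/

/-- For a morphism `x : Spec K → X` to an `S`-scheme `X`, a valuation `v` on the field `K` is an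
`S`-valuation if `Spec K → X → S` extends to a morphism `Spec O_v → S`. -/
def IsSValuation {K : Type u} [Field K] {X S : Scheme.{u}} (x : Spec (.of K) ⟶ X) (s : X ⟶ S)
    (v : ValuationSubring K) : Prop :=
  ∃ φ : Spec (.of v) ⟶ S, Spec.map (CommRingCat.ofHom v.subtype) ≫ φ = x ≫ s

/-- Pairs `(x, v)` of a point `x` of `X` and a valuation `v` on the residue field `k(x)`. -/
abbrev ValuedPoint (X : Scheme.{u}) : Type u :=
  Σ x : X, ValuationSubring (X.residueField x)

/-- The image of a pair `(y, w)` under `f : Y ⟶ X`. -/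
def ValuedPoint.map {X Y : Scheme.{u}} (f : Y ⟶ X) (q : ValuedPoint Y) : ValuedPoint X :=
  ⟨f q.1, q.2.comap (f.residueFieldMap q.1).hom⟩

/-- The set `Val_S X` of `S`-valuations on an `S`-scheme `X`. -/
def Val {X S : Scheme.{u}} (s : X ⟶ S) : Set (ValuedPoint X) :=
  {q | IsSValuation (X.fromSpecResidueField q.1) s q.2}

/-! ### The tame site -/

/-- Base change of étale schemes along `f : Y ⟶ X`. -/
def etaleBaseChange {X Y : Scheme.{u}} (f : Y ⟶ X) : X.Etale ⥤ Y.Etale :=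
  haveI : MorphismProperty.HasPullbacksAlong @Etale.{u} f := ⟨fun _ _ => inferInstance⟩
  haveI : MorphismProperty.IsStableUnderBaseChangeAlong @Etale.{u} f :=
    ⟨fun sq h => MorphismProperty.IsStableUnderBaseChange.of_isPullback sq h⟩
  MorphismProperty.Over.pullback (T := Scheme.{u}) (P := @Etale.{u}) ⊤ f

/-- Composition of étale schemes over `Y` with an étale morphism `f : Y ⟶ X`. -/
def etaleMap {X Y : Scheme.{u}} (f : Y ⟶ X) (hf : Etale f) : Y.Etale ⥤ X.Etale :=
  haveI : MorphismProperty.IsStableUnderComposition @Etale.{u} :=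
    (inferInstance : MorphismProperty.IsMultiplicative @Etale.{u}).toIsStableUnderComposition
  MorphismProperty.Over.map (T := Scheme.{u}) (P := @Etale.{u}) ⊤ hf

/-- The covering families of the tame site `(X/S)_t`: a family of morphisms `U_i → U` of étale
`X`-schemes is a tame covering if it is jointly surjective and every `(u, v) ∈ Val_S U` is the
image of some `(u_i, v_i) ∈ Val_S U_i` such that `v_i / v` is at most tamely ramified. -/
def tamePrecoverage {X S : Scheme.{u}} (s : X ⟶ S) : Precoverage X.Etale where
  coverings U := {R |
    (∀ x : U.left, ∃ (V : X.Etale) (p : V ⟶ U) (y : V.left), R p ∧ p.left y = x) ∧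
    ∀ q ∈ Val (U.hom ≫ s), ∃ (V : X.Etale) (p : V ⟶ U), R p ∧
      ∃ r ∈ Val (V.hom ≫ s), r.map p.left = q ∧
        IsTamelyRamified (p.left.residueFieldMap r.1).hom r.2}

/-- The Grothendieck topology of the tame site `(X/S)_t` on the category of étale `X`-schemes. -/
def tameTopology {X S : Scheme.{u}} (s : X ⟶ S) : GrothendieckTopology X.Etale :=
  (tamePrecoverage s).toGrothendieck

/-- Sheaves of abelian groups on `(X/S)_t`. As the category of étale `X`-schemes is large, the
groups are allowed to live in the universe `u + 1`; this includes (via `ULift`) the sheaves of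
groups in the universe `u`. -/
abbrev TameSheaf {X S : Scheme.{u}} (s : X ⟶ S) : Type (u + 2) :=
  Sheaf (tameTopology s) AddCommGrpCat.{u + 1}

/-! ### Tame points and stalks -/

/-- A tame point of `X/S`: a morphism `Spec k → X`, `k` a field, with an `S`-valuation `v` on `k`
such that `k` has no nontrivial finite separable extension to which `v` has a tamely ramified
extension. -/
structure TamePoint {X S : Scheme.{u}} (s : X ⟶ S) where
  /-- The field `k`. -/
  k : Type u
  [field : Field k]
  /-- The morphism `Spec k → X`. -/
  x : Spec (.of k) ⟶ X
  /-- The valuation on `k`. -/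
  v : ValuationSubring k
  isSValuation : IsSValuation x s v
  surjective_of_isTamelyRamified : ∀ (L : Type u) [Field L] [Algebra k L] [FiniteDimensional k L]
    [Algebra.IsSeparable k L] (w : ValuationSubring L), w.comap (algebraMap k L) = v →
    IsTamelyRamified (algebraMap k L) w → Function.Surjective (algebraMap k L)

attribute [instance] TamePoint.field

namespace TamePoint

variable {X S : Scheme.{u}} {s : X ⟶ S} (P : TamePoint s)

/-- The morphism `Spec k → Spec O_v`, which makes `Spec k` a scheme over `Spec O_v`. -/
def toSpecValuationRing : Spec (.of P.k) ⟶ Spec (.of P.v) :=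
  Spec.map (CommRingCat.ofHom P.v.subtype)

/-- The inverse image of a tame sheaf on `(X/S)_t` under the morphism of sites
`(Spec k / Spec O_v)_t → (X/S)_t` given by base change of étale `X`-schemes along `Spec k → X`:
left Kan extension followed by sheafification. -/
def inverseImage (F : TameSheaf s) : TameSheaf P.toSpecValuationRing :=
  (presheafToSheaf (tameTopology P.toSpecValuationRing) AddCommGrpCat.{u + 1}).obj
    ((etaleBaseChange P.x).op.lan.obj F.obj)

/-- The stalk of a tame sheaf at a tame point: the global sections of its inverse image. -/
def stalk (F : TameSheaf s) : AddCommGrpCat.{u + 1} :=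
  (P.inverseImage F).obj.obj (op (Scheme.Etale.mk (𝟙 (Spec (.of P.k)))))

end TamePoint

/-- A tame sheaf has finite stalks if its stalks at all tame points are finite. -/
def HasFiniteStalks {X S : Scheme.{u}} {s : X ⟶ S} (F : TameSheaf s) : Prop :=
  ∀ P : TamePoint s, Finite (P.stalk F)

/-! ### Locally constant sheaves -/

/-- The Zariski topology on the category of étale `X`-schemes. -/
abbrev zariskiTopologyOnEtale (X : Scheme.{u}) : GrothendieckTopology X.Etale :=
  X.smallGrothendieckTopology (P := @IsOpenImmersion) (Q := @Etale)

/-- The constant sheaf of an abelian group `A` on the category of étale `X`-schemes: the Zariski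
sheafification of the constant presheaf. -/
def constantEtaleSheaf (X : Scheme.{u}) (A : AddCommGrpCat.{u + 1}) :
    X.Etaleᵒᵖ ⥤ AddCommGrpCat.{u + 1} :=
  ((constantSheaf (zariskiTopologyOnEtale X) AddCommGrpCat.{u + 1}).obj A).obj

/-- The restriction of a presheaf on the category of étale `X`-schemes to an étale
`X`-scheme `U`. -/
def restrict {X : Scheme.{u}} (F : X.Etaleᵒᵖ ⥤ AddCommGrpCat.{u + 1}) (U : X.Etale) :
    U.left.Etaleᵒᵖ ⥤ AddCommGrpCat.{u + 1} :=
  (etaleMap U.hom U.prop).op ⋙ F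

/-- A tame sheaf is locally constant if there is a tame covering `(U_i → X)` such that its
restriction to each `U_i` is isomorphic to the constant sheaf of some abelian group `A_i`. -/
def IsLocallyConstant {X S : Scheme.{u}} {s : X ⟶ S} (F : TameSheaf s) : Prop :=
  ∃ R ∈ tamePrecoverage s (Scheme.Etale.mk (𝟙 X)),
    ∀ ⦃U : X.Etale⦄ (p : U ⟶ Scheme.Etale.mk (𝟙 X)), R p →
      ∃ A : AddCommGrpCat.{u + 1}, Nonempty (restrict F.obj U ≅ constantEtaleSheaf U.left A)

/-! ### Finite tame covers and representability -/

/-- A finite tame cover of the `S`-scheme `X`: a finite étale morphism `f : Y ⟶ X` such that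
`k(y) / k(f y)` is at most tamely ramified at every `S`-valuation on `k(y)`, for all `y`. -/
structure IsFiniteTameCover {X Y S : Scheme.{u}} (s : X ⟶ S) (f : Y ⟶ X) : Prop where
  isFinite : IsFinite f
  etale : Etale f
  isTamelyRamified : ∀ q ∈ Val (f ≫ s), IsTamelyRamified (f.residueFieldMap q.1).hom q.2

/-- A tame sheaf is represented by a commutative group scheme `G → X` if it is isomorphic, as a
sheaf of abelian groups, to the sheaf sending an étale `X`-scheme `U` to the group of
`X`-morphisms `U → G`. -/
def IsRepresentedBy {X S : Scheme.{u}} {s : X ⟶ S} (F : TameSheaf s)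
    (G : Over X) [GrpObj G] [IsCommMonObj G] : Prop :=
  ∃ e : ∀ U : X.Etale, F.obj.obj (op U) ≃+ Additive ((Scheme.Etale.forget X).obj U ⟶ G),
    ∀ ⦃U V : X.Etale⦄ (p : U ⟶ V) (a : F.obj.obj (op V)),
      (e U (F.obj.map p.op a)).toMul = (Scheme.Etale.forget X).map p ≫ (e V a).toMul

end

end TameSite

/-! Suppose that `F` is locally constant with finite stalks. Where `F` is constant with group `A`
over a nonempty `U`, the group `A` embeds into the stalk at a geometric point of `U` with the
trivial valuation, which is a tame point. So `A` is finite, and `F` is étale locally a finite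
constant sheaf. The finite set of sections that exhibits this over an étale `W` is called a chart
(`IsChart`).

The representing scheme is the relative spectrum of the algebra of functions on `F`, that is, of
natural maps from `F` to the structure sheaf. Over a chart with `n` sections this algebra is the
`n`-th power of the base ring. On a general affine `U` it is the equalizer attached to a finite
cover by affine charts, and flat base change preserves such equalizers (`FunRing.isPushout_map`).
Hence the spectra glue to a scheme over `X`, which is finite étale because it is so over charts.
Evaluation turns a section of `F` into a homomorphism out of the algebra of functions. Conversely,
over a chart, such a homomorphism sends the coordinate idempotents to idempotents with sum `1`, one
of which is `1` near any given point, so it is locally evaluation at a chart section. This gives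
`exists_representing_section`, and the group law follows by Yoneda among étale schemes.

For tameness, take a valued point of `G` over a valued point of `X`. The tame covering supplies a
tamely ramified valued point over the same point of `X`, with residue field `M`, on some `U` with a
chart. Since geometric points of `G` over `U` come from sections `U ⟶ G`, every embedding of the
residue field `L` of the point of `G` into a separable closure of `M` has image in `M`. Extensions
of a valuation to a separable closure are conjugate (`exists_algEquiv_comap_eq`), so the embedding
can be chosen compatibly with the valuations. The strict henselization of `L` then lies between
those of the base field and of `M`, and its degree divides a number prime to the residue
characteristic (`IsTamelyRamified.of_forall_factors`).

Conversely, tame coverings split at a tame point, so sheafification does not change the global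
sections there, and the stalk is a filtered colimit of sections of `F`. If `G` represents `F`, every
element of the stalk is the value of the universal section at a `k`-point of `G` over the given
point of `X`. A finite `G` has only finitely many of these. -/

open scoped TensorProduct
namespace TameSite

/-! ### Extensions of valuations -/

section Conjugacy

variable {K Ω : Type u} [Field K] [Field Ω]

/-- The values `∑_{k ≥ i} a_k x ^ (k - i)` of the truncations of a polynomial with root `x`
lie in every valuation ring containing the coefficients of the polynomial. -/
lemma eval_divX_iterate_mem (V : ValuationSubring Ω) {f : Polynomial Ω}
    (hf : ∀ i, f.coeff i ∈ V) {x : Ω} (hx : f.eval x = 0) (i : ℕ) :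
    ((Polynomial.divX^[i] f).eval x) ∈ V := by
  have hc (i j : ℕ) : (Polynomial.divX^[i] f).coeff j = f.coeff (i + j) := by
    induction i generalizing j with
    | zero => simp
    | succ i ih => rw [Function.iterate_succ_apply', Polynomial.coeff_divX, ih]; congr 1; omega
  -- If `x ∈ V`, the truncation is a polynomial in `x` with coefficients in `V`. Otherwise `x⁻¹ ∈
  -- V`, and the truncations are computed from below, starting from the value `0` of `f` at `x`:
  -- each step subtracts a coefficient and divides by `x`.
  by_cases h : x ∈ V
  · rw [Polynomial.eval_eq_sum_range]
    exact sum_mem fun j _ => mul_mem (by rw [hc]; exact hf _) (pow_mem h _)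
  · have h' : x⁻¹ ∈ V := (V.mem_or_inv_mem x).resolve_left h
    have hx0 : x ≠ 0 := by rintro rfl; exact h V.zero_mem
    induction i with
    | zero => simp [hx]
    | succ i ih =>
      have e := congr_arg (Polynomial.eval x) (Polynomial.divX_mul_X_add (Polynomial.divX^[i] f))
      simp only [Polynomial.eval_add, Polynomial.eval_mul, Polynomial.eval_X,
        Polynomial.eval_C, hc, ← Function.iterate_succ_apply'] at e
      have : (Polynomial.divX^[i + 1] f).eval x =
          ((Polynomial.divX^[i] f).eval x - f.coeff (i + 0)) * x⁻¹ := by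
        rw [← e]; field_simp; ring
      rw [this]
      exact mul_mem (sub_mem ih (hf _)) h'

variable [Algebra K Ω]

/-- Every element of an algebraic extension of `K` is a root of a polynomial with coefficients
in a given valuation ring of `K`, one of them equal to `1`. -/
lemma exists_coeff_mem_and_eq_one [Algebra.IsAlgebraic K Ω] (A : ValuationSubring K) (x : Ω) :
    ∃ f : Polynomial K, (∀ i, f.coeff i ∈ A) ∧ (∃ i, f.coeff i = 1) ∧
      Polynomial.aeval x f = 0 := by
  obtain ⟨g, hg0, hg⟩ := Algebra.IsAlgebraic.isAlgebraic (R := K) x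
  -- Dividing by a coefficient of maximal valuation makes all coefficients integral and that one
  -- equal to `1`.
  obtain ⟨k, hk, hmax⟩ := g.support.exists_max_image (fun i => A.valuation (g.coeff i))
    (Polynomial.support_nonempty.2 hg0)
  have hk0 : g.coeff k ≠ 0 := Polynomial.mem_support_iff.1 hk
  refine ⟨Polynomial.C (g.coeff k)⁻¹ * g, fun i => ?_, ⟨k, ?_⟩, ?_⟩
  · rw [Polynomial.coeff_C_mul, ← A.valuation_le_one_iff, map_mul, map_inv₀]
    by_cases hi : i ∈ g.support
    · have := hmax i hi
      have h0 : A.valuation (g.coeff k) ≠ 0 := by simpa using hk0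
      exact (inv_mul_le_iff₀ (zero_lt_iff.2 h0)).2 (by simpa using this)
    · simp [Polynomial.notMem_support_iff.1 hi]
  · simp [hk0]
  · simp [hg]

/-- A valuation ring `W₂` of an algebraic extension of `K` contains every valuation ring `W₁` whose
maximal ideal contains the integral elements of the maximal ideal of `W₂`. -/
lemma le_of_nonunits_inter_integral_le [Algebra.IsAlgebraic K Ω] (A : ValuationSubring K)
    (W₁ W₂ : ValuationSubring Ω)
    (h₂ : W₂.comap (algebraMap K Ω) = A)
    (h : ∀ x : Ω, IsIntegral A x → x ∈ W₂.nonunits → x ∈ W₁.nonunits) : W₁ ≤ W₂ := by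
  intro x hx
  obtain ⟨f, hf, ⟨k, hk⟩, hfx⟩ := exists_coeff_mem_and_eq_one A x
  set g : Polynomial Ω := f.map (algebraMap K Ω)
  set b : ℕ → Ω := fun i => (Polynomial.divX^[i] g).eval x
  have hgx : g.eval x = 0 := by rwa [Polynomial.eval_map_algebraMap]
  have hW (W : ValuationSubring Ω) (hW : W.comap (algebraMap K Ω) = A) (i : ℕ) :
      g.coeff i ∈ W := by
    rw [Polynomial.coeff_map, ← ValuationSubring.mem_comap, hW]; exact hf i
  have hc (i j : ℕ) : (Polynomial.divX^[i] g).coeff j = g.coeff (i + j) := by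
    induction i generalizing j with
    | zero => simp
    | succ i ih => rw [Function.iterate_succ_apply', Polynomial.coeff_divX, ih]; congr 1; omega
  have hb (i : ℕ) : b (i + 1) * x + g.coeff i = b i := by
    have e := congr_arg (Polynomial.eval x) (Polynomial.divX_mul_X_add (Polynomial.divX^[i] g))
    simpa only [Polynomial.eval_add, Polynomial.eval_mul, Polynomial.eval_X,
      Polynomial.eval_C, hc, ← Function.iterate_succ_apply', add_zero] using e
  -- The integral closure is the intersection of the valuation rings that contain it, and each of
  -- these contains `b i`.
  have hint (i : ℕ) : IsIntegral A (b i) := by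
    by_contra hcon
    have : IsIntegrallyClosedIn (integralClosure A Ω).toSubring Ω :=
      inferInstanceAs (IsIntegrallyClosedIn (integralClosure A Ω) Ω)
    obtain ⟨V, hV, hbV⟩ := Subring.exists_le_valuationSubring_of_isIntegrallyClosedIn
      (R := (integralClosure A Ω).toSubring) (x := b i) hcon
    refine hbV (eval_divX_iterate_mem V (fun j => ?_) hgx i)
    refine hV ?_
    change IsIntegral A (g.coeff j)
    rw [Polynomial.coeff_map]
    exact isIntegral_algebraMap (R := A) (A := Ω) (x := ⟨f.coeff j, hf j⟩)
  by_contra hx2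
  -- If `b (i + 1)` were a unit or had its inverse in `W₂`, then solving `b (i + 1) * x + a_i = b i`
  -- for `x` would put `x` into `W₂`.
  have hbW₂ (i : ℕ) : b i ∈ W₂.nonunits := by
    cases i with
    | zero => simp [b, hgx]
    | succ i =>
      by_contra hcon
      rw [ValuationSubring.mem_nonunits_iff_or, not_or, not_not] at hcon
      have hb0 := hcon.1
      have : x = (b i - g.coeff i) * (b (i + 1))⁻¹ := by
        rw [← hb i]; field_simp; ring
      refine hx2 (this ▸ mul_mem (sub_mem ?_ (hW W₂ h₂ i)) hcon.2)
      exact eval_divX_iterate_mem W₂ (hW W₂ h₂) hgx i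
  have hbW₁ (i : ℕ) : b i ∈ W₁.nonunits := h _ (hint i) (hbW₂ i)
  have hmul : b (k + 1) * x ∈ W₁.nonunits := by
    rw [ValuationSubring.mem_nonunits_iff, map_mul]
    exact mul_lt_one_of_lt_of_le (hbW₁ _) ((W₁.valuation_le_one_iff x).2 hx)
  -- The coefficient `1 = a_k` equals `b k - b (k + 1) * x`, a difference of elements of the maximal
  -- ideal of `W₁`.
  have h1 : (1 : Ω) ∈ W₁.nonunits := by
    have := sub_mem (hbW₁ k) hmul
    rw [← hb k, add_sub_cancel_left, Polynomial.coeff_map, hk, map_one] at this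
    exact this
  simp [ValuationSubring.mem_nonunits_iff] at h1

/-- Two extensions of a valuation to a Galois extension are conjugate. -/
theorem exists_algEquiv_comap_eq [IsGalois K Ω] (W₁ W₂ : ValuationSubring Ω)
    (h : W₁.comap (algebraMap K Ω) = W₂.comap (algebraMap K Ω)) :
    ∃ σ : Ω ≃ₐ[K] Ω, W₂.comap (σ : Ω →+* Ω) = W₁ := by
  set A : ValuationSubring K := W₁.comap (algebraMap K Ω) with hA
  let B := integralClosure A Ω
  -- With the discrete topology on the integral closure `B`, the Galois group acts continuously, so
  -- the transitivity of profinite groups on the primes over a given prime applies.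
  let : TopologicalSpace B := ⊥
  have : DiscreteTopology B := ⟨rfl⟩
  have hsm : SMulCommClass (Ω ≃ₐ[K] Ω) A Ω :=
    ⟨fun g a x => (map_smul g (a : K) x)⟩
  have : ContinuousSMul (Ω ≃ₐ[K] Ω) B := by
    rw [continuousSMul_iff_stabilizer_isOpen]
    intro b
    have : MulAction.stabilizer (Ω ≃ₐ[K] Ω) b = MulAction.stabilizer (Ω ≃ₐ[K] Ω) (b : Ω) := by
      ext g
      exact ⟨fun hg => congr_arg Subtype.val hg, fun hg => Subtype.ext hg⟩
    rw [this]
    exact stabilizer_isOpen_of_isIntegral (K := K) (b : Ω)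
  have hle (W : ValuationSubring Ω) (hW : W.comap (algebraMap K Ω) = A) (x : Ω)
      (hx : IsIntegral A x) : x ∈ W := by
    obtain ⟨p, hp, hpx⟩ := hx
    have : IsIntegral W x := by
      let inc : A →+* W := ((algebraMap K Ω).comp A.subtype).codRestrict W.toSubring
        (fun a => (by rw [hW]; exact a.2 : (a : K) ∈ W.comap (algebraMap K Ω)))
      exact ⟨p.map inc, hp.map _, by rw [Polynomial.eval₂_map]; exact hpx⟩
    obtain ⟨y, rfl⟩ := IsIntegrallyClosed.isIntegral_iff.1 this
    exact y.2
  let inc (W : ValuationSubring Ω) (hW : W.comap (algebraMap K Ω) = A) : B →+* W :=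
    B.val.toRingHom.codRestrict W.toSubring (fun b => hle W hW _ b.2)
  let P (W : ValuationSubring Ω) (hW : W.comap (algebraMap K Ω) = A) : Ideal B :=
    (IsLocalRing.maximalIdeal W).comap (inc W hW)
  have hP (W hW) (b : B) : b ∈ P W hW ↔ (b : Ω) ∈ W.nonunits :=
    (ValuationSubring.coe_mem_nonunits_iff (a := inc W hW b)).symm
  have hinv : Algebra.IsInvariant A B (Ω ≃ₐ[K] Ω) := by
    refine ⟨fun b hb => ?_⟩
    obtain ⟨k, hk⟩ := (InfiniteGalois.mem_range_algebraMap_iff_fixed (k := K) (b : Ω)).2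
      (fun g => congr_arg Subtype.val (hb g))
    have hkA : k ∈ A := by
      rw [hA, ValuationSubring.mem_comap, hk]; exact hle _ hA.symm _ b.2
    exact ⟨⟨k, hkA⟩, Subtype.ext hk⟩
  have hnu (W : ValuationSubring Ω) (hW : W.comap (algebraMap K Ω) = A) (a : K) :
      algebraMap K Ω a ∈ W.nonunits ↔ a ∈ A.nonunits := by
    rw [ValuationSubring.mem_nonunits_iff_or, ValuationSubring.mem_nonunits_iff_or, ← hW,
      ValuationSubring.mem_comap]
    simp
  have := (IsLocalRing.maximalIdeal W₁).comap_isPrime (inc W₁ rfl)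
  have := (IsLocalRing.maximalIdeal W₂).comap_isPrime (inc W₂ h.symm)
  obtain ⟨g, hg⟩ := Algebra.IsInvariant.exists_smul_of_under_eq_of_profinite (A := A) (B := B)
    (G := Ω ≃ₐ[K] Ω) (P W₁ rfl) (P W₂ h.symm) (by
      ext a
      exact (hP W₁ rfl (algebraMap A B a)).trans (((hnu W₁ rfl a).trans
        (hnu W₂ h.symm a).symm).trans (hP W₂ h.symm (algebraMap A B a)).symm))
  have hgb (b : B) : (b : Ω) ∈ W₁.nonunits ↔ g (b : Ω) ∈ W₂.nonunits := by
    rw [← hP W₁ rfl b, ← Ideal.smul_mem_pointwise_smul_iff (a := g), ← hg, hP _ h.symm]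
    rfl
  have hcomap : (W₂.comap (g : Ω →+* Ω)).comap (algebraMap K Ω) = A := by
    rw [ValuationSubring.comap_comap, h]
    congr 1
    ext x
    simp
  have hnu' (x : Ω) : x ∈ (W₂.comap (g : Ω →+* Ω)).nonunits ↔ g x ∈ W₂.nonunits := by
    rw [ValuationSubring.mem_nonunits_iff_or, ValuationSubring.mem_nonunits_iff_or,
      ValuationSubring.mem_comap]
    simp
  -- A valuation ring over `A` is determined by the prime of `B` under its maximal ideal, by
  -- `le_of_nonunits_inter_integral_le` in both directions.
  refine ⟨g, le_antisymm ?_ ?_⟩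
  · refine le_of_nonunits_inter_integral_le A _ _ rfl fun x hx hxW => ?_
    exact (hnu' x).2 ((hgb ⟨x, hx⟩).1 hxW)
  · refine le_of_nonunits_inter_integral_le A _ _ hcomap fun x hx hxW => ?_
    exact (hgb ⟨x, hx⟩).2 ((hnu' x).1 hxW)

omit [Algebra K Ω] in
/-- Every valuation extends to every field extension. -/
lemma exists_comap_eq (j : K →+* Ω) (v : ValuationSubring K) :
    ∃ W : ValuationSubring Ω, W.comap j = v := by
  obtain ⟨W, hW, hloc⟩ := IsLocalRing.exists_factor_valuationRing (j.comp v.subtype)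
  refine ⟨W, le_antisymm (fun x hx => ?_) fun x hx => hW ⟨x, hx⟩⟩
  -- If `x ∉ v` but its image lies in `W`, then `x⁻¹ ∈ v` becomes a unit in `W`. Since `v → W` is
  -- local, it is already a unit in `v`.
  by_contra hxv
  have hx' : x⁻¹ ∈ v := (v.mem_or_inv_mem x).resolve_left hxv
  have hx0 : x ≠ 0 := by rintro rfl; exact hxv v.zero_mem
  have hu : IsUnit (((j.comp v.subtype).codRestrict W.toSubring hW) ⟨x⁻¹, hx'⟩) := by
    refine IsUnit.of_mul_eq_one (⟨j x, hx⟩ : W) (Subtype.ext ?_)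
    change j x⁻¹ * j x = 1
    rw [← map_mul, inv_mul_cancel₀ hx0, map_one]
  obtain ⟨y, hy⟩ := (hloc.map_nonunit _ hu).exists_right_inv
  have hy' : x⁻¹ * (y : K) = 1 := congr_arg Subtype.val hy
  have : x = y := by field_simp at hy'; exact hy'.symm
  exact hxv (this ▸ y.2)

end Conjugacy

/-! ### Tame ramification in towers -/

section Tower

variable {K L M Ω : Type u} [Field K] [Field L] [Field M] [Field Ω]

/-- An étale algebra `C` over the smaller valuation ring becomes étale over the larger one after
base change, and the image of the base change in `Ω` contains that of `C`. -/
lemma strictHenselization_comp_subset (i : K →+* L) (j : L →+* Ω) (W : ValuationSubring Ω) :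
    strictHenselization (j.comp i) W ⊆ strictHenselization j W := by
  rintro a ⟨C, _, _, φ, hC, hφ, hφW, ha⟩
  let e : W.comap (j.comp i) →+* W.comap j :=
    (i.comp (W.comap (j.comp i)).subtype).codRestrict (W.comap j).toSubring fun x => x.2
  let _ : Algebra (W.comap (j.comp i)) (W.comap j) := e.toAlgebra
  let _ : Algebra (W.comap (j.comp i)) Ω := (j.comp (W.comap j).subtype |>.comp e).toAlgebra
  let _ : Algebra (W.comap j) Ω := (j.comp (W.comap j).subtype).toAlgebra
  have : IsScalarTower (W.comap (j.comp i)) (W.comap j) Ω := .of_algebraMap_eq fun _ => rfl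
  let φ' : C →ₐ[W.comap (j.comp i)] Ω := { φ with commutes' := fun r => RingHom.congr_fun hφ r }
  let ψ : TensorProduct (W.comap (j.comp i)) (W.comap j) C →ₐ[W.comap j] Ω :=
    Algebra.TensorProduct.lift (Algebra.ofId _ _) φ' fun _ _ => Commute.all _ _
  have hψ (x : W.comap j) (c : C) : ψ (x ⊗ₜ c) = j x * φ c := by
    simp [ψ, φ', Algebra.ofId_apply]; rfl
  refine ⟨_, inferInstance, inferInstance, ψ.toRingHom, ?_, ?_, ?_, ?_⟩
  · exact Algebra.Etale.baseChange ..
  · ext x; exact ψ.commutes x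
  · intro c
    induction c with
    | zero => simp
    | add x y hx hy => rw [map_add]; exact add_mem hx hy
    | tmul x y => exact (hψ x y).symm ▸ mul_mem x.2 (hφW y)
  · obtain ⟨c, rfl⟩ := ha
    exact ⟨1 ⊗ₜ c, by simp [hψ]⟩

lemma strictHenselizationField_comp_le (i : K →+* L) (j : L →+* Ω) (W : ValuationSubring Ω) :
    strictHenselizationField (j.comp i) W ≤ strictHenselizationField j W :=
  Subfield.closure_mono (strictHenselization_comp_subset i j W)

lemma strictHenselizationField_comp_of_bijective (i : K →+* L) (hi : Function.Bijective i)
    (j : L →+* Ω) (W : ValuationSubring Ω) :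
    strictHenselizationField (j.comp i) W = strictHenselizationField j W := by
  refine le_antisymm (strictHenselizationField_comp_le i j W) ?_
  let e := RingEquiv.ofBijective i hi
  have : j = (j.comp i).comp (e.symm : L →+* K) := by
    ext x; exact congr_arg j (e.apply_symm_apply x).symm
  conv_lhs => rw [this]
  exact strictHenselizationField_comp_le _ _ W

lemma image_strictHenselization (θ : Ω ≃+* M) (j : K →+* Ω) (W : ValuationSubring M) :
    θ '' strictHenselization j (W.comap (θ : Ω →+* M)) =
      strictHenselization ((θ : Ω →+* M).comp j) W := by
  ext a
  constructor
  · rintro ⟨_, ⟨C, h1, h2, φ, hC, hφ, hφW, c, rfl⟩, rfl⟩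
    exact ⟨C, h1, h2, (θ : Ω →+* M).comp φ, hC, RingHom.ext fun x => congr_arg θ (RingHom.congr_fun hφ x),
      hφW, c, rfl⟩
  · rintro ⟨C, h1, h2, φ, hC, hφ, hφW, c, rfl⟩
    refine ⟨θ.symm (φ c), ⟨C, h1, h2, (θ.symm : M →+* Ω).comp φ, hC, ?_, fun c => ?_, c, rfl⟩,
      by simp⟩
    · refine RingHom.ext fun x => (congr_arg θ.symm (RingHom.congr_fun hφ x)).trans ?_
      exact θ.symm_apply_apply _
    · change θ (θ.symm (φ c)) ∈ W
      rw [θ.apply_symm_apply]; exact hφW c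

lemma map_strictHenselizationField (θ : Ω ≃+* M) (j : K →+* Ω) (W : ValuationSubring M) :
    (strictHenselizationField j (W.comap (θ : Ω →+* M))).map (θ : Ω →+* M) =
      strictHenselizationField ((θ : Ω →+* M).comp j) W := by
  rw [strictHenselizationField, RingHom.map_field_closure, strictHenselizationField,
    ← image_strictHenselization]
  rfl

/-- Tame ramification may be tested in any separable closure. -/
lemma isTamelyRamified_of_isSepClosure (i : K →+* L) (w : ValuationSubring L) [Algebra L Ω]
    [IsSepClosure L Ω] (W : ValuationSubring Ω) (hW : W.comap (algebraMap L Ω) = w)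
    (h : (Subfield.relfinrank (strictHenselizationField ((algebraMap L Ω).comp i) W)
      (strictHenselizationField (algebraMap L Ω) W)).Coprime
      (ringExpChar (IsLocalRing.ResidueField (w.comap i)))) : IsTamelyRamified i w := by
  let θ : SeparableClosure L ≃ₐ[L] Ω := IsSepClosure.equiv L _ _
  have hθ : (θ.toRingEquiv : SeparableClosure L →+* Ω).comp
      (algebraMap L (SeparableClosure L)) = algebraMap L Ω := 
    RingHom.ext θ.commutes
  refine ⟨W.comap (θ.toRingEquiv : SeparableClosure L →+* Ω), ?_, ?_⟩
  · rw [ValuationSubring.comap_comap, hθ, hW]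
  · rwa [← Subfield.relfinrank_map_map _ _ (θ.toRingEquiv : SeparableClosure L →+* Ω),
      map_strictHenselizationField, map_strictHenselizationField, ← RingHom.comp_assoc, hθ]

lemma isTamelyRamified_of_bijective (i : K →+* L) (hi : Function.Bijective i)
    (w : ValuationSubring L) : IsTamelyRamified i w := by
  obtain ⟨W, hW⟩ := exists_comap_eq (algebraMap L (SeparableClosure L)) w
  refine ⟨W, hW, ?_⟩
  rw [strictHenselizationField_comp_of_bijective i hi, Subfield.relfinrank_self]
  exact Nat.coprime_one_left _

/-- The inclusion of valuation rings is local and induces an embedding of residue fields. Hence the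
residue characteristic in the definition of tameness may be read off upstairs. -/
lemma ringExpChar_residueField_comap (i : K →+* L) (w : ValuationSubring L) :
    ringExpChar (IsLocalRing.ResidueField (w.comap i)) =
      ringExpChar (IsLocalRing.ResidueField w) := by
  let e : w.comap i →+* w :=
    (i.comp (w.comap i).subtype).codRestrict w.toSubring fun x => x.2
  have he : IsLocalHom e := by
    refine ⟨fun a ha => ?_⟩
    obtain ⟨b, hb⟩ := ha.exists_right_inv
    have hb' : i a * b = 1 := congr_arg Subtype.val hb
    have ha0 : (a : K) ≠ 0 := by rintro h; simp [h] at hb'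
    have hinv : (a : K)⁻¹ ∈ w.comap i := by
      rw [ValuationSubring.mem_comap, map_inv₀, ← eq_inv_of_mul_eq_one_right hb']
      exact b.2
    exact IsUnit.of_mul_eq_one ⟨_, hinv⟩ (Subtype.ext (mul_inv_cancel₀ ha0))
  have := RingHom.expChar (IsLocalRing.ResidueField.map e)
    (IsLocalRing.ResidueField.map e).injective (ringExpChar (IsLocalRing.ResidueField w))
  exact ringExpChar.eq _ _

/-- Tame ramification is insensitive to replacing the base field by an isomorphic one. -/
lemma IsTamelyRamified.comp_of_bijective {i : K →+* L} (hi : Function.Bijective i)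
    {m : L →+* M} {w : ValuationSubring M} (h : IsTamelyRamified m w) :
    IsTamelyRamified (m.comp i) w := by
  obtain ⟨W, hW, h⟩ := h
  refine ⟨W, hW, ?_⟩
  rw [ringExpChar_residueField_comap] at h ⊢
  rwa [← RingHom.comp_assoc, strictHenselizationField_comp_of_bijective i hi]

/-- Let `L` and `M` be finite separable over `K`, with valuations `w`, `w'` inducing the same
valuation on `K`. If `w'` is tamely ramified over `K` and every `K`-embedding of `L` into
a separable closure of `M` factors through `M`, then `w` is tamely ramified over `K`. -/
theorem IsTamelyRamified.of_forall_factors [Algebra K L] [Algebra K M]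
    [Algebra.IsSeparable K L] [Algebra.IsSeparable K M] (w : ValuationSubring L)
    (w' : ValuationSubring M)
    (hww' : w.comap (algebraMap K L) = w'.comap (algebraMap K M))
    (h : IsTamelyRamified (algebraMap K M) w')
    (H : ∀ σ : L →+* SeparableClosure M,
      σ.comp (algebraMap K L) = (algebraMap M (SeparableClosure M)).comp (algebraMap K M) →
      ∃ τ : L →+* M, σ = (algebraMap M (SeparableClosure M)).comp τ) :
    IsTamelyRamified (algebraMap K L) w := by
  obtain ⟨W, hW, hdeg⟩ := h
  let _ : Algebra K (SeparableClosure M) :=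
    ((algebraMap M (SeparableClosure M)).comp (algebraMap K M)).toAlgebra
  have : IsScalarTower K M (SeparableClosure M) := .of_algebraMap_eq fun _ => rfl
  have : Algebra.IsSeparable K (SeparableClosure M) := Algebra.IsSeparable.trans K M _
  have : IsSepClosure K (SeparableClosure M) := ⟨inferInstance, this⟩
  obtain ⟨W₁, hW₁⟩ := exists_comap_eq (algebraMap L (SeparableClosure L)) w
  let _ : Algebra K (SeparableClosure L) :=
    ((algebraMap L (SeparableClosure L)).comp (algebraMap K L)).toAlgebra
  have : IsScalarTower K L (SeparableClosure L) := .of_algebraMap_eq fun _ => rfl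
  have : Algebra.IsSeparable K (SeparableClosure L) := Algebra.IsSeparable.trans K L _
  have : IsSepClosure K (SeparableClosure L) := ⟨inferInstance, this⟩
  let θ₀ : SeparableClosure M ≃ₐ[K] SeparableClosure L := IsSepClosure.equiv K _ _
  -- Conjugating by `g` makes the chosen extension `W₁` of `w` correspond to `W`. The resulting
  -- embedding `σ` of `L` into the separable closure of `M` then satisfies `W.comap σ = w`.
  obtain ⟨g, hg⟩ := exists_algEquiv_comap_eq (K := K)
    (W₁.comap (θ₀ : SeparableClosure M →+* SeparableClosure L)) W (by
      rw [ValuationSubring.comap_comap]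
      have e1 : ((θ₀ : SeparableClosure M →+* SeparableClosure L)).comp
          (algebraMap K (SeparableClosure M)) =
          (algebraMap L (SeparableClosure L)).comp (algebraMap K L) := RingHom.ext θ₀.commutes
      rw [e1, ← ValuationSubring.comap_comap, hW₁, hww', ← hW, ValuationSubring.comap_comap]
      rfl)
  let σ : L →+* SeparableClosure M :=
    ((g : SeparableClosure M →+* SeparableClosure M).comp
      (θ₀.symm : SeparableClosure L →+* SeparableClosure M)).comp
        (algebraMap L (SeparableClosure L))
  have hσ : σ.comp (algebraMap K L) =
      (algebraMap M (SeparableClosure M)).comp (algebraMap K M) := by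
    refine RingHom.ext fun x => ?_
    exact (congr_arg g (θ₀.symm.commutes x)).trans (g.commutes x)
  have hσW : W.comap σ = w := by
    rw [← ValuationSubring.comap_comap, ← ValuationSubring.comap_comap, hg,
      ValuationSubring.comap_comap, ← hW₁]
    have e2 : (θ₀ : SeparableClosure M →+* SeparableClosure L).comp
        (θ₀.symm : SeparableClosure L →+* SeparableClosure M) = RingHom.id _ :=
      RingHom.ext θ₀.apply_symm_apply
    rw [ValuationSubring.comap_comap, ← RingHom.comp_assoc, e2, RingHom.id_comp]
  obtain ⟨τ, hτ⟩ := H σ hσ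
  have hτK : τ.comp (algebraMap K L) = algebraMap K M := by
    ext x
    have := RingHom.congr_fun hσ x
    rw [hτ] at this
    exact (algebraMap M (SeparableClosure M)).injective this
  let _ : Algebra L (SeparableClosure M) := σ.toAlgebra
  have : IsScalarTower K L (SeparableClosure M) :=
    .of_algebraMap_eq fun x => (RingHom.congr_fun hσ x).symm
  have : Algebra.IsSeparable L (SeparableClosure M) :=
    Algebra.isSeparable_tower_top_of_isSeparable K L _
  have : IsSepClosure L (SeparableClosure M) := ⟨inferInstance, this⟩
  refine isTamelyRamified_of_isSepClosure _ w W hσW ?_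
  rw [hww']
  refine hdeg.coprime_dvd_left ?_
  change Subfield.relfinrank (strictHenselizationField (σ.comp (algebraMap K L)) W)
    (strictHenselizationField σ W) ∣ _
  rw [hσ]
  -- As `σ` factors through `M`, the three strict henselizations form a tower in one field, and
  -- degrees multiply.
  refine Dvd.intro _ (Subfield.relfinrank_mul_relfinrank ?_ ?_)
  · rw [← hσ]; exact strictHenselizationField_comp_le _ _ _
  · rw [hτ]; exact strictHenselizationField_comp_le _ _ _

end Tower
end TameSite

/-! ### Étale schemes over `X`: morphisms and gluing. -/

namespace TameSite
noncomputable section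

variable {X : Scheme.{u}}

/-- A morphism of étale `X`-schemes. -/
def etaleHom {U V : X.Etale} (f : U.left ⟶ V.left) (w : f ≫ V.hom = U.hom) : U ⟶ V :=
  MorphismProperty.Over.homMk f w trivial

@[simp]
lemma etale_comp_left {U V W : X.Etale} (f : U ⟶ V) (g : V ⟶ W) :
    (f ≫ g).left = f.left ≫ g.left := rfl

lemma etale_comp_left_assoc {U V W : X.Etale} (f : U ⟶ V) (g : V ⟶ W) {Z : Scheme.{u}}
    (h : W.left ⟶ Z) : (f ≫ g).left ≫ h = f.left ≫ g.left ≫ h :=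
  Category.assoc f.left g.left h

@[simp]
lemma etale_id_left (U : X.Etale) : CommaMorphism.left (𝟙 U : U ⟶ U).toCommaMorphism = 𝟙 U.left := rfl

@[simp]
lemma etale_w {U V : X.Etale} (f : U ⟶ V) : f.left ≫ V.hom = U.hom :=
  CategoryTheory.Over.w f.toCommaMorphism

lemma etale_w_assoc {U V : X.Etale} (f : U ⟶ V) {Z : Scheme.{u}} (h : X ⟶ Z) :
    f.left ≫ V.hom ≫ h = U.hom ≫ h := by
  rw [← Category.assoc, etale_w]

lemma etale_hom_ext {U V : X.Etale} {f g : U ⟶ V} (h : f.left = g.left) : f = g :=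
  MorphismProperty.Over.Hom.ext h

/-- The étale `X`-scheme `U ⟶ V ⟶ X` for an étale morphism to an étale `X`-scheme `V`. -/
def etaleOver (V : X.Etale) {U : Scheme.{u}} (f : U ⟶ V.left) [Etale f] : X.Etale :=
  Scheme.Etale.mk (f ≫ V.hom)

/-- The structure morphism of `etaleOver V f`. -/
def etaleOverHom (V : X.Etale) {U : Scheme.{u}} (f : U ⟶ V.left) [Etale f] : etaleOver V f ⟶ V :=
  etaleHom f rfl

@[simp]
lemma etaleOverHom_left (V : X.Etale) {U : Scheme.{u}} (f : U ⟶ V.left) [Etale f] :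
    (etaleOverHom V f).left = f := rfl

open Limits in
/-- Morphisms to a scheme glue along jointly surjective families of étale morphisms. -/
theorem existsUnique_glue_hom {T : X.Etale} {I : Type u} (V : I → X.Etale) (p : ∀ i, V i ⟶ T)
    (hp : ∀ x : T.left, ∃ (i : I) (y : (V i).left), (p i).left y = x) {Y : Scheme.{u}}
    (f : ∀ i, (V i).left ⟶ Y)
    (hf : ∀ (i j : I) (Z : X.Etale) (a : Z ⟶ V i) (b : Z ⟶ V j), a ≫ p i = b ≫ p j →
      a.left ≫ f i = b.left ≫ f j) :
    ∃! g : T.left ⟶ Y, ∀ i, (p i).left ≫ g = f i := by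
  -- Jointly surjective étale families are fppf coverings, and the fppf topology is subcanonical.
  have hmem : Presieve.ofArrows (fun i => (V i).left) (fun i => (p i).left) ∈
      Scheme.fppfPrecoverage T.left := by
    refine (Scheme.ofArrows_mem_precoverage_iff _).2 ⟨fun x => ?_, fun i => ⟨?_, ?_⟩⟩
    · obtain ⟨i, y, hy⟩ := hp x
      exact ⟨i, y, hy⟩
    · exact inferInstance
    · exact inferInstance
  have h1 := (GrothendieckTopology.Subcanonical.isSheaf_of_isRepresentable
    (J := Scheme.fppfTopology) (yoneda.obj Y)).isSheafFor
      (Presieve.ofArrows (fun i => (V i).left) fun i => (p i).left)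
      (Precoverage.generate_mem_toGrothendieck hmem)
  rw [Presieve.isSheafFor_arrows_iff] at h1
  obtain ⟨g, hg, hu⟩ := h1 f (by
    intro i j Z a b hab
    -- The sheaf condition tests compatibility on arbitrary schemes. The fibre product is étale over
    -- `X` and universal among them, so étale test objects suffice.
    let P : X.Etale := etaleOver (V i) (pullback.fst (p i).left (p j).left)
    have := hf i j P (etaleOverHom _ _) (etaleHom (pullback.snd (p i).left (p j).left) (by
      change _ = pullback.fst (p i).left (p j).left ≫ (V i).hom
      rw [← etale_w (p i), ← etale_w (p j), pullback.condition_assoc]; rfl)) (etale_hom_ext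
        pullback.condition)
    have h2 := congr_arg (fun m => pullback.lift a b hab ≫ m) this
    simp only [etaleOverHom_left] at h2
    erw [pullback.lift_fst_assoc, pullback.lift_snd_assoc] at h2
    exact h2)
  exact ⟨g, hg, hu⟩

/-- Global functions glue along jointly surjective families of étale morphisms. -/
theorem existsUnique_glue_functions {T : X.Etale} {I : Type u} (V : I → X.Etale)
    (p : ∀ i, V i ⟶ T)
    (hp : ∀ x : T.left, ∃ (i : I) (y : (V i).left), (p i).left y = x)
    (f : ∀ i, Γ((V i).left, ⊤))
    (hf : ∀ (i j : I) (Z : X.Etale) (a : Z ⟶ V i) (b : Z ⟶ V j), a ≫ p i = b ≫ p j →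
      a.left.appTop (f i) = b.left.appTop (f j)) :
    ∃! g : Γ(T.left, ⊤), ∀ i, (p i).left.appTop g = f i := by
  -- Functions are morphisms to the affine line over `ℤ`, so this is a case of gluing morphisms.
  let e (Y : Scheme.{u}) := (AffineSpace.toSpecMvPolyIntEquiv (X := Y) PUnit.{u + 1}).trans
    (Equiv.funUnique PUnit.{u + 1} Γ(Y, ⊤))
  have he {Y Y' : Scheme.{u}} (a : Y ⟶ Y') (m) : e Y (a ≫ m) = a.appTop (e Y' m) := rfl
  have he' {Y Y' : Scheme.{u}} (a : Y ⟶ Y') (m) : (e Y).symm (a.appTop m) = a ≫ (e Y').symm m := by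
    rw [Equiv.symm_apply_eq, he, Equiv.apply_symm_apply]
  obtain ⟨g, hg, hu⟩ := existsUnique_glue_hom V p hp (fun i => (e _).symm (f i)) (by
    intro i j Z a b hab
    rw [← he', ← he', hf i j Z a b hab])
  refine ⟨e _ g, fun i => ?_, fun g' hg' => ?_⟩
  · dsimp only
    rw [← he, hg, Equiv.apply_symm_apply]
  · rw [← Equiv.symm_apply_eq]
    exact hu _ fun i => by rw [← he', hg']

lemma mem_zariskiTopologyOnEtale_iff {T : X.Etale} (S : Sieve T) :
    S ∈ zariskiTopologyOnEtale X T ↔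
      ∀ x : T.left, ∃ (V : X.Etale) (p : V ⟶ T) (y : V.left),
        S p ∧ IsOpenImmersion p.left ∧ p.left y = x := by
  have : MorphismProperty.IsStableUnderComposition @Etale.{u} :=
    (inferInstance : MorphismProperty.IsMultiplicative @Etale.{u}).toIsStableUnderComposition
  have h : @IsOpenImmersion.{u} ≤ @Etale.{u} := fun _ _ f hf => by
    have : IsOpenImmersion f := hf
    exact (inferInstance : Etale f)
  have e := Scheme.smallGrothendieckTopology_eq_toGrothendieck_smallPretopology
    (P := @IsOpenImmersion.{u}) (Q := @Etale.{u}) X h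
  exact (congrArg (fun J : GrothendieckTopology X.Etale => S ∈ J T)
    e).to_iff.trans (Scheme.mem_toGrothendieck_smallPretopology T S)

end
end TameSite

namespace TameSite
noncomputable section

variable {X : Scheme.{u}}

/-! ### Fibre products of étale schemes -/

section Pullback

open Limits

variable {T U V : X.Etale} (f : U ⟶ T) (g : V ⟶ T)

/-- The fibre product of étale `X`-schemes. -/
def etalePullback : X.Etale := etaleOver U (pullback.fst f.left g.left)

/-- The first projection. -/
def etaleFst : etalePullback f g ⟶ U := etaleOverHom U (pullback.fst f.left g.left)

/-- The second projection. -/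
def etaleSnd : etalePullback f g ⟶ V := etaleHom (pullback.snd f.left g.left) (by
  change _ = pullback.fst f.left g.left ≫ U.hom
  rw [← etale_w f, ← etale_w g, pullback.condition_assoc]; rfl)

lemma etalePullback_condition : etaleFst f g ≫ f = etaleSnd f g ≫ g :=
  etale_hom_ext pullback.condition

lemma isPullback_etalePullback :
    IsPullback (etaleFst f g).left (etaleSnd f g).left f.left g.left :=
  IsPullback.of_hasPullback f.left g.left

variable {f g}

lemma exists_etalePullback_lift {Z : X.Etale} (a : Z ⟶ U) (b : Z ⟶ V) (h : a ≫ f = b ≫ g) :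
    ∃ l : Z ⟶ etalePullback f g, l ≫ etaleFst f g = a ∧ l ≫ etaleSnd f g = b := by
  have h' : a.left ≫ f.left = b.left ≫ g.left := by
    rw [← etale_comp_left, h, etale_comp_left]
  let m : Z.left ⟶ (etalePullback f g).left := (isPullback_etalePullback f g).lift a.left b.left h'
  have hm : m ≫ (etaleFst f g).left = a.left := (isPullback_etalePullback f g).lift_fst _ _ h'
  have hm' : m ≫ (etaleSnd f g).left = b.left := (isPullback_etalePullback f g).lift_snd _ _ h'
  refine ⟨etaleHom m ?_, etale_hom_ext hm, etale_hom_ext hm'⟩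
  rw [← etale_w (etaleFst f g), ← etale_w a, reassoc_of% hm]

lemma exists_etalePullback_point (x : U.left) (y : V.left) (h : f.left x = g.left y) :
    ∃ z : (etalePullback f g).left, (etaleFst f g).left z = x ∧ (etaleSnd f g).left z = y :=
  Scheme.Pullback.exists_preimage_pullback x y h

end Pullback

/-! ### Global functions -/

/-- The ring of global functions of an étale `X`-scheme. -/
abbrev fn (V : X.Etale) : Type u := Γ(V.left, ⊤)

/-- Pullback of global functions. -/
def fnMap {U V : X.Etale} (p : U ⟶ V) : fn V →+* fn U := p.left.appTop.hom

@[simp]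
lemma fnMap_id (V : X.Etale) (f : fn V) : fnMap (𝟙 V) f = f := by
  simp [fnMap]

lemma fnMap_comp {U V W : X.Etale} (p : U ⟶ V) (q : V ⟶ W) (f : fn W) :
    fnMap (p ≫ q) f = fnMap p (fnMap q f) := by
  simp only [fnMap, etale_comp_left, Scheme.Hom.comp_appTop]; rfl

lemma existsUnique_glue_fn {T : X.Etale} {I : Type u} (V : I → X.Etale) (p : ∀ i, V i ⟶ T)
    (hp : ∀ x : T.left, ∃ (i : I) (y : (V i).left), (p i).left y = x) (f : ∀ i, fn (V i))
    (hf : ∀ (i j : I) (Z : X.Etale) (a : Z ⟶ V i) (b : Z ⟶ V j), a ≫ p i = b ≫ p j →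
      fnMap a (f i) = fnMap b (f j)) : ∃! g : fn T, ∀ i, fnMap (p i) g = f i :=
  existsUnique_glue_functions V p hp f hf

lemma fn_ext {T : X.Etale} {f g : fn T}
    (h : ∀ x : T.left, ∃ (V : X.Etale) (p : V ⟶ T) (y : V.left), p.left y = x ∧
      fnMap p f = fnMap p g) : f = g := by
  choose V p y hy hp using h
  obtain ⟨_, _, hu⟩ := existsUnique_glue_fn V p (fun x => ⟨x, y x, hy x⟩)
    (fun x => fnMap (p x) f) (by
      intro i j Z a b hab
      rw [← fnMap_comp, ← fnMap_comp, hab])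
  rw [hu f fun i => rfl, hu g fun i => (hp i).symm]

lemma fn_eq_of_isEmpty {T : X.Etale} (h : IsEmpty T.left) (f g : fn T) : f = g :=
  fn_ext fun x => h.elim x

/-! ### The ring of functions on the functor -/

variable (F : X.Etaleᵒᵖ ⥤ AddCommGrpCat.{u + 1})

/-- Restriction of sections. -/
def res {U V : X.Etale} (p : U ⟶ V) : F.obj (op V) →+ F.obj (op U) := (F.map p.op).hom

@[simp]
lemma res_id (V : X.Etale) (s : F.obj (op V)) : res F (𝟙 V) s = s := by
  simp [res]

lemma res_comp {U V W : X.Etale} (p : U ⟶ V) (q : V ⟶ W) (s : F.obj (op W)) :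
    res F (p ≫ q) s = res F p (res F q s) := by
  simp [res]

/-- The ring of morphisms of functors from the restriction of `F` to `U` to the structure sheaf. -/
def HomRing (U : X.Etale) : Subring (∀ V : X.Etale, (V ⟶ U) → F.obj (op V) → fn V) where
  carrier := {φ | ∀ (V V' : X.Etale) (q : V' ⟶ V) (p : V ⟶ U) (s : F.obj (op V)),
    φ V' (q ≫ p) (res F q s) = fnMap q (φ V p s)}
  mul_mem' h h' _ _ q p s := by simp [h _ _ q p s, h' _ _ q p s]
  one_mem' _ _ q p _ := by simp
  add_mem' h h' _ _ q p s := by simp [h _ _ q p s, h' _ _ q p s]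
  zero_mem' _ _ q p _ := by simp
  neg_mem' h _ _ q p s := by simp [h _ _ q p s]

namespace HomRing

variable {F} {U : X.Etale}

/-- Evaluation at a section. -/
def eval {V : X.Etale} (p : V ⟶ U) (s : F.obj (op V)) : HomRing F U →+* fn V where
  toFun φ := φ.1 V p s
  map_one' := rfl
  map_mul' _ _ := rfl
  map_zero' := rfl
  map_add' _ _ := rfl

lemma eval_res {V V' : X.Etale} (q : V' ⟶ V) (p : V ⟶ U) (s : F.obj (op V)) (φ : HomRing F U) :
    eval (q ≫ p) (res F q s) φ = fnMap q (eval p s φ) :=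
  φ.2 V V' q p s

@[ext]
lemma ext {φ ψ : HomRing F U}
    (h : ∀ (V : X.Etale) (p : V ⟶ U) (s : F.obj (op V)), eval p s φ = eval p s ψ) : φ = ψ :=
  Subtype.ext <| funext fun V => funext fun p => funext fun s => h V p s

/-- Restriction along a morphism `U' ⟶ U`. -/
def map {U' : X.Etale} (q : U' ⟶ U) : HomRing F U →+* HomRing F U' where
  toFun φ := ⟨fun V p s => eval (p ≫ q) s φ, fun V V' r p s => by
    change eval ((r ≫ p) ≫ q) (res F r s) φ = fnMap r (eval (p ≫ q) s φ)
    rw [Category.assoc, eval_res]⟩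
  map_one' := rfl
  map_mul' _ _ := rfl
  map_zero' := rfl
  map_add' _ _ := rfl

lemma eval_map {U' : X.Etale} (q : U' ⟶ U) {V : X.Etale} (p : V ⟶ U') (s : F.obj (op V))
    (φ : HomRing F U) : eval p s (map q φ) = eval (p ≫ q) s φ := rfl

variable (F U) in
/-- The constant functions. -/
def const : fn U →+* HomRing F U where
  toFun r := ⟨fun _ p _ => fnMap p r, fun _ _ q p _ => fnMap_comp q p r⟩
  map_one' := ext fun _ p _ => (fnMap p).map_one
  map_mul' a b := ext fun _ p _ => (fnMap p).map_mul a b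
  map_zero' := ext fun _ p _ => (fnMap p).map_zero
  map_add' a b := ext fun _ p _ => (fnMap p).map_add a b

lemma ext_of_cover {φ ψ : HomRing F U}
    (h : ∀ x : U.left, ∃ (V : X.Etale) (p : V ⟶ U) (y : V.left), p.left y = x ∧
      map p φ = map p ψ) : φ = ψ := by
  refine ext fun V p s => fn_ext fun x => ?_
  obtain ⟨W, q, y, hy, hq⟩ := h (p.left x)
  obtain ⟨z, hz, -⟩ := exists_etalePullback_point (f := p) (g := q) x y hy.symm
  refine ⟨etalePullback p q, etaleFst p q, z, hz, ?_⟩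
  rw [← eval_res, ← eval_res, etalePullback_condition, ← eval_map, ← eval_map, hq]

/-- Functions glue along jointly surjective families. -/
theorem exists_glue {J : Type u} (W : J → X.Etale) (p : ∀ j, W j ⟶ U)
    (hp : ∀ x : U.left, ∃ (j : J) (y : (W j).left), (p j).left y = x)
    (φ : ∀ j, HomRing F (W j))
    (hφ : ∀ j k, map (etaleFst (p j) (p k)) (φ j) = map (etaleSnd (p j) (p k)) (φ k)) :
    ∃ ψ : HomRing F U, ∀ j, map (p j) ψ = φ j := by
  have hφ' (j k) (Z : X.Etale) (a : Z ⟶ W j) (b : Z ⟶ W k) (hab : a ≫ p j = b ≫ p k)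
      (s : F.obj (op Z)) : eval a s (φ j) = eval b s (φ k) := by
    obtain ⟨l, rfl, rfl⟩ := exists_etalePullback_lift a b hab
    rw [← eval_map, ← eval_map, hφ]
  -- The value at a section `s` over `V` is glued from the values of the `φ j` on the pulled-back
  -- cover of `V`. Characterizing it on all `Z` at once makes naturality in `V` a consequence of
  -- uniqueness.
  have key (V : X.Etale) (r : V ⟶ U) (s : F.obj (op V)) : ∃! g : fn V,
      ∀ (Z : X.Etale) (z : Z ⟶ V) (j) (b : Z ⟶ W j), z ≫ r = b ≫ p j →
        fnMap z g = eval b (res F z s) (φ j) := by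
    have hcov (x : V.left) : ∃ (j : J) (y : (etalePullback r (p j)).left),
        (etaleFst r (p j)).left y = x := by
      obtain ⟨j, y, hy⟩ := hp (r.left x)
      obtain ⟨z, hz, -⟩ := exists_etalePullback_point (f := r) (g := p j) x y hy.symm
      exact ⟨j, z, hz⟩
    obtain ⟨g, hg, hu⟩ := existsUnique_glue_fn (fun j => etalePullback r (p j))
      (fun j => etaleFst r (p j)) hcov
      (fun j => eval (etaleSnd r (p j)) (res F (etaleFst r (p j)) s) (φ j)) (by
        intro j k Z a b hab
        rw [← eval_res, ← eval_res, ← res_comp, ← res_comp, hab]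
        apply hφ'
        rw [Category.assoc, Category.assoc, ← etalePullback_condition,
          ← etalePullback_condition, reassoc_of% hab])
    refine ⟨g, fun Z z j b h => ?_, fun g' hg' => hu _ fun j => ?_⟩
    · obtain ⟨l, hl, rfl⟩ := exists_etalePullback_lift z b h
      have := hg j
      rw [← hl, fnMap_comp, this, ← eval_res, res_comp]
    · exact hg' _ _ j _ (etalePullback_condition _ _)
  choose g hg hu using key
  refine ⟨⟨g, fun V V' q r s => ?_⟩, fun j => ext fun V r s => ?_⟩
  · refine (hu _ _ _ _ fun Z z j b h => ?_).symm
    rw [← fnMap_comp, hg _ _ _ _ _ j b (by simpa using h), res_comp]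
  · rw [eval_map]
    refine (fnMap_id _ _).symm.trans ((hg V (r ≫ p j) s V (𝟙 V) j r (by simp)).trans ?_)
    rw [res_id]

end HomRing

/-! ### Charts -/

/-- A finite family of sections of `F` over `W` is a chart if it identifies the restriction of `F`
to `W` with a constant Zariski sheaf. -/
structure IsChart (W : X.Etale) {n : ℕ} (c : Fin n → F.obj (op W)) : Prop where
  locally_eq : ∀ (V : X.Etale) (p : V ⟶ W) (s : F.obj (op V)) (v : V.left),
    ∃ (V' : X.Etale) (q : V' ⟶ V) (v' : V'.left) (a : Fin n), IsOpenImmersion q.left ∧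
      q.left v' = v ∧ res F q s = res F (q ≫ p) (c a)
  injective : ∀ (V : X.Etale) (p : V ⟶ W) (a b : Fin n), Nonempty V.left →
    res F p (c a) = res F p (c b) → a = b

namespace IsChart

variable {F} {W : X.Etale} {n : ℕ} {c : Fin n → F.obj (op W)}

lemma restrict (h : IsChart F W c) {W' : X.Etale} (q : W' ⟶ W) :
    IsChart F W' fun a => res F q (c a) where
  locally_eq V p s v := by
    obtain ⟨V', r, v', a, hr, hv, hs⟩ := h.locally_eq V (p ≫ q) s v
    exact ⟨V', r, v', a, hr, hv, by rw [hs, ← res_comp, Category.assoc]⟩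
  injective V p a b hV hab := h.injective V (p ≫ q) a b hV (by simpa only [← res_comp] using hab)

/-- Every section is locally a restriction of some `c a`, so naturality determines all values from
those at the `c a`. -/
lemma homRing_ext (h : IsChart F W c) {φ ψ : HomRing F W}
    (H : ∀ a, HomRing.eval (𝟙 W) (c a) φ = HomRing.eval (𝟙 W) (c a) ψ) : φ = ψ := by
  refine HomRing.ext fun V p s => fn_ext fun v => ?_
  obtain ⟨V', q, v', a, -, hv, hs⟩ := h.locally_eq V p s v
  refine ⟨V', q, v', hv, ?_⟩
  have (χ : HomRing F W) :
      fnMap q (HomRing.eval p s χ) = fnMap (q ≫ p) (HomRing.eval (𝟙 W) (c a) χ) := by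
    rw [← HomRing.eval_res, ← HomRing.eval_res, hs, Category.comp_id]
  rw [this, this, H]

/-- The value at a section is forced to be `f a` wherever the section agrees with `c a`. These local
values glue because the label `a` is unique on nonempty schemes. -/
lemma exists_homRing (h : IsChart F W c) (f : Fin n → fn W) :
    ∃ φ : HomRing F W, ∀ a, HomRing.eval (𝟙 W) (c a) φ = f a := by
  have key (V : X.Etale) (p : V ⟶ W) (s : F.obj (op V)) : ∃! g : fn V,
      ∀ (Z : X.Etale) (z : Z ⟶ V) (a : Fin n), res F z s = res F (z ≫ p) (c a) →
        fnMap z g = fnMap (z ≫ p) (f a) := by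
    choose V' q v' a ho hv hs using h.locally_eq V p s
    have hcomp (Z : X.Etale) (z : Z ⟶ V) (a b : Fin n) (ha : res F z s = res F (z ≫ p) (c a))
        (hb : res F z s = res F (z ≫ p) (c b)) : fnMap (z ≫ p) (f a) = fnMap (z ≫ p) (f b) := by
      -- The label need not be unique over the empty scheme, but all functions there coincide.
      rcases isEmpty_or_nonempty Z.left with hZ | hZ
      · exact fn_eq_of_isEmpty hZ _ _
      · rw [h.injective Z (z ≫ p) a b hZ (ha.symm.trans hb)]
    have hcov (x : V.left) : ∃ (i : V.left) (y : (V' i).left), (q i).left y = x :=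
      ⟨x, v' x, hv x⟩
    have hglue (v w : V.left) (Z : X.Etale) (x : Z ⟶ V' v) (y : Z ⟶ V' w)
        (hxy : x ≫ q v = y ≫ q w) :
        fnMap x (fnMap (q v ≫ p) (f (a v))) = fnMap y (fnMap (q w ≫ p) (f (a w))) := by
      have h1 : res F (x ≫ q v) s = res F ((x ≫ q v) ≫ p) (c (a v)) := by
        rw [res_comp, hs, ← res_comp, Category.assoc]
      have h2 : res F (x ≫ q v) s = res F ((x ≫ q v) ≫ p) (c (a w)) := by
        rw [hxy, res_comp, hs, ← res_comp, Category.assoc]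
      rw [← fnMap_comp, ← fnMap_comp, ← Category.assoc, ← Category.assoc, ← hxy]
      exact hcomp _ _ _ _ h1 h2
    obtain ⟨g, hg, hu⟩ := existsUnique_glue_fn V' q hcov
      (fun v => fnMap (q v ≫ p) (f (a v))) hglue
    refine ⟨g, fun Z z b hb => fn_ext fun x => ?_, fun g' hg' => hu _ fun v => hg' _ _ _ (hs v)⟩
    obtain ⟨t, ht, -⟩ := exists_etalePullback_point (f := z) (g := q (z.left x)) x
      (v' (z.left x)) (hv _).symm
    refine ⟨_, etaleFst z (q (z.left x)), t, ht, ?_⟩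
    have h1 := hg (z.left x)
    rw [← fnMap_comp, etalePullback_condition, fnMap_comp, h1, ← fnMap_comp, ← fnMap_comp,
      ← Category.assoc, ← Category.assoc, ← etalePullback_condition]
    apply hcomp
    · rw [etalePullback_condition, res_comp, hs, ← res_comp, Category.assoc]
    · rw [res_comp, hb, ← res_comp, Category.assoc]
  choose g hg hu using key
  refine ⟨⟨g, fun V V' q p s => (hu _ _ _ _ fun Z z a ha => ?_).symm⟩, fun a => ?_⟩
  · rw [← fnMap_comp, hg _ _ _ _ _ a (by rw [res_comp, ha, Category.assoc]), Category.assoc]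
  · have := hg W (𝟙 W) (c a) W (𝟙 W) a (by simp)
    refine (fnMap_id W _).symm.trans (this.trans ?_)
    rw [Category.comp_id, fnMap_id]

/-- The ring of functions over a chart is a product of copies of the base. -/
def homRingEquiv (h : IsChart F W c) : HomRing F W ≃+* (Fin n → fn W) :=
  RingEquiv.ofBijective (RingHom.pi fun a => HomRing.eval (𝟙 W) (c a))
    ⟨fun _ _ e => h.homRing_ext fun a => congr_fun e a, fun f =>
      (h.exists_homRing f).imp fun _ e => funext e⟩

end IsChart

/-- `F` is locally constant with finite fibres, for the étale topology. -/
class HasCharts : Prop where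
  exists_chart : ∀ x : X, ∃ (W : X.Etale) (w : W.left) (n : ℕ) (c : Fin n → F.obj (op W)),
    W.hom w = x ∧ IsChart F W c

lemma exists_isAffine_chart [HasCharts F] (T : X.Etale) (x : T.left) :
    ∃ (W : X.Etale) (p : W ⟶ T) (w : W.left) (n : ℕ) (c : Fin n → F.obj (op W)),
      IsAffine W.left ∧ p.left w = x ∧ IsChart F W c := by
  obtain ⟨W, w, n, c, hw, hc⟩ := HasCharts.exists_chart (F := F) (T.hom x)
  let Z : X.Etale := etaleOver T (Limits.pullback.fst T.hom W.hom)
  let q : Z ⟶ W := etaleHom (Limits.pullback.snd T.hom W.hom) Limits.pullback.condition.symm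
  obtain ⟨z, hz, -⟩ := Scheme.Pullback.exists_preimage_pullback (f := T.hom) (g := W.hom) x w hw.symm
  obtain ⟨_, ⟨V, hV, rfl⟩, hzV, -⟩ := Z.left.isBasis_affineOpens.exists_subset_of_mem_open
    (Set.mem_univ z) isOpen_univ
  refine ⟨etaleOver Z (Scheme.Opens.ι V), etaleOverHom Z (Scheme.Opens.ι V) ≫ etaleOverHom T (Limits.pullback.fst T.hom W.hom),
    ⟨z, hzV⟩, n, _, hV, ?_, hc.restrict (etaleOverHom Z (Scheme.Opens.ι V) ≫ q)⟩
  rw [etale_comp_left]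
  exact hz

/-- Natural maps are indexed by the large category of étale schemes, but they are determined by
their values on chart sections around the points of `U`. Smallness is what allows a spectrum in the
universe of `X`. -/
instance [HasCharts F] (U : X.Etale) : Small.{u} (HomRing F U) := by
  choose W p w n c _ hw hc using exists_isAffine_chart F U
  refine small_of_injective (β := ∀ x, Fin (n x) → fn (W x))
    (f := fun φ x a => HomRing.eval (p x) (c x a) φ) fun φ ψ h => HomRing.ext_of_cover fun x =>
      ⟨W x, p x, w x, hw x, (hc x).homRing_ext fun a => ?_⟩
  rw [HomRing.eval_map, HomRing.eval_map, Category.id_comp]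
  exact congr_fun (congr_fun h x) a

end
end TameSite

/-! ### Flat base change of equalizers and finite powers of rings. -/

namespace TameSite
noncomputable section

lemma isPushout_iff_isBaseChange {R R' B B' : Type u} [CommRing R] [CommRing R'] [CommRing B]
    [CommRing B'] [Algebra R R'] [Algebra R B] [Algebra R' B'] [Algebra R B']
    [IsScalarTower R R' B'] (g : B →ₐ[R] B') :
    IsPushout (CommRingCat.ofHom (algebraMap R R')) (CommRingCat.ofHom (algebraMap R B))
      (CommRingCat.ofHom (algebraMap R' B')) (CommRingCat.ofHom g.toRingHom) ↔
    IsBaseChange R' g.toLinearMap := by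
  let _ : Algebra B B' := g.toRingHom.toAlgebra
  have _ : IsScalarTower R B B' := .of_algebraMap_eq fun x => (g.commutes x).symm
  have h1 := CommRingCat.isPushout_iff_isPushout (R := R) (R' := R') (S := B) (S' := B')
  refine h1.trans ((Algebra.IsPushout.comm (R := R) (S := R') (R' := B) (S' := B')).symm.symm.trans ?_)
  rw [Algebra.IsPushout.comm, Algebra.isPushout_iff]
  exact Iff.rfl

/-- Base change along flat ring homomorphisms commutes with equalizers. -/
theorem isBaseChange_of_exact {R R' B B' : Type u} [CommRing R] [CommRing R'] [CommRing B]
    [CommRing B'] [Algebra R R'] [Algebra R B] [Algebra R' B'] [Algebra R B']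
    [IsScalarTower R R' B'] [Module.Flat R R'] (g : B →ₐ[R] B')
    {J K : Type*} [Finite J] [Finite K] (l r : K → J)
    {C C' : J → Type u} {D D' : K → Type u} [∀ j, CommRing (C j)] [∀ j, CommRing (C' j)]
    [∀ k, CommRing (D k)] [∀ k, CommRing (D' k)]
    [∀ j, Algebra R (C j)] [∀ j, Algebra R (C' j)] [∀ j, Algebra R' (C' j)]
    [∀ j, IsScalarTower R R' (C' j)]
    [∀ k, Algebra R (D k)] [∀ k, Algebra R (D' k)] [∀ k, Algebra R' (D' k)]
    [∀ k, IsScalarTower R R' (D' k)]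
    (e : ∀ j, B →ₐ[R] C j) (e' : ∀ j, B' →ₐ[R'] C' j)
    (x : ∀ k, C (l k) →ₐ[R] D k) (x' : ∀ k, C' (l k) →ₐ[R'] D' k)
    (y : ∀ k, C (r k) →ₐ[R] D k) (y' : ∀ k, C' (r k) →ₐ[R'] D' k)
    (gC : ∀ j, C j →ₐ[R] C' j) (gD : ∀ k, D k →ₐ[R] D' k)
    (hC : ∀ j, IsBaseChange R' (gC j).toLinearMap)
    (hD : ∀ k, IsBaseChange R' (gD k).toLinearMap)
    (hge : ∀ j b, e' j (g b) = gC j (e j b))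
    (hx : ∀ k c, x' k (gC _ c) = gD k (x k c)) (hy : ∀ k c, y' k (gC _ c) = gD k (y k c))
    (hxy : ∀ k b, x k (e _ b) = y k (e _ b)) (hxy' : ∀ k b, x' k (e' _ b) = y' k (e' _ b))
    (he : ∀ b, (∀ j, e j b = 0) → b = 0) (he' : ∀ b, (∀ j, e' j b = 0) → b = 0)
    (hex : ∀ c : ∀ j, C j, (∀ k, x k (c _) = y k (c _)) → ∃ b, ∀ j, e j b = c j)
    (hex' : ∀ c : ∀ j, C' j, (∀ k, x' k (c _) = y' k (c _)) → ∃ b, ∀ j, e' j b = c j) :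
    IsBaseChange R' g.toLinearMap := by
  -- The equalizer is the kernel of the difference map between products. These products are finite,
  -- hence compatible with base change, and flatness preserves the kernel.
  refine IsBaseChange.of_left_exact R' g.toLinearMap
    (LinearMap.pi fun j => (gC j).toLinearMap ∘ₗ LinearMap.proj j)
    (LinearMap.pi fun k => (gD k).toLinearMap ∘ₗ LinearMap.proj k)
    (f := LinearMap.pi fun j => (e j).toLinearMap)
    (f' := LinearMap.pi fun j => (e' j).toLinearMap)
    (g := LinearMap.pi fun k => (x k).toLinearMap ∘ₗ LinearMap.proj (l k) -
      (y k).toLinearMap ∘ₗ LinearMap.proj (r k))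
    (g' := LinearMap.pi fun k => (x' k).toLinearMap ∘ₗ LinearMap.proj (l k) -
      (y' k).toLinearMap ∘ₗ LinearMap.proj (r k)) ?_ ?_ (IsBaseChange.pi _ hC) (IsBaseChange.pi _ hD)
      ?_ ?_ ?_ ?_
  · refine LinearMap.ext fun b => funext fun j => (hge j b).symm
  · refine LinearMap.ext fun c => funext fun k => ?_
    change gD k (x k (c _) - y k (c _)) = x' k (gC _ (c _)) - y' k (gC _ (c _))
    rw [map_sub, hx, hy]
  · intro c
    constructor
    · intro hc
      obtain ⟨b, hb⟩ := hex c fun k => sub_eq_zero.1 (congr_fun hc k)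
      exact ⟨b, funext hb⟩
    · rintro ⟨b, rfl⟩
      exact funext fun k => sub_eq_zero.2 (hxy k b)
  · exact (injective_iff_map_eq_zero _).2 fun b hb => he b fun j => congr_fun hb j
  · intro c
    constructor
    · intro hc
      obtain ⟨b, hb⟩ := hex' c fun k => sub_eq_zero.1 (congr_fun hc k)
      exact ⟨b, funext hb⟩
    · rintro ⟨b, rfl⟩
      exact funext fun k => sub_eq_zero.2 (hxy' k b)
  · exact (injective_iff_map_eq_zero _).2 fun b hb => he' b fun j => congr_fun hb j

lemma isBaseChange_of_equiv_pi {R R' A A' C C' : Type u} [CommRing R] [CommRing R'] [CommRing A]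
    [CommRing A'] [CommRing C] [CommRing C'] [Algebra R R'] [Algebra R A] [Algebra R A']
    [Algebra R' A'] [IsScalarTower R R' A'] [Algebra R C] [Algebra R C'] [Algebra R' C']
    [IsScalarTower R R' C'] {n : ℕ} (a : A →ₐ[R] A') (ha : IsBaseChange R' a.toLinearMap)
    (e : C ≃ₐ[R] (Fin n → A)) (e' : C' ≃ₐ[R'] (Fin n → A')) (g : C →ₐ[R] C')
    (h : ∀ c i, e' (g c) i = a (e c i)) : IsBaseChange R' g.toLinearMap := by
  have h1 := IsBaseChange.pi (fun _ : Fin n => a.toLinearMap) fun _ => ha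
  refine (IsBaseChange.iff_of_equiv_comm e.toLinearEquiv e'.toLinearEquiv
    (LinearMap.ext fun c => funext fun i => (h c i).symm)).2 h1

open CommRingCat in
/-- Pushouts along flat ring homomorphisms commute with equalizers. -/
theorem isPushout_of_exact {R R' B B' : Type u} [CommRing R] [CommRing R'] [CommRing B]
    [CommRing B'] (f : R →+* R') (b : R →+* B) (b' : R' →+* B') (g : B →+* B') (hf : f.Flat)
    (hg : ∀ s, g (b s) = b' (f s))
    {J K : Type*} [Finite J] [Finite K] (l r : K → J)
    {C C' : J → Type u} {D D' : K → Type u} [∀ j, CommRing (C j)] [∀ j, CommRing (C' j)]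
    [∀ k, CommRing (D k)] [∀ k, CommRing (D' k)]
    (e : ∀ j, B →+* C j) (e' : ∀ j, B' →+* C' j)
    (x : ∀ k, C (l k) →+* D k) (x' : ∀ k, C' (l k) →+* D' k)
    (y : ∀ k, C (r k) →+* D k) (y' : ∀ k, C' (r k) →+* D' k)
    (gC : ∀ j, C j →+* C' j) (gD : ∀ k, D k →+* D' k)
    (hC : ∀ j, IsPushout (ofHom f) (ofHom ((e j).comp b)) (ofHom ((e' j).comp b')) (ofHom (gC j)))
    (hD : ∀ k, IsPushout (ofHom f) (ofHom ((x k).comp ((e _).comp b)))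
      (ofHom ((x' k).comp ((e' _).comp b'))) (ofHom (gD k)))
    (hge : ∀ j b, e' j (g b) = gC j (e j b))
    (hx : ∀ k c, x' k (gC _ c) = gD k (x k c)) (hy : ∀ k c, y' k (gC _ c) = gD k (y k c))
    (hxy : ∀ k b, x k (e _ b) = y k (e _ b)) (hxy' : ∀ k b, x' k (e' _ b) = y' k (e' _ b))
    (he : ∀ b, (∀ j, e j b = 0) → b = 0) (he' : ∀ b, (∀ j, e' j b = 0) → b = 0)
    (hex : ∀ c : ∀ j, C j, (∀ k, x k (c _) = y k (c _)) → ∃ b, ∀ j, e j b = c j)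
    (hex' : ∀ c : ∀ j, C' j, (∀ k, x' k (c _) = y' k (c _)) → ∃ b, ∀ j, e' j b = c j) :
    IsPushout (ofHom f) (ofHom b) (ofHom b') (ofHom g) := by
  let _ := f.toAlgebra
  let _ := b.toAlgebra
  let _ := b'.toAlgebra
  let _ := (b'.comp f).toAlgebra
  let _ (j) : Algebra R (C j) := ((e j).comp b).toAlgebra
  let _ (j) : Algebra R' (C' j) := ((e' j).comp b').toAlgebra
  let _ (j) : Algebra R (C' j) := (((e' j).comp b').comp f).toAlgebra
  let _ (k) : Algebra R (D k) := ((x k).comp ((e _).comp b)).toAlgebra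
  let _ (k) : Algebra R' (D' k) := ((x' k).comp ((e' _).comp b')).toAlgebra
  let _ (k) : Algebra R (D' k) := (((x' k).comp ((e' _).comp b')).comp f).toAlgebra
  have : IsScalarTower R R' B' := .of_algebraMap_eq fun _ => rfl
  have hj (j : J) : IsScalarTower R R' (C' j) := .of_algebraMap_eq fun _ => rfl
  have hk (k : K) : IsScalarTower R R' (D' k) := .of_algebraMap_eq fun _ => rfl
  have : Module.Flat R R' := hf
  let gA : B →ₐ[R] B' := { g with commutes' := hg }
  let gCA (j) : C j →ₐ[R] C' j := { gC j with
    commutes' := fun s => by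
      change gC j (e j (b s)) = e' j (b' (f s))
      rw [← hge, hg] }
  let gDA (k) : D k →ₐ[R] D' k := { gD k with
    commutes' := fun s => by
      change gD k (x k (e _ (b s))) = x' k (e' _ (b' (f s)))
      rw [← hx, ← hge, hg] }
  refine (isPushout_iff_isBaseChange gA).2 (isBaseChange_of_exact gA l r
    (fun j => { e j with commutes' := fun _ => rfl }) (fun j => { e' j with commutes' := fun _ => rfl })
    (fun j => { x j with commutes' := fun _ => rfl }) (fun j => { x' j with commutes' := fun _ => rfl })
    (fun k => { y k with commutes' := fun s => (hxy k (b s)).symm })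
    (fun k => { y' k with commutes' := fun s => (hxy' k (b' s)).symm })
    gCA gDA (fun j => (isPushout_iff_isBaseChange (gCA j)).1 (hC j))
    (fun k => (isPushout_iff_isBaseChange (gDA k)).1 (hD k)) hge hx hy hxy hxy' he he' hex hex')

open CommRingCat in
lemma isPushout_of_equiv_pi {R R' A A' C C' : Type u} [CommRing R] [CommRing R'] [CommRing A]
    [CommRing A'] [CommRing C] [CommRing C'] (f : R →+* R') (s : R →+* A) (s' : R' →+* A')
    (a : A →+* A') (H : IsPushout (ofHom f) (ofHom s) (ofHom s') (ofHom a))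
    (b : R →+* C) (b' : R' →+* C') (g : C →+* C') (hg : ∀ s, g (b s) = b' (f s)) {n : ℕ}
    (e : C ≃+* (Fin n → A)) (e' : C' ≃+* (Fin n → A'))
    (he : ∀ x i, e (b x) i = s x) (he' : ∀ x i, e' (b' x) i = s' x)
    (h : ∀ c i, e' (g c) i = a (e c i)) :
    IsPushout (ofHom f) (ofHom b) (ofHom b') (ofHom g) := by
  let _ := f.toAlgebra
  let _ := s.toAlgebra
  let _ := s'.toAlgebra
  let _ := (s'.comp f).toAlgebra
  let _ := b.toAlgebra
  let _ := b'.toAlgebra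
  let _ := (b'.comp f).toAlgebra
  have : IsScalarTower R R' A' := .of_algebraMap_eq fun _ => rfl
  have : IsScalarTower R R' C' := .of_algebraMap_eq fun _ => rfl
  let aA : A →ₐ[R] A' := { a with
    commutes' := fun x => DFunLike.congr_fun (congrArg CommRingCat.Hom.hom H.w).symm x }
  let gA : C →ₐ[R] C' := { g with commutes' := hg }
  refine (isPushout_iff_isBaseChange gA).2 (isBaseChange_of_equiv_pi aA
    ((isPushout_iff_isBaseChange aA).1 H)
    { e with commutes' := fun x => funext (he x) }
    { e' with commutes' := fun x => funext (he' x) } gA h)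

variable {X : Scheme.{u}} (F : X.Etaleᵒᵖ ⥤ AddCommGrpCat.{u + 1}) [HasCharts F]

/-- The ring `HomRing F U`, in the universe of `X`. -/
def FunRing (U : X.Etale) : Type u := Shrink.{u} (HomRing F U)

instance (U : X.Etale) : CommRing (FunRing F U) := inferInstanceAs (CommRing (Shrink (HomRing F U)))

namespace FunRing

/-- The comparison of `FunRing F U` with `HomRing F U`. -/
def equiv (U : X.Etale) : FunRing F U ≃+* HomRing F U := Shrink.ringEquiv _

variable {F} {U : X.Etale}

/-- Evaluation at a section. -/
def eval {V : X.Etale} (p : V ⟶ U) (s : F.obj (op V)) : FunRing F U →+* fn V :=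
  (HomRing.eval p s).comp (equiv F U).toRingHom

/-- Restriction along a morphism. -/
def map {U' : X.Etale} (q : U' ⟶ U) : FunRing F U →+* FunRing F U' :=
  (equiv F U').symm.toRingHom.comp ((HomRing.map q).comp (equiv F U).toRingHom)

variable (F U) in
/-- The constant functions. -/
def const : fn U →+* FunRing F U := (equiv F U).symm.toRingHom.comp (HomRing.const F U)

lemma equiv_map {U' : X.Etale} (q : U' ⟶ U) (φ : FunRing F U) :
    equiv F U' (map q φ) = HomRing.map q (equiv F U φ) :=
  (equiv F U').apply_symm_apply _

lemma equiv_const (r : fn U) : equiv F U (const F U r) = HomRing.const F U r :=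
  (equiv F U).apply_symm_apply _

@[ext]
lemma ext {φ ψ : FunRing F U}
    (h : ∀ (V : X.Etale) (p : V ⟶ U) (s : F.obj (op V)), eval p s φ = eval p s ψ) : φ = ψ :=
  (equiv F U).injective <| HomRing.ext h

lemma eval_res {V V' : X.Etale} (q : V' ⟶ V) (p : V ⟶ U) (s : F.obj (op V)) (φ : FunRing F U) :
    eval (q ≫ p) (res F q s) φ = fnMap q (eval p s φ) :=
  HomRing.eval_res q p s _

lemma eval_map {U' : X.Etale} (q : U' ⟶ U) {V : X.Etale} (p : V ⟶ U') (s : F.obj (op V))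
    (φ : FunRing F U) : eval p s (map q φ) = eval (p ≫ q) s φ :=
  congrArg (HomRing.eval p s) (equiv_map q φ)

lemma eval_const {V : X.Etale} (p : V ⟶ U) (s : F.obj (op V)) (r : fn U) :
    eval p s (const F U r) = fnMap p r :=
  congrArg (HomRing.eval p s) (equiv_const r)

lemma map_const {U' : X.Etale} (q : U' ⟶ U) (r : fn U) :
    map q (const F U r) = const F U' (fnMap q r) :=
  ext fun V p s => by rw [eval_map, eval_const, eval_const, fnMap_comp]

lemma map_comp {U' U'' : X.Etale} (q : U' ⟶ U) (q' : U'' ⟶ U') (φ : FunRing F U) :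
    map (q' ≫ q) φ = map q' (map q φ) :=
  ext fun V p s => by rw [eval_map, eval_map, eval_map, Category.assoc]

lemma map_id (φ : FunRing F U) : map (𝟙 U) φ = φ :=
  ext fun V p s => by rw [eval_map, Category.comp_id]

lemma ext_of_cover {φ ψ : FunRing F U}
    (h : ∀ x : U.left, ∃ (V : X.Etale) (p : V ⟶ U) (y : V.left), p.left y = x ∧
      map p φ = map p ψ) : φ = ψ := by
  refine (equiv F U).injective (HomRing.ext_of_cover fun x => ?_)
  obtain ⟨V, p, y, hy, e⟩ := h x
  exact ⟨V, p, y, hy, by rw [← equiv_map, ← equiv_map, e]⟩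

theorem exists_glue {J : Type u} (W : J → X.Etale) (p : ∀ j, W j ⟶ U)
    (hp : ∀ x : U.left, ∃ (j : J) (y : (W j).left), (p j).left y = x)
    (φ : ∀ j, FunRing F (W j))
    (hφ : ∀ j k, map (etaleFst (p j) (p k)) (φ j) = map (etaleSnd (p j) (p k)) (φ k)) :
    ∃ ψ : FunRing F U, ∀ j, map (p j) ψ = φ j := by
  obtain ⟨ψ, hψ⟩ := HomRing.exists_glue W p hp (fun j => equiv F _ (φ j)) fun j k => by
    rw [← equiv_map, ← equiv_map, hφ]
  exact ⟨(equiv F U).symm ψ, fun j => (equiv F _).injective (by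
    rw [equiv_map, RingEquiv.apply_symm_apply, hψ])⟩

end FunRing

/-- The ring of functions over a chart is a product of copies of the base. -/
def IsChart.funRingEquiv {F : X.Etaleᵒᵖ ⥤ AddCommGrpCat.{u + 1}} [HasCharts F] {W : X.Etale} {n : ℕ}
    {c : Fin n → F.obj (op W)} (h : IsChart F W c) : FunRing F W ≃+* (Fin n → fn W) :=
  (FunRing.equiv F W).trans h.homRingEquiv

lemma IsChart.funRingEquiv_apply {F : X.Etaleᵒᵖ ⥤ AddCommGrpCat.{u + 1}} [HasCharts F]
    {W : X.Etale} {n : ℕ} {c : Fin n → F.obj (op W)} (h : IsChart F W c) (φ : FunRing F W)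
    (a : Fin n) : h.funRingEquiv φ a = FunRing.eval (𝟙 W) (c a) φ := rfl


/-! ### Quasi-coherence -/

section

open Limits CommRingCat

variable {F}

lemma isPushout_fnMap {P U V T : X.Etale} [IsAffine U.left] [IsAffine V.left] [IsAffine T.left]
    {a : P ⟶ U} {b : P ⟶ V} {f : U ⟶ T} {g : V ⟶ T}
    (h : IsPullback a.left b.left f.left g.left) :
    IsPushout (ofHom (fnMap f)) (ofHom (fnMap g)) (ofHom (fnMap a)) (ofHom (fnMap b)) :=
  isPushout_appTop_of_isPullback h

instance {U V T : X.Etale} (f : U ⟶ T) (g : V ⟶ T) [IsAffine U.left] [IsAffine V.left]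
    [IsAffine T.left] : IsAffine (etalePullback f g).left :=
  inferInstanceAs (IsAffine (pullback f.left g.left))

lemma flat_fnMap {U V : X.Etale} [IsAffine U.left] [IsAffine V.left] (q : U ⟶ V) :
    (fnMap q).Flat :=
  HasRingHomProperty.appTop (P := @Flat) q.left inferInstance

/-- Over `W` and over `P` the rings of functions are powers of the base rings with the same index
set, so the claim reduces to the cartesian square of affine schemes itself. -/
lemma IsChart.isPushout {P W U' U : X.Etale} [IsAffine W.left] [IsAffine U.left] [IsAffine U'.left]
    {a : P ⟶ U'} {b : P ⟶ W} {q : U' ⟶ U} {p : W ⟶ U}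
    (h : IsPullback a.left b.left q.left p.left) {n : ℕ} {c : Fin n → F.obj (op W)}
    (hc : IsChart F W c) :
    IsPushout (ofHom (fnMap q)) (ofHom ((FunRing.const F W).comp (fnMap p)))
      (ofHom ((FunRing.const F P).comp (fnMap a))) (ofHom (FunRing.map b)) := by
  have e : a ≫ q = b ≫ p := etale_hom_ext h.w
  refine isPushout_of_equiv_pi _ _ _ _ (isPushout_fnMap h) _ _ _ (fun s => ?_) hc.funRingEquiv
    (hc.restrict b).funRingEquiv (fun r i => ?_) (fun r i => ?_) (fun φ i => ?_)
  · change FunRing.map b (FunRing.const F W (fnMap p s)) = FunRing.const F P (fnMap a (fnMap q s))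
    rw [FunRing.map_const, ← fnMap_comp, ← fnMap_comp, e]
  · exact (FunRing.eval_const _ _ _).trans (fnMap_id _ _)
  · exact (FunRing.eval_const _ _ _).trans (fnMap_id _ _)
  · rw [IsChart.funRingEquiv_apply, IsChart.funRingEquiv_apply, FunRing.eval_map,
      ← FunRing.eval_res, Category.id_comp, Category.comp_id]

/-- A morphism to a fibre product. -/
def etaleLift {T U V Z : X.Etale} {f : U ⟶ T} {g : V ⟶ T} (a : Z ⟶ U) (b : Z ⟶ V)
    (h : a ≫ f = b ≫ g) : Z ⟶ etalePullback f g :=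
  (exists_etalePullback_lift a b h).choose

@[simp]
lemma etaleLift_fst {T U V Z : X.Etale} {f : U ⟶ T} {g : V ⟶ T} (a : Z ⟶ U) (b : Z ⟶ V)
    (h : a ≫ f = b ≫ g) : etaleLift a b h ≫ etaleFst f g = a :=
  (exists_etalePullback_lift a b h).choose_spec.1

@[simp]
lemma etaleLift_fst_assoc {T U V Z W : X.Etale} {f : U ⟶ T} {g : V ⟶ T} (a : Z ⟶ U)
    (b : Z ⟶ V) (h : a ≫ f = b ≫ g) (k : U ⟶ W) :
    etaleLift a b h ≫ etaleFst f g ≫ k = a ≫ k := by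
  rw [← Category.assoc, etaleLift_fst]

@[simp]
lemma etaleLift_snd {T U V Z : X.Etale} {f : U ⟶ T} {g : V ⟶ T} (a : Z ⟶ U) (b : Z ⟶ V)
    (h : a ≫ f = b ≫ g) : etaleLift a b h ≫ etaleSnd f g = b :=
  (exists_etalePullback_lift a b h).choose_spec.2

@[simp]
lemma etaleLift_snd_assoc {T U V Z W : X.Etale} {f : U ⟶ T} {g : V ⟶ T} (a : Z ⟶ U)
    (b : Z ⟶ V) (h : a ≫ f = b ≫ g) (k : V ⟶ W) :
    etaleLift a b h ≫ etaleSnd f g ≫ k = b ≫ k := by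
  rw [← Category.assoc, etaleLift_snd]

lemma etalePullback_hom_ext {T U V Z : X.Etale} {f : U ⟶ T} {g : V ⟶ T}
    {a b : Z ⟶ etalePullback f g} (h : a ≫ etaleFst f g = b ≫ etaleFst f g)
    (h' : a ≫ etaleSnd f g = b ≫ etaleSnd f g) : a = b :=
  etale_hom_ext <| (isPullback_etalePullback f g).hom_ext
    (by rw [← etale_comp_left, h, etale_comp_left])
    (by rw [← etale_comp_left, h', etale_comp_left])

-- Étale morphisms are open and `U` is quasi-compact. Finiteness is needed because only finite
-- products commute with base change.
variable (F) in
lemma exists_finite_chart_cover (U : X.Etale) [IsAffine U.left] :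
    ∃ (J : Type u) (_ : Finite J) (W : J → X.Etale) (p : ∀ j, W j ⟶ U) (n : J → ℕ)
      (c : ∀ j, Fin (n j) → F.obj (op (W j))), (∀ j, IsAffine (W j).left) ∧
      (∀ j, IsChart F (W j) (c j)) ∧
      ∀ x : U.left, ∃ (j : J) (y : (W j).left), (p j).left y = x := by
  choose W p w n c hW hw hc using exists_isAffine_chart F U
  have hopen (x : U.left) : IsOpen (Set.range (p x).left) := by
    have : Etale (p x).left := inferInstance
    exact (p x).left.isOpenMap.isOpen_range
  obtain ⟨t, ht⟩ := isCompact_univ.elim_finite_subcover (fun x => Set.range (p x).left) hopen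
    fun x _ => Set.mem_iUnion.2 ⟨x, w x, hw x⟩
  refine ⟨t, inferInstance, fun j => W j, fun j => p j, fun j => n j, fun j => c j,
    fun j => hW j, fun j => hc j, fun x => ?_⟩
  obtain ⟨j, hj, y, hy⟩ := Set.mem_iUnion₂.1 (ht (Set.mem_univ x))
  exact ⟨⟨j, hj⟩, y, hy⟩

/-- The rings `FunRing F U` form a quasi-coherent algebra on the affine étale site. -/
theorem FunRing.isPushout_map {U U' : X.Etale} (q : U' ⟶ U) [IsAffine U.left] [IsAffine U'.left] :
    IsPushout (ofHom (fnMap q)) (ofHom (FunRing.const F U)) (ofHom (FunRing.const F U'))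
      (ofHom (FunRing.map q)) := by
  obtain ⟨J, _, W, p, n, c, hW, hc, hcov⟩ := exists_finite_chart_cover F U
  let x (k : J × J) := etaleFst (p k.1) (p k.2)
  -- The ring of functions over `U` is the equalizer of those over the `W j` and their overlaps.
  -- Pulling this diagram back along `q` gives the `W' j` and `Z' k`, for which the corresponding
  -- equalizer is the ring over `U'`. The overlaps carry charts too, restricted from the first
  -- factor.
  let y (k : J × J) := etaleSnd (p k.1) (p k.2)
  have hxyp (k) : x k ≫ p k.1 = y k ≫ p k.2 := etalePullback_condition _ _
  let W' (j : J) := etalePullback q (p j)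
  let p' (j : J) : W' j ⟶ U' := etaleFst q (p j)
  let b (j : J) : W' j ⟶ W j := etaleSnd q (p j)
  have hW' (j) : p' j ≫ q = b j ≫ p j := etalePullback_condition _ _
  let Z' (k : J × J) := etalePullback q (x k ≫ p k.1)
  let u (k) : Z' k ⟶ U' := etaleFst q (x k ≫ p k.1)
  let d (k) : Z' k ⟶ etalePullback (p k.1) (p k.2) := etaleSnd q (x k ≫ p k.1)
  have hZ' (k) : u k ≫ q = d k ≫ x k ≫ p k.1 := etalePullback_condition _ _
  let x' (k : J × J) : Z' k ⟶ W' k.1 := etaleLift (u k) (d k ≫ x k) (by simp [hZ'])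
  let y' (k : J × J) : Z' k ⟶ W' k.2 := etaleLift (u k) (d k ≫ y k) (by simp [hZ', hxyp])
  have hx'p (k) : x' k ≫ p' k.1 = u k := etaleLift_fst _ _ _
  have hy'p (k) : y' k ≫ p' k.2 = u k := etaleLift_fst _ _ _
  have hx'b (k) : x' k ≫ b k.1 = d k ≫ x k := etaleLift_snd _ _ _
  have hy'b (k) : y' k ≫ b k.2 = d k ≫ y k := etaleLift_snd _ _ _
  have hcov' (z : U'.left) : ∃ (j : J) (y : (W' j).left), (p' j).left y = z := by
    obtain ⟨j, t, ht⟩ := hcov (q.left z)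
    obtain ⟨s, hs, -⟩ := exists_etalePullback_point (f := q) (g := p j) z t ht.symm
    exact ⟨j, s, hs⟩
  refine isPushout_of_exact (fnMap q) (const F U) (const F U') (map q) (flat_fnMap q)
    (fun s => map_const q s) (K := J × J) Prod.fst Prod.snd
    (fun j => map (p j)) (fun j => map (p' j))
    (fun k => map (x k)) (fun k => map (x' k)) (fun k => map (y k)) (fun k => map (y' k))
    (fun j => map (b j)) (fun k => map (d k)) (fun j => ?_) (fun k => ?_)
    (fun j φ => ?_) (fun k φ => ?_) (fun k φ => ?_) (fun k φ => ?_) (fun k φ => ?_)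
    (fun φ h => ?_) (fun φ h => ?_) (fun φ h => ?_) (fun φ h => ?_)
  · have h1 : (map (p j)).comp (const F U) = (const F (W j)).comp (fnMap (p j)) :=
      RingHom.ext fun s => map_const _ s
    have h2 : (map (p' j)).comp (const F U') = (const F (W' j)).comp (fnMap (p' j)) :=
      RingHom.ext fun s => map_const _ s
    rw [h1, h2]
    exact (hc j).isPushout (isPullback_etalePullback q (p j))
  · have h1 : (map (x k)).comp ((map (p k.1)).comp (const F U)) =
        (const F _).comp (fnMap (x k ≫ p k.1)) :=
      RingHom.ext fun s => by
        change map _ (map _ (const _ _ _)) = const _ _ _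
        rw [← map_comp, map_const]
    have h2 : (map (x' k)).comp ((map (p' k.1)).comp (const F U')) =
        (const F _).comp (fnMap (u k)) :=
      RingHom.ext fun s => by
        change map _ (map _ (const _ _ _)) = const _ _ _
        rw [← map_comp, map_const, hx'p]
    rw [h1, h2]
    exact ((hc k.1).restrict (x k)).isPushout (isPullback_etalePullback q (x k ≫ p k.1))
  · rw [← map_comp, ← map_comp, hW']
  · rw [← map_comp, ← map_comp, hx'b]
  · rw [← map_comp, ← map_comp, hy'b]
  · rw [← map_comp, ← map_comp, hxyp]
  · rw [← map_comp, ← map_comp, hx'p, hy'p]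
  · refine ext_of_cover fun z => ?_
    obtain ⟨j, t, ht⟩ := hcov z
    exact ⟨_, p j, t, ht, by rw [h, map_zero]⟩
  · refine ext_of_cover fun z => ?_
    obtain ⟨j, t, ht⟩ := hcov' z
    exact ⟨_, p' j, t, ht, by rw [h, map_zero]⟩
  · exact exists_glue W p hcov φ fun j k => h (j, k)
  · refine exists_glue W' p' hcov' φ fun j k => ?_
    -- The hypothesis gives agreement on the pullbacks `Z'` of the overlaps, whereas gluing needs it
    -- on the overlaps of the pullbacks. The map `l` compares the two.
    let l : etalePullback (p' j) (p' k) ⟶ Z' (j, k) :=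
      etaleLift (etaleFst _ _ ≫ p' j)
        (etaleLift (f := p j) (g := p k) (etaleFst _ _ ≫ b j) (etaleSnd _ _ ≫ b k) (by
          rw [Category.assoc, ← hW', Category.assoc, ← hW', ← Category.assoc,
            etalePullback_condition, Category.assoc])) (by
          rw [etaleLift_fst_assoc, Category.assoc, Category.assoc, hW'])
    have hl1 : l ≫ x' (j, k) = etaleFst _ _ := etalePullback_hom_ext
      (by rw [Category.assoc, hx'p]; exact etaleLift_fst _ _ _)
      (by rw [Category.assoc, hx'b, etaleLift_snd_assoc]; exact etaleLift_fst _ _ _)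
    have hl2 : l ≫ y' (j, k) = etaleSnd _ _ := etalePullback_hom_ext
      (by rw [Category.assoc, hy'p, ← etalePullback_condition]; exact etaleLift_fst _ _ _)
      (by rw [Category.assoc, hy'b, etaleLift_snd_assoc]; exact etaleLift_snd _ _ _)
    rw [← hl1, ← hl2, map_comp, map_comp, h (j, k)]

end

end
end TameSite

/-! ### Étale descent and the construction of the representing scheme. -/

namespace TameSite
noncomputable section

open Limits CommRingCat

lemma isZariskiLocalAtTarget_etale : IsZariskiLocalAtTarget @Etale.{u} :=
  HasRingHomProperty.instIsZariskiLocalAtTarget (P := @Etale) (Q := RingHom.Etale)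

lemma isZariskiLocalAtSource_etale : IsZariskiLocalAtSource @Etale.{u} :=
  HasRingHomProperty.instIsZariskiLocalAtSource (P := @Etale) (Q := RingHom.Etale)

lemma isFinite_comp {X Y Z : Scheme.{u}} (f : X ⟶ Y) (g : Y ⟶ Z) (_ : IsFinite f)
    (_ : IsFinite g) : IsFinite (f ≫ g) := inferInstance

lemma etale_comp {X Y Z : Scheme.{u}} (f : X ⟶ Y) (g : Y ⟶ Z) (_ : Etale f)
    (_ : Etale g) : Etale (f ≫ g) := inferInstance

lemma descendsAlong_of_descendsAlong_quasiCompact (P : MorphismProperty Scheme.{u})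
    (_ : IsZariskiLocalAtTarget P) (_ : P.DescendsAlong (@Surjective ⊓ @Flat ⊓ @QuasiCompact)) :
    P.DescendsAlong (@Surjective ⊓ @Flat ⊓ @LocallyOfFinitePresentation) := inferInstance

/-- Properties of morphisms that descend along flat coverings can be checked étale locally. -/
lemma of_etale_cover {P : MorphismProperty Scheme.{u}} (_ : IsZariskiLocalAtTarget P)
    (_ : P.DescendsAlong (@Surjective ⊓ @Flat ⊓ @QuasiCompact))
    {Y X : Scheme.{u}} (f : Y ⟶ X)
    (H : ∀ x : X, ∃ (W Z : Scheme.{u}) (q : W ⟶ X) (a : Z ⟶ Y) (g : Z ⟶ W) (w : W),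
      Etale q ∧ q w = x ∧ IsPullback a g f q ∧ P g) : P f := by
  have := descendsAlong_of_descendsAlong_quasiCompact P ‹_› ‹_›
  choose W Z q a g w hq hw hp hg using H
  -- The local étale neighbourhoods are assembled into one étale surjection, along which `P`
  -- descends. Over the disjoint union, `P` is checked on each summand.
  let Q : (∐ W) ⟶ X := Sigma.desc q
  have hQ : Etale Q := by
    refine (@IsZariskiLocalAtSource.iff_of_openCover @Etale.{u} isZariskiLocalAtSource_etale _ _ _
      (sigmaOpenCover W)).2 fun x => ?_
    have : (sigmaOpenCover W).f x ≫ Q = q x := Sigma.ι_desc _ _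
    rw [this]
    exact hq x
  have hQ' : Surjective Q := ⟨fun x => ⟨Sigma.ι W x (w x), by
    rw [← Scheme.Hom.comp_apply]
    exact (congrArg (fun m : W x ⟶ X => m (w x)) (Sigma.ι_desc q x)).trans (hw x)⟩⟩
  refine MorphismProperty.of_pullback_snd_of_descendsAlong
    (Q := @Surjective.{u} ⊓ @Flat.{u} ⊓ @LocallyOfFinitePresentation.{u}) (g := Q)
    ⟨⟨hQ', inferInstance⟩, inferInstance⟩ ?_
  rw [IsZariskiLocalAtTarget.iff_of_openCover (P := P) (sigmaOpenCover W)]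
  intro x
  have h1 : IsPullback (pullback.fst (pullback.snd f Q) ((sigmaOpenCover W).f x) ≫
      pullback.fst f Q) (pullback.snd (pullback.snd f Q) ((sigmaOpenCover W).f x)) f (q x) := by
    have := (IsPullback.of_hasPullback (pullback.snd f Q) ((sigmaOpenCover W).f x)).paste_horiz
      (IsPullback.of_hasPullback f Q)
    have e : (sigmaOpenCover W).f x ≫ Q = q x := Sigma.ι_desc _ _
    rwa [e] at this
  have h2 : (pullback.snd (pullback.snd f Q) ((sigmaOpenCover W).f x)) =
      (h1.isoIsPullback _ _ (hp x)).hom ≫ g x :=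
    (IsPullback.isoIsPullback_hom_snd _ _ h1 (hp x)).symm
  change P (pullback.snd (pullback.snd f Q) ((sigmaOpenCover W).f x))
  rw [h2]
  exact (P.cancel_left_of_respectsIso _ _).2 (hg x)

variable {X : Scheme.{u}} (F : X.Etaleᵒᵖ ⥤ AddCommGrpCat.{u + 1}) [HasCharts F]

/-! ### The relative spectrum -/

/-- The spectrum of the ring of functions of `F` over `U`. -/
def relSpec (U : X.Etale) : Scheme.{u} := Spec (.of (FunRing F U))

/-- The structure morphism of `relSpec F U`, for an affine `U`. -/
def relSpecHom (U : X.Etale) [IsAffine U.left] : relSpec F U ⟶ U.left :=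
  Spec.map (ofHom (FunRing.const F U)) ≫ U.left.isoSpec.inv

/-- The functoriality of `relSpec`. -/
def relSpecMap {U' U : X.Etale} (q : U' ⟶ U) : relSpec F U' ⟶ relSpec F U :=
  Spec.map (ofHom (FunRing.map q))

lemma relSpecMap_id (U : X.Etale) : relSpecMap F (𝟙 U) = 𝟙 _ := by
  have : FunRing.map (F := F) (𝟙 U) = RingHom.id _ := RingHom.ext FunRing.map_id
  rw [relSpecMap, this]
  exact Spec.map_id _

lemma relSpecMap_comp {U'' U' U : X.Etale} (q : U'' ⟶ U') (r : U' ⟶ U) :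
    relSpecMap F (q ≫ r) = relSpecMap F q ≫ relSpecMap F r := by
  have : FunRing.map (F := F) (q ≫ r) = (FunRing.map q).comp (FunRing.map r) :=
    RingHom.ext (FunRing.map_comp _ _)
  rw [relSpecMap, this]
  exact Spec.map_comp (ofHom (FunRing.map r)) (ofHom (FunRing.map q))

/-- This is the geometric form of quasi-coherence. It provides the equifibered condition for gluing
and identifies the base change of the glued scheme to a chart. -/
lemma isPullback_relSpecMap {U' U : X.Etale} [IsAffine U.left] [IsAffine U'.left] (q : U' ⟶ U) :
    IsPullback (relSpecMap F q) (relSpecHom F U') (relSpecHom F U) q.left := by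
  have h1 : IsPullback (relSpecMap F q) (Spec.map (ofHom (FunRing.const F U')))
      (Spec.map (ofHom (FunRing.const F U))) (Spec.map (ofHom (fnMap q))) :=
    (isPullback_SpecMap_of_isPushout _ _ _ _ (FunRing.isPushout_map q)).flip
  exact h1.paste_vert (IsPullback.of_vert_isIso ⟨Scheme.isoSpec_inv_naturality q.left⟩)

lemma IsChart.finite_const {F : X.Etaleᵒᵖ ⥤ AddCommGrpCat.{u + 1}} [HasCharts F] {W : X.Etale}
    {n : ℕ} {c : Fin n → F.obj (op W)} (h : IsChart F W c) : (FunRing.const F W).Finite := by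
  let _ := (FunRing.const F W).toAlgebra
  let e : FunRing F W ≃ₐ[fn W] (Fin n → fn W) := { h.funRingEquiv with
    commutes' := fun r => funext fun i => (FunRing.eval_const _ _ _).trans (fnMap_id _ _) }
  exact Module.Finite.equiv e.symm.toLinearEquiv

lemma IsChart.etale_const {F : X.Etaleᵒᵖ ⥤ AddCommGrpCat.{u + 1}} [HasCharts F] {W : X.Etale}
    {n : ℕ} {c : Fin n → F.obj (op W)} (h : IsChart F W c) : (FunRing.const F W).Etale := by
  let _ := (FunRing.const F W).toAlgebra
  let e : FunRing F W ≃ₐ[fn W] (Fin n → fn W) := { h.funRingEquiv with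
    commutes' := fun r => funext fun i => (FunRing.eval_const _ _ _).trans (fnMap_id _ _) }
  have h1 : Algebra.FormallyEtale (fn W) (Fin n → fn W) :=
    (Algebra.FormallyEtale.pi_iff _).2 fun _ => inferInstance
  have h2 : Algebra.FinitePresentation (fn W) (Fin n → fn W) := inferInstance
  have : Algebra.Etale (fn W) (Fin n → fn W) := ⟨h1, h2⟩
  exact Algebra.Etale.of_equiv e.symm

lemma IsChart.isFinite_relSpecHom {F : X.Etaleᵒᵖ ⥤ AddCommGrpCat.{u + 1}} [HasCharts F]
    {W : X.Etale} [IsAffine W.left] {n : ℕ} {c : Fin n → F.obj (op W)} (h : IsChart F W c) :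
    IsFinite (relSpecHom F W) := by
  have : IsFinite (Spec.map (ofHom (FunRing.const F W))) :=
    (IsFinite.SpecMap_iff _).2 h.finite_const
  exact isFinite_comp _ _ this inferInstance

lemma IsChart.etale_relSpecHom {F : X.Etaleᵒᵖ ⥤ AddCommGrpCat.{u + 1}} [HasCharts F]
    {W : X.Etale} [IsAffine W.left] {n : ℕ} {c : Fin n → F.obj (op W)} (h : IsChart F W c) :
    Etale (relSpecHom F W) := by
  have : Etale (Spec.map (ofHom (FunRing.const F W))) :=
    (HasRingHomProperty.Spec_iff (P := @Etale.{u})).2 h.etale_const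
  exact etale_comp _ _ this inferInstance

/-- An open subscheme, as an étale scheme. -/
def opensEtale (U : X.AffineZariskiSite) : X.Etale := Scheme.Etale.mk U.1.ι

instance (U : X.AffineZariskiSite) : IsAffine (opensEtale U).left := U.2

/-- The inclusion of open subschemes. -/
def opensEtaleMap {U V : X.AffineZariskiSite} (h : U ⟶ V) : opensEtale U ⟶ opensEtale V :=
  etaleHom (X.homOfLE ((Scheme.AffineZariskiSite.toOpensFunctor _).map h).le) (by
    exact Scheme.homOfLE_ι _ _)

lemma opensEtaleMap_unique {V : X.AffineZariskiSite} {Z : X.Etale} (f g : Z ⟶ opensEtale V) :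
    f = g := by
  refine etale_hom_ext ?_
  have h1 : f.left ≫ V.1.ι = Z.hom := etale_w f
  have h2 : g.left ≫ V.1.ι = Z.hom := etale_w g
  exact (cancel_mono V.1.ι).1 (h1.trans h2.symm)

/-- The gluing data for the scheme representing `F`. -/
def gluingData : (Scheme.AffineZariskiSite.directedCover X).RelativeGluingData where
  functor :=
    { obj := fun U => relSpec F (opensEtale U)
      map := fun h => relSpecMap F (opensEtaleMap h)
      map_id := fun U => by
        rw [← relSpecMap_id]; congr 1; exact opensEtaleMap_unique _ _
      map_comp := fun f g => by
        rw [← relSpecMap_comp]; congr 1; exact opensEtaleMap_unique _ _ }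
  natTrans :=
    { app := fun U => relSpecHom F (opensEtale U)
      naturality := fun U V h => (isPullback_relSpecMap F (opensEtaleMap h)).w }
  equifibered := fun U V h => isPullback_relSpecMap F (opensEtaleMap h)

/-- The scheme representing `F`. -/
def repScheme : Scheme.{u} := (gluingData F).glued

/-- The structure morphism of `repScheme F`. -/
def repSchemeHom : repScheme F ⟶ X := (gluingData F).toBase

/-- The restriction of `repScheme F` to an affine open subset. -/
def relSpecIncl (U : X.AffineZariskiSite) : relSpec F (opensEtale U) ⟶ repScheme F :=
  (gluingData F).cover.f U

lemma relSpecMap_incl {U V : X.AffineZariskiSite} (h : U ⟶ V) :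
    relSpecMap F (opensEtaleMap h) ≫ relSpecIncl F V = relSpecIncl F U :=
  Scheme.Cover.trans_map (gluingData F).cover h

lemma isPullback_relSpecIncl (U : X.AffineZariskiSite) :
    IsPullback (relSpecIncl F U) (relSpecHom F (opensEtale U)) (repSchemeHom F)
      (opensEtale U).hom :=
  ((gluingData F).isPullback_natTrans_ι_toBase U).flip

lemma exists_relSpecIncl_eq (x : repScheme F) :
    ∃ (U : X.AffineZariskiSite) (y : relSpec F (opensEtale U)), relSpecIncl F U y = x :=
  ⟨(gluingData F).cover.idx x, (gluingData F).cover.covers x⟩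

instance (U : X.AffineZariskiSite) : IsOpenImmersion (relSpecIncl F U) :=
  (gluingData F).cover.map_prop U

lemma exists_relSpecMap_eq {U V : X.AffineZariskiSite} (x : relSpec F (opensEtale U))
    (y : relSpec F (opensEtale V)) (h : relSpecIncl F U x = relSpecIncl F V y) :
    ∃ (W : X.AffineZariskiSite) (f : W ⟶ U) (g : W ⟶ V) (z : relSpec F (opensEtale W)),
      relSpecMap F (opensEtaleMap f) z = x ∧ relSpecMap F (opensEtaleMap g) z = y :=
  (gluingData F).cover.exists_of_f_eq_f x y h

/-- The base change of `repScheme F` to an affine étale scheme contained in an affine open. -/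
lemma isPullback_relSpecMap_incl {W : X.Etale} [IsAffine W.left] {U : X.AffineZariskiSite}
    (q : W ⟶ opensEtale U) :
    IsPullback (relSpecMap F q ≫ relSpecIncl F U) (relSpecHom F W) (repSchemeHom F) W.hom := by
  rw [← etale_w q]
  exact (((isPullback_relSpecMap F q).flip.paste_vert (isPullback_relSpecIncl F U).flip)).flip

/-- The spectra are glued only over affine opens of `X`. Zariski locally, every étale `X`-scheme
lies over one of them. -/
lemma exists_hom_opensEtale (T : X.Etale) (x : T.left) :
    ∃ (U : X.AffineZariskiSite) (V : X.Etale) (p : V ⟶ T) (_ : V ⟶ opensEtale U) (v : V.left),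
      p.left v = x ∧ IsOpenImmersion p.left := by
  obtain ⟨_, ⟨V, hV, rfl⟩, hxV, -⟩ := X.isBasis_affineOpens.exists_subset_of_mem_open
    (Set.mem_univ (T.hom x)) isOpen_univ
  let p := etaleOverHom T (pullback.fst T.hom (Scheme.Opens.ι V))
  obtain ⟨z, hz, -⟩ := Scheme.Pullback.exists_preimage_pullback (f := T.hom)
    (g := Scheme.Opens.ι V) x ⟨T.hom x, hxV⟩ rfl
  exact ⟨⟨V, hV⟩, _, p, etaleHom (pullback.snd T.hom (Scheme.Opens.ι V)) pullback.condition.symm, z,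
    hz, (inferInstance : IsOpenImmersion (pullback.fst T.hom (Scheme.Opens.ι V)))⟩

lemma exists_chart_over_opensEtale (x : X) :
    ∃ (U : X.AffineZariskiSite) (W : X.Etale) (_ : W ⟶ opensEtale U) (w : W.left) (n : ℕ)
      (c : Fin n → F.obj (op W)), IsAffine W.left ∧ W.hom w = x ∧ IsChart F W c := by
  obtain ⟨U, V, p, q, v, hv, -⟩ := exists_hom_opensEtale (Scheme.Etale.mk (𝟙 X)) x
  obtain ⟨W, r, w, n, c, hW, hw, hc⟩ := exists_isAffine_chart F V v
  refine ⟨U, W, r ≫ q, w, n, c, hW, ?_, hc⟩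
  rw [← etale_w (r ≫ p), etale_comp_left, Category.assoc, Scheme.Hom.comp_apply, hw,
    Scheme.Hom.comp_apply, hv]
  rfl

/-- After base change to an affine chart the morphism is the spectrum of a power of the base ring,
and étaleness descends. -/
instance : Etale (repSchemeHom F) := by
  refine of_etale_cover isZariskiLocalAtTarget_etale inferInstance _ fun x => ?_
  obtain ⟨U, W, q, w, n, c, _, hw, hc⟩ := exists_chart_over_opensEtale F x
  exact ⟨_, _, W.hom, _, _, w, W.prop, hw, isPullback_relSpecMap_incl F q, hc.etale_relSpecHom⟩

/-- A finite morphism is one that is universally closed, affine and locally of finite type. The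
first property descends from charts, the second holds because affine opens have the glued spectra as
preimages, and the third follows from étaleness. -/
instance : IsFinite (repSchemeHom F) := by
  have h1 : UniversallyClosed (repSchemeHom F) := by
    refine of_etale_cover (P := @UniversallyClosed.{u}) inferInstance inferInstance _ fun x => ?_
    obtain ⟨U, W, q, w, n, c, _, hw, hc⟩ := exists_chart_over_opensEtale F x
    have := hc.isFinite_relSpecHom
    exact ⟨_, _, W.hom, _, _, w, W.prop, hw, isPullback_relSpecMap_incl F q, inferInstance⟩
  have h2 : IsAffineHom (repSchemeHom F) := by
    refine isAffineHom_of_forall_exists_isAffineOpen _ fun x => ?_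
    obtain ⟨U, y, rfl⟩ : ∃ (U : X.AffineZariskiSite) (y : U.1), U.1.ι y = x :=
      ⟨(Scheme.AffineZariskiSite.directedCover X).idx x,
        (Scheme.AffineZariskiSite.directedCover X).covers x⟩
    have h := (gluingData F).toBase_preimage_eq_opensRange_ι U
    have e : ((Scheme.AffineZariskiSite.directedCover X).f U).opensRange = U.1 :=
      Scheme.Opens.opensRange_ι _
    rw [e] at h
    refine ⟨U.1, y.2, U.2, ?_⟩
    have h3 : IsAffineOpen (relSpecIncl F U).opensRange := by
      have : IsAffine (relSpec F (opensEtale U)) := by unfold relSpec; infer_instance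
      exact isAffineOpen_opensRange _
    exact h ▸ h3
  rw [IsFinite.iff_isIntegralHom_and_locallyOfFiniteType]
  exact ⟨IsIntegralHom.iff_universallyClosed_and_isAffineHom.2 ⟨h1, h2⟩, inferInstance⟩

end
end TameSite

namespace TameSite
noncomputable section

open Limits CommRingCat

variable {X : Scheme.{u}}

/-! ### Morphisms to relative spectra -/

/-- The ring homomorphism corresponding to a morphism to a spectrum. -/
def ringOfHom {Z : Scheme.{u}} {R : Type u} [CommRing R] (f : Z ⟶ Spec (.of R)) : R →+* Γ(Z, ⊤) :=
  ((Scheme.ΓSpecIso (.of R)).inv ≫ f.appTop).hom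

/-- The morphism to a spectrum corresponding to a ring homomorphism. -/
def homOfRing {Z : Scheme.{u}} {R : Type u} [CommRing R] (h : R →+* Γ(Z, ⊤)) : Z ⟶ Spec (.of R) :=
  Z.toSpecΓ ≫ Spec.map (ofHom h)

lemma homOfRing_ringOfHom {Z : Scheme.{u}} {R : Type u} [CommRing R] (f : Z ⟶ Spec (.of R)) :
    homOfRing (ringOfHom f) = f := by
  change Z.toSpecΓ ≫ Spec.map ((Scheme.ΓSpecIso (.of R)).inv ≫ f.appTop) = f
  rw [Spec.map_comp, ← Scheme.toSpecΓ_naturality_assoc, toSpecΓ_SpecMap_ΓSpecIso_inv,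
    Category.comp_id]

lemma ringOfHom_homOfRing {Z : Scheme.{u}} {R : Type u} [CommRing R] (h : R →+* Γ(Z, ⊤)) :
    ringOfHom (homOfRing h) = h := by
  have : (Scheme.ΓSpecIso (.of R)).inv ≫ (Z.toSpecΓ ≫ Spec.map (ofHom h)).appTop = ofHom h := by
    rw [Scheme.Hom.comp_appTop, ← Scheme.ΓSpecIso_inv_naturality_assoc, Scheme.toSpecΓ_appTop,
      Iso.inv_hom_id, Category.comp_id]
  exact congrArg CommRingCat.Hom.hom this

lemma ringOfHom_comp {Z Z' : Scheme.{u}} {R : Type u} [CommRing R] (g : Z' ⟶ Z)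
    (f : Z ⟶ Spec (.of R)) : ringOfHom (g ≫ f) = g.appTop.hom.comp (ringOfHom f) := by
  have : (Scheme.ΓSpecIso (.of R)).inv ≫ (g ≫ f).appTop =
      ((Scheme.ΓSpecIso (.of R)).inv ≫ f.appTop) ≫ g.appTop := by
    rw [Scheme.Hom.comp_appTop, Category.assoc]
  exact congrArg CommRingCat.Hom.hom this

lemma ringOfHom_comp_specMap {Z : Scheme.{u}} {R R' : Type u} [CommRing R] [CommRing R']
    (f : Z ⟶ Spec (.of R)) (g : R' →+* R) :
    ringOfHom (f ≫ Spec.map (ofHom g)) = (ringOfHom f).comp g := by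
  have : homOfRing (ringOfHom f) ≫ Spec.map (ofHom g) = homOfRing ((ringOfHom f).comp g) := by
    rw [homOfRing, homOfRing, Category.assoc, ← Spec.map_comp]; rfl
  rw [homOfRing_ringOfHom] at this
  rw [this, ringOfHom_homOfRing]

lemma ringOfHom_injective {Z : Scheme.{u}} {R : Type u} [CommRing R] {f g : Z ⟶ Spec (.of R)}
    (h : ringOfHom f = ringOfHom g) : f = g := by
  rw [← homOfRing_ringOfHom f, h, homOfRing_ringOfHom]

variable (F : X.Etaleᵒᵖ ⥤ AddCommGrpCat.{u + 1})

lemma comp_comp_inv_eq_iff {C : Type*} [Category* C] {W X Y Z : C} (f : W ⟶ X) (g : X ⟶ Y)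
    (e : Z ≅ Y) (r : W ⟶ Z) : f ≫ g ≫ e.inv = r ↔ f ≫ g = r ≫ e.hom := by
  rw [← Category.assoc, Iso.comp_inv_eq]

lemma comp_relSpecHom_iff [HasCharts F] {U : X.Etale} [IsAffine U.left] {Z : Scheme.{u}} (f : Z ⟶ relSpec F U)
    (r : Z ⟶ U.left) :
    f ≫ relSpecHom F U = r ↔
      (ringOfHom f).comp (FunRing.const F U) = r.appTop.hom := by
  have h1 : f ≫ relSpecHom F U = r ↔
      f ≫ Spec.map (ofHom (FunRing.const F U)) = r ≫ U.left.isoSpec.hom :=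
    comp_comp_inv_eq_iff f _ U.left.isoSpec r
  have h2 : r ≫ U.left.isoSpec.hom = homOfRing (R := Γ(U.left, ⊤)) r.appTop.hom :=
    Scheme.toSpecΓ_naturality r
  have h3 : ringOfHom (f ≫ Spec.map (ofHom (FunRing.const F U))) =
      (ringOfHom f).comp (FunRing.const F U) := ringOfHom_comp_specMap f _
  rw [h1, h2, ← h3]
  exact ⟨fun h => (congrArg ringOfHom h).trans (ringOfHom_homOfRing _),
    fun h => ringOfHom_injective (h.trans (ringOfHom_homOfRing _).symm)⟩

/-! ### Idempotents -/

/-- Since the idempotents sum to `1` in the local ring at `v`, one of them is a unit there, hence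
equal to `1`. Equality of germs spreads to a neighbourhood. -/
lemma exists_fnMap_eq_one {V : X.Etale} (v : V.left) {n : ℕ} (e : Fin n → fn V)
    (he : ∀ a, e a * e a = e a) (hs : ∑ a, e a = 1) :
    ∃ (V' : X.Etale) (q : V' ⟶ V) (v' : V'.left) (a : Fin n), IsOpenImmersion q.left ∧
      q.left v' = v ∧ fnMap q (e a) = 1 := by
  let g := (V.left.presheaf.germ ⊤ v trivial).hom
  obtain ⟨a, ha⟩ : ∃ a, IsUnit (g (e a)) := by
    by_contra! h
    have h1 : ∑ a, g (e a) ∈ IsLocalRing.maximalIdeal (V.left.presheaf.stalk v) :=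
      Ideal.sum_mem _ fun a _ => (IsLocalRing.mem_maximalIdeal _).2 (h a)
    rw [← map_sum, hs, map_one] at h1
    exact (Ideal.ne_top_iff_one _).1 (IsLocalRing.maximalIdeal.isMaximal _).ne_top h1
  have h1 : g (e a) = g 1 := by
    rw [map_one]
    exact ha.mul_left_cancel (by rw [← map_mul, he, mul_one])
  obtain ⟨W, hvW, i, j, hij⟩ := TopCat.Presheaf.germ_eq V.left.presheaf (U := ⊤) (V := ⊤) v trivial trivial _ _ h1
  refine ⟨etaleOver V (Scheme.Opens.ι W), etaleOverHom V _, ⟨v, hvW⟩, a,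
    (inferInstance : IsOpenImmersion (Scheme.Opens.ι W)), rfl, ?_⟩
  have h2 : (Scheme.Opens.ι W).appTop = V.left.presheaf.map i.op ≫
      V.left.presheaf.map (homOfLE (by simp : Scheme.Opens.ι W ''ᵁ ⊤ ≤ W)).op := by
    rw [← Functor.map_comp]
    exact Scheme.Opens.ι_appTop _
  change (Scheme.Opens.ι W).appTop.hom (e a) = 1
  rw [h2]
  change V.left.presheaf.map (homOfLE _).op (V.left.presheaf.map i.op (e a)) = 1
  rw [hij, map_one, map_one]

lemma exists_isAffine_nhd (V : X.Etale) (v : V.left) :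
    ∃ (V' : X.Etale) (q : V' ⟶ V) (v' : V'.left), IsAffine V'.left ∧ IsOpenImmersion q.left ∧
      q.left v' = v := by
  obtain ⟨_, ⟨W, hW, rfl⟩, hvW, -⟩ := V.left.isBasis_affineOpens.exists_subset_of_mem_open
    (Set.mem_univ v) isOpen_univ
  exact ⟨etaleOver V (Scheme.Opens.ι W), etaleOverHom V _, ⟨v, hvW⟩, hW,
    (inferInstance : IsOpenImmersion (Scheme.Opens.ι W)), rfl⟩

/-! ### Sections of `F` as ring homomorphisms -/

/-- `F` is a locally constant sheaf with finite fibres for a topology that refines the Zariski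
topology. -/
structure IsLocallyFiniteSheaf (F : X.Etaleᵒᵖ ⥤ AddCommGrpCat.{u + 1})
    (J : GrothendieckTopology X.Etale) : Prop where
  isSheaf : Presheaf.IsSheaf J F
  zariski_le : zariskiTopologyOnEtale X ≤ J
  exists_charts : ∀ T : X.Etale, ∃ S ∈ J T, ∀ (V : X.Etale) (p : V ⟶ T), S p →
    ∃ (n : ℕ) (c : Fin n → F.obj (op V)), IsChart F V c

namespace IsLocallyFiniteSheaf

variable {F} {J : GrothendieckTopology X.Etale} (hF : IsLocallyFiniteSheaf F J)
include hF

lemma isSheafFor {Z : X.Etale} {S : Sieve Z} (hS : S ∈ J Z) :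
    S.arrows.IsSheafFor (F ⋙ CategoryTheory.forget AddCommGrpCat.{u + 1}) :=
  (isSheaf_iff_isSheaf_of_type _ _).1 ((Presheaf.isSheaf_iff_isSheaf_forget J F
    (CategoryTheory.forget AddCommGrpCat.{u + 1})).1 hF.isSheaf) S hS

lemma sec_ext {Z : X.Etale} {S : Sieve Z} (hS : S ∈ J Z) {s t : F.obj (op Z)}
    (h : ∀ (V : X.Etale) (p : V ⟶ Z), S p → res F p s = res F p t) : s = t :=
  (hF.isSheafFor hS).isSeparatedFor.ext fun V p hp => h V p hp

lemma sec_glue {Z : X.Etale} {S : Sieve Z} (hS : S ∈ J Z)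
    (s : ∀ (V : X.Etale) (p : V ⟶ Z), S p → F.obj (op V))
    (h : ∀ (V V' : X.Etale) (q : V' ⟶ V) (p : V ⟶ Z) (hp : S p),
      res F q (s V p hp) = s V' (q ≫ p) (S.downward_closed hp q)) :
    ∃ t : F.obj (op Z), ∀ (V : X.Etale) (p : V ⟶ Z) (hp : S p), res F p t = s V p hp := by
  obtain ⟨t, ht, -⟩ := hF.isSheafFor hS (fun V p hp => s V p hp)
    ((Presieve.compatible_iff_sieveCompatible _).2 fun V V' p q hp => (h V V' q p hp).symm)
  exact ⟨t, fun V p hp => ht p hp⟩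

lemma mem_of_zariski {T : X.Etale} {S : Sieve T} (h : ∀ x : T.left, ∃ (V : X.Etale) (p : V ⟶ T)
    (y : V.left), S p ∧ IsOpenImmersion p.left ∧ p.left y = x) : S ∈ J T :=
  hF.zariski_le _ ((mem_zariskiTopologyOnEtale_iff S).2 h)

lemma sec_glue_zariski {Z : X.Etale} {I : Type*} (V : I → X.Etale) (p : ∀ i, V i ⟶ Z)
    (ho : ∀ i, IsOpenImmersion (p i).left)
    (hp : ∀ x : Z.left, ∃ (i : I) (y : (V i).left), (p i).left y = x)
    (s : ∀ i, F.obj (op (V i))) (h : ∀ (i j : I) (W : X.Etale) (a : W ⟶ V i) (b : W ⟶ V j),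
      a ≫ p i = b ≫ p j → res F a (s i) = res F b (s j)) :
    ∃ t : F.obj (op Z), ∀ i, res F (p i) t = s i := by
  have hS : Sieve.ofArrows V p ∈ J Z := hF.mem_of_zariski fun x => by
    obtain ⟨i, y, hy⟩ := hp x
    exact ⟨V i, p i, y, Sieve.ofArrows_mk V p i, ho i, hy⟩
  have h1 := (Presieve.isSheafFor_iff_generate _).2 (hF.isSheafFor hS)
  obtain ⟨t, ht, -⟩ := (Presieve.isSheafFor_arrows_iff _ _).1 h1 s
    fun i j W a b hab => h i j W a b hab
  exact ⟨t, ht⟩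

/-- Charts exist only after a `J`-covering, not Zariski locally. Transitivity reduces the test to
affine schemes with a chart, where Zariski neighbourhoods suffice. -/
lemma mem_of_charts {T : X.Etale} {S : Sieve T}
    (h : ∀ (W : X.Etale) (_ : IsAffine W.left) (p : W ⟶ T) (n : ℕ) (c : Fin n → F.obj (op W))
      (_ : IsChart F W c) (w : W.left), ∃ (V : X.Etale) (q : V ⟶ W) (v : V.left), S (q ≫ p) ∧
      IsOpenImmersion q.left ∧ q.left v = w) : S ∈ J T := by
  obtain ⟨R, hR, H⟩ := hF.exists_charts T
  refine J.transitive hR _ fun V p hp => hF.mem_of_zariski fun x => ?_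
  obtain ⟨n, c, hc⟩ := H V p hp
  obtain ⟨W, q, w, hW, hq, hw⟩ := exists_isAffine_nhd V x
  obtain ⟨W', r, w', hS, hr, hw'⟩ := h W hW (q ≫ p) n _ (hc.restrict q) w
  exact ⟨W', r ≫ q, w', by simpa using hS, (inferInstance : IsOpenImmersion (r.left ≫ q.left)),
    by rw [etale_comp_left, Scheme.Hom.comp_apply, hw', hw]⟩

/-- Sections of `F` over an étale `U`-scheme are determined by the values of functions. -/
theorem sec_ext_of_eval [HasCharts F] {U Z : X.Etale} [IsAffine U.left] (r : Z ⟶ U) {s t : F.obj (op Z)}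
    (h : ∀ φ : FunRing F U, FunRing.eval r s φ = FunRing.eval r t φ) : s = t := by
  let S : Sieve Z :=
    { arrows := fun V p => res F p s = res F p t
      downward_closed := fun {V V' p} hp q => by
        rw [res_comp, res_comp, hp] }
  refine hF.sec_ext (S := S) (hF.mem_of_charts ?_) fun V p hp => hp
  intro W hW p n c hc w
  -- By the pushout square, a homomorphism out of `FunRing F W` is determined by its restrictions to
  -- functions on `W` and to `FunRing F U`.
  have key (φ : FunRing F W) : FunRing.eval (𝟙 W) (res F p s) φ =
      FunRing.eval (𝟙 W) (res F p t) φ := by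
    have H := FunRing.isPushout_map (F := F) (p ≫ r)
    have : ofHom (FunRing.eval (𝟙 W) (res F p s)) = ofHom (FunRing.eval (𝟙 W) (res F p t)) := by
      refine H.hom_ext ?_ ?_
      · ext x
        exact (FunRing.eval_const _ _ _).trans (FunRing.eval_const _ _ _).symm
      · ext ψ
        change FunRing.eval _ _ (FunRing.map _ ψ) = FunRing.eval _ _ (FunRing.map _ ψ)
        rw [FunRing.eval_map, FunRing.eval_map, Category.id_comp, FunRing.eval_res,
          FunRing.eval_res, h]
    exact DFunLike.congr_fun (congrArg CommRingCat.Hom.hom this) φ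
  obtain ⟨V, q, v, a, hq, hv, hs⟩ := hc.locally_eq W (𝟙 W) (res F p s) w
  obtain ⟨V', q', v', b, hq', hv', ht⟩ := hc.locally_eq V q (res F q (res F p t)) v
  refine ⟨V', q' ≫ q, v', ?_, (inferInstance : IsOpenImmersion (q'.left ≫ q.left)),
    by rw [etale_comp_left, Scheme.Hom.comp_apply, hv', hv]⟩
  change res F _ s = res F _ t
  have hs' : res F (q' ≫ q) (res F p s) = res F (q' ≫ q) (c a) := by
    rw [res_comp, hs, Category.comp_id, res_comp]
  have ht' : res F (q' ≫ q) (res F p t) = res F (q' ≫ q) (c b) := by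
    rw [res_comp, ht]
  have hab : a = b := by
    by_contra hab
    have hne : Nonempty V'.left := ⟨v'⟩
    -- The indicator function of the sheet `a` takes the value `1` at `c a` and `0` at `c b`.
    let φ := hc.funRingEquiv.symm (Pi.single a 1)
    have hφ (i) : FunRing.eval (𝟙 W) (c i) φ = (Pi.single a 1 : Fin n → fn W) i := by
      rw [← IsChart.funRingEquiv_apply hc, RingEquiv.apply_symm_apply]
    have h1 := congrArg (fnMap (q' ≫ q)) (key φ)
    rw [← FunRing.eval_res, ← FunRing.eval_res, hs', ht', FunRing.eval_res, FunRing.eval_res,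
      hφ, hφ, Pi.single_eq_same, Pi.single_eq_of_ne (Ne.symm hab), map_one, map_zero] at h1
    have : Nonempty (⊤ : V'.left.Opens) := ⟨v', trivial⟩
    have : Nontrivial (fn V') := Scheme.component_nontrivial V'.left ⊤
    exact one_ne_zero h1
  rw [Category.assoc, res_comp, res_comp, res_comp, res_comp, ← res_comp, hs', hab, ← ht',
    ← res_comp, ← res_comp, ← res_comp]

/-- Every compatible ring homomorphism is the evaluation at a section. -/
theorem exists_eval_eq [HasCharts F] {U Z : X.Etale} [IsAffine U.left] (r : Z ⟶ U) (h : FunRing F U →+* fn Z)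
    (hh : ∀ x, h (FunRing.const F U x) = fnMap r x) :
    ∃ s : F.obj (op Z), ∀ φ, FunRing.eval r s φ = h φ := by
  let S : Sieve Z :=
    { arrows := fun V p => ∃ s : F.obj (op V), ∀ φ, FunRing.eval (p ≫ r) s φ = fnMap p (h φ)
      downward_closed := fun {V V' p} hp q => by
        obtain ⟨s, hs⟩ := hp
        refine ⟨res F q s, fun φ => ?_⟩
        rw [Category.assoc, FunRing.eval_res, hs, fnMap_comp] }
  have hloc (W : X.Etale) (_ : IsAffine W.left) (p : W ⟶ Z) (n : ℕ) (c : Fin n → F.obj (op W))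
      (hc : IsChart F W c) (w : W.left) : ∃ (V : X.Etale) (q : V ⟶ W) (v : V.left), S (q ≫ p) ∧
      IsOpenImmersion q.left ∧ q.left v = w := by
    have H := FunRing.isPushout_map (F := F) (p ≫ r)
    -- Base change turns `h` into a retraction `m` of the structure map of `FunRing F W`.
    let m := H.desc (𝟙 (CommRingCat.of (fn W))) (ofHom ((fnMap p).comp h)) (by
      ext x
      change fnMap (p ≫ r) x = fnMap p (h (FunRing.const F U x))
      rw [hh, fnMap_comp])
    have hm1 (x : fn W) : m.hom (FunRing.const F W x) = x :=
      DFunLike.congr_fun (congrArg CommRingCat.Hom.hom (H.inl_desc _ _ _)) x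
    have hm2 (φ : FunRing F U) : m.hom (FunRing.map (p ≫ r) φ) = fnMap p (h φ) :=
      DFunLike.congr_fun (congrArg CommRingCat.Hom.hom (H.inr_desc _ _ _)) φ
    let δ (a : Fin n) := hc.funRingEquiv.symm (Pi.single a 1)
    obtain ⟨V, q, v, a, hq, hv, ha⟩ := exists_fnMap_eq_one w (fun a => m.hom (δ a))
      (fun a => by
        rw [← map_mul, ← map_mul]
        congr 2
        rw [← Pi.single_mul, one_mul])
      (by
        have e1 : ∑ a, (Pi.single a 1 : Fin n → fn W) = 1 := Finset.univ_sum_single 1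
        rw [← map_sum, ← map_sum, e1, map_one, map_one])
    refine ⟨V, q, v, ⟨res F q (c a), fun φ => ?_⟩, hq, hv⟩
    -- On the sheet `a` every function equals the constant given by its value at `c a`. Applying `m`
    -- where `m (δ a) = 1` therefore identifies `m` with evaluation at `c a`.
    have h2 (ψ : FunRing F W) : ψ * δ a = FunRing.const F W (FunRing.eval (𝟙 W) (c a) ψ) * δ a := by
      refine hc.funRingEquiv.injective (funext fun b => ?_)
      rw [map_mul, map_mul, RingEquiv.apply_symm_apply, Pi.mul_apply, Pi.mul_apply]
      rcases eq_or_ne b a with rfl | hb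
      · rw [IsChart.funRingEquiv_apply, IsChart.funRingEquiv_apply, FunRing.eval_const, fnMap_id]
      · rw [Pi.single_eq_of_ne hb, mul_zero, mul_zero]
    have h3 := congrArg (fun z => fnMap q (m.hom z)) (h2 (FunRing.map (p ≫ r) φ))
    simp only [map_mul] at h3
    rw [ha, mul_one, mul_one, hm1, hm2, FunRing.eval_map, ← FunRing.eval_res] at h3
    rw [fnMap_comp, h3, Category.id_comp, Category.assoc]
  choose! s hs using fun (V : X.Etale) (p : V ⟶ Z) (hp : S p) => hp
  obtain ⟨t, ht⟩ := hF.sec_glue (hF.mem_of_charts hloc) (fun V p _ => s V p) fun V V' q p hp =>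
    hF.sec_ext_of_eval (q ≫ p ≫ r) fun φ => by
      rw [FunRing.eval_res, hs V p hp, ← fnMap_comp, ← hs V' (q ≫ p) (S.downward_closed hp q),
        Category.assoc]
  refine ⟨t, fun φ => fn_ext fun z => ?_⟩
  obtain ⟨W, p, w, n, c, hW, hw, hc⟩ := exists_isAffine_chart F Z z
  obtain ⟨V, q, v, hqp, -, hv⟩ := hloc W hW p n c hc w
  refine ⟨V, q ≫ p, v, by rw [etale_comp_left, Scheme.Hom.comp_apply, hv, hw], ?_⟩
  rw [← FunRing.eval_res, ht _ _ hqp, hs _ _ hqp]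

end IsLocallyFiniteSheaf

end
end TameSite

/-! ### The universal section and representability. -/

namespace TameSite
noncomputable section

open Limits CommRingCat

variable {X : Scheme.{u}} (F : X.Etaleᵒᵖ ⥤ AddCommGrpCat.{u + 1}) [HasCharts F]

/-- The scheme representing `F`, as an étale `X`-scheme. -/
def repEtale : X.Etale := Scheme.Etale.mk (repSchemeHom F)

/-- An affine open subset of `repEtale F`. -/
def relSpecEtale (U : X.AffineZariskiSite) : X.Etale :=
  Scheme.Etale.mk (relSpecIncl F U ≫ repSchemeHom F)

/-- The inclusion of an affine open subset of `repEtale F`. -/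
def relSpecEtaleIncl (U : X.AffineZariskiSite) : relSpecEtale F U ⟶ repEtale F :=
  etaleHom (relSpecIncl F U) rfl

/-- The structure morphism of an affine open subset of `repEtale F`. -/
def relSpecEtaleHom (U : X.AffineZariskiSite) : relSpecEtale F U ⟶ opensEtale U :=
  etaleHom (relSpecHom F (opensEtale U)) (isPullback_relSpecIncl F U).w.symm

/-- The functoriality of `relSpecEtale`. -/
def relSpecEtaleMap {U V : X.AffineZariskiSite} (h : U ⟶ V) :
    relSpecEtale F U ⟶ relSpecEtale F V :=
  etaleHom (relSpecMap F (opensEtaleMap h)) (by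
    change relSpecMap F (opensEtaleMap h) ≫ relSpecIncl F V ≫ repSchemeHom F =
      relSpecIncl F U ≫ repSchemeHom F
    rw [← relSpecMap_incl F h, Category.assoc])

lemma relSpecEtaleMap_incl {U V : X.AffineZariskiSite} (h : U ⟶ V) :
    relSpecEtaleMap F h ≫ relSpecEtaleIncl F V = relSpecEtaleIncl F U :=
  etale_hom_ext (relSpecMap_incl F h)

instance {U V : X.AffineZariskiSite} (h : U ⟶ V) :
    IsOpenImmersion (relSpecMap F (opensEtaleMap h)) := by
  have : IsOpenImmersion (relSpecMap F (opensEtaleMap h) ≫ relSpecIncl F V) := by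
    rw [relSpecMap_incl]
    infer_instance
  exact IsOpenImmersion.of_comp _ (relSpecIncl F V)

lemma relSpecEtaleIncl_cancel {U : X.AffineZariskiSite} {Z : X.Etale} {f g : Z ⟶ relSpecEtale F U}
    (h : f ≫ relSpecEtaleIncl F U = g ≫ relSpecEtaleIncl F U) : f = g := by
  have h1 : f.left ≫ relSpecIncl F U = g.left ≫ relSpecIncl F U :=
    congrArg (fun m : Z ⟶ repEtale F => m.left) h
  exact etale_hom_ext ((cancel_mono (relSpecIncl F U)).1 h1)

/-- The ring homomorphism that corresponds to a morphism to `relSpecEtale F U`. -/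
def ringOfEtaleHom {U : X.AffineZariskiSite} {Z : X.Etale} (f : Z ⟶ relSpecEtale F U) :
    FunRing F (opensEtale U) →+* fn Z :=
  ringOfHom (R := FunRing F (opensEtale U)) f.left

lemma ringOfEtaleHom_injective {U : X.AffineZariskiSite} {Z : X.Etale}
    {f g : Z ⟶ relSpecEtale F U} (h : ringOfEtaleHom F f = ringOfEtaleHom F g) : f = g :=
  etale_hom_ext (ringOfHom_injective h)

lemma ringOfEtaleHom_comp {U : X.AffineZariskiSite} {Z Z' : X.Etale} (g : Z' ⟶ Z)
    (f : Z ⟶ relSpecEtale F U) (φ : FunRing F (opensEtale U)) :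
    ringOfEtaleHom F (g ≫ f) φ = fnMap g (ringOfEtaleHom F f φ) :=
  DFunLike.congr_fun (ringOfHom_comp (R := FunRing F (opensEtale U)) g.left f.left) φ

lemma ringOfEtaleHom_const {U : X.AffineZariskiSite} {Z : X.Etale} (f : Z ⟶ relSpecEtale F U)
    (x : fn (opensEtale U)) :
    ringOfEtaleHom F f (FunRing.const F _ x) = fnMap (f ≫ relSpecEtaleHom F U) x :=
  DFunLike.congr_fun ((comp_relSpecHom_iff F f.left _).1 rfl) x

lemma exists_ringOfEtaleHom_eq {U : X.AffineZariskiSite} {Z : X.Etale} (r : Z ⟶ opensEtale U)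
    (h : FunRing F (opensEtale U) →+* fn Z) (hh : ∀ x, h (FunRing.const F _ x) = fnMap r x) :
    ∃ f : Z ⟶ relSpecEtale F U, ringOfEtaleHom F f = h := by
  let m : Z.left ⟶ relSpec F (opensEtale U) := homOfRing h
  have hm : ringOfHom (R := FunRing F (opensEtale U)) m = h := ringOfHom_homOfRing h
  have h1 : m ≫ relSpecHom F (opensEtale U) = r.left :=
    (comp_relSpecHom_iff F m r.left).2 (RingHom.ext fun x => by
      rw [hm]; exact hh x)
  refine ⟨etaleHom m ?_, hm⟩
  change m ≫ relSpecIncl F U ≫ repSchemeHom F = Z.hom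
  rw [(isPullback_relSpecIncl F U).w, reassoc_of% h1]
  exact etale_w r

/-- The piece over `U` is the fibre product of the whole scheme with `U`, so a morphism from a
scheme lying over `U` lands in it. -/
lemma exists_comp_relSpecEtaleIncl_eq {U : X.AffineZariskiSite} {Z : X.Etale}
    (r : Z ⟶ opensEtale U) (f : Z ⟶ repEtale F) :
    ∃ l : Z ⟶ relSpecEtale F U, l ≫ relSpecEtaleIncl F U = f := by
  have hw : f.left ≫ repSchemeHom F = r.left ≫ (opensEtale U).hom :=
    (etale_w f).trans (etale_w r).symm
  let m : Z.left ⟶ relSpec F (opensEtale U) := (isPullback_relSpecIncl F U).lift f.left r.left hw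
  have hm : m ≫ relSpecIncl F U = f.left := (isPullback_relSpecIncl F U).lift_fst _ _ _
  refine ⟨etaleHom m ?_, etale_hom_ext hm⟩
  change m ≫ relSpecIncl F U ≫ repSchemeHom F = Z.hom
  rw [reassoc_of% hm]
  exact etale_w f

namespace IsLocallyFiniteSheaf

variable {F} {J : GrothendieckTopology X.Etale} (hF : IsLocallyFiniteSheaf F J)
include hF

/-- The universal section of `F`. -/
theorem exists_universal_section : ∃ ξ : F.obj (op (repEtale F)),
    ∀ (U : X.AffineZariskiSite) (Z : X.Etale) (l : Z ⟶ relSpecEtale F U) (r : Z ⟶ opensEtale U)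
      (φ : FunRing F (opensEtale U)),
      FunRing.eval r (res F (l ≫ relSpecEtaleIncl F U) ξ) φ = ringOfEtaleHom F l φ := by
  -- The tautological homomorphism, given by the identity of the spectrum, is evaluation at a
  -- section. These local universal sections are then glued.
  have h1 (U : X.AffineZariskiSite) : ∃ s : F.obj (op (relSpecEtale F U)), ∀ φ,
      FunRing.eval (relSpecEtaleHom F U) s φ = ringOfEtaleHom F (𝟙 _) φ :=
    hF.exists_eval_eq _ _ fun x => by rw [ringOfEtaleHom_const, Category.id_comp]
  choose s hs using h1
  have hs' (U : X.AffineZariskiSite) (Z : X.Etale) (l : Z ⟶ relSpecEtale F U)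
      (r : Z ⟶ opensEtale U) (φ : FunRing F (opensEtale U)) :
      FunRing.eval r (res F l (s U)) φ = ringOfEtaleHom F l φ := by
    rw [opensEtaleMap_unique r (l ≫ relSpecEtaleHom F U), FunRing.eval_res, hs,
      ← ringOfEtaleHom_comp, Category.comp_id]
  have hmap {U V : X.AffineZariskiSite} (h : U ⟶ V) : res F (relSpecEtaleMap F h) (s V) = s U := by
    refine hF.sec_ext_of_eval (relSpecEtaleHom F U ≫ opensEtaleMap h) fun φ => ?_
    rw [hs', ← FunRing.eval_map, hs]
    exact DFunLike.congr_fun (ringOfHom_comp_specMap (𝟙 _) (FunRing.map (opensEtaleMap h))) φ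
  have hcompat (U V : X.AffineZariskiSite) (Z : X.Etale) (a : Z ⟶ relSpecEtale F U)
      (b : Z ⟶ relSpecEtale F V) (hab : a ≫ relSpecEtaleIncl F U = b ≫ relSpecEtaleIncl F V) :
      res F a (s U) = res F b (s V) := by
    let S : Sieve Z :=
      { arrows := fun W p => res F p (res F a (s U)) = res F p (res F b (s V))
        downward_closed := fun {W W' p} hp q => by
          rw [res_comp, res_comp, hp] }
    refine hF.sec_ext (S := S) (hF.mem_of_zariski fun z => ?_) fun W p hp => hp
    have hz : relSpecIncl F U (a.left z) = relSpecIncl F V (b.left z) := by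
      have := congrArg (fun m : Z ⟶ repEtale F => m.left z) hab
      simp only [etale_comp_left, Scheme.Hom.comp_apply] at this
      exact this
    obtain ⟨W, f, g, w, hw1, hw2⟩ := exists_relSpecMap_eq F _ _ hz
    obtain ⟨y, hy, hy'⟩ := exists_etalePullback_point (f := a) (g := relSpecEtaleMap F f) z w
      hw1.symm
    refine ⟨_, etaleFst a (relSpecEtaleMap F f), y, ?_, ?_, hy⟩
    · change res F _ _ = res F _ _
      have h2 : etaleFst a (relSpecEtaleMap F f) ≫ b =
          etaleSnd a (relSpecEtaleMap F f) ≫ relSpecEtaleMap F g := by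
        refine relSpecEtaleIncl_cancel F ?_
        rw [Category.assoc, Category.assoc, ← hab, relSpecEtaleMap_incl, ← Category.assoc,
          etalePullback_condition, Category.assoc, relSpecEtaleMap_incl]
      rw [← res_comp, ← res_comp, h2, etalePullback_condition, res_comp, res_comp, hmap, hmap]
    · have : IsOpenImmersion (relSpecEtaleMap F f).left :=
        (inferInstance : IsOpenImmersion (relSpecMap F (opensEtaleMap f)))
      exact (inferInstance : IsOpenImmersion (pullback.fst a.left (relSpecEtaleMap F f).left))
  obtain ⟨ξ, hξ⟩ := hF.sec_glue_zariski (relSpecEtale F) (relSpecEtaleIncl F)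
    (fun U => (inferInstance : IsOpenImmersion (relSpecIncl F U)))
    (fun x => exists_relSpecIncl_eq F x) s hcompat
  exact ⟨ξ, fun U Z l r φ => by rw [res_comp, hξ, hs']⟩

/-- `F` is represented by `repEtale F`. -/
theorem exists_representing_section : ∃ ξ : F.obj (op (repEtale F)),
    ∀ Z : X.Etale, Function.Bijective fun f : Z ⟶ repEtale F => res F f ξ := by
  obtain ⟨ξ, hξ⟩ := hF.exists_universal_section
  -- Over an affine open, morphisms to the representing scheme and sections of `F` are both the same
  -- as homomorphisms out of the ring of functions. The general case is glued from a Zariski cover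
  -- of `Z`.
  have hinj {U : X.AffineZariskiSite} {Z : X.Etale} (r : Z ⟶ opensEtale U) (f g : Z ⟶ repEtale F)
      (h : res F f ξ = res F g ξ) : f = g := by
    obtain ⟨l, rfl⟩ := exists_comp_relSpecEtaleIncl_eq F r f
    obtain ⟨m, rfl⟩ := exists_comp_relSpecEtaleIncl_eq F r g
    have : l = m := ringOfEtaleHom_injective F (RingHom.ext fun φ => by rw [← hξ U Z l r, h, hξ])
    rw [this]
  have hsurj {U : X.AffineZariskiSite} {Z : X.Etale} (r : Z ⟶ opensEtale U) (s : F.obj (op Z)) :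
      ∃ f : Z ⟶ repEtale F, res F f ξ = s := by
    obtain ⟨l, hl⟩ := exists_ringOfEtaleHom_eq F r (FunRing.eval r s) fun x =>
      FunRing.eval_const _ _ _
    exact ⟨l ≫ relSpecEtaleIncl F U, hF.sec_ext_of_eval r fun φ => by rw [hξ, hl]⟩
  refine ⟨ξ, fun Z => ?_⟩
  choose U V p q v hv ho using exists_hom_opensEtale Z
  have hcov (x : Z.left) : ∃ (i : Z.left) (y : (V i).left), (p i).left y = x := ⟨x, v x, hv x⟩
  constructor
  · intro f g (h : res F f ξ = res F g ξ)
    obtain ⟨_, -, hu⟩ := existsUnique_glue_hom V p hcov (fun z => (p z).left ≫ f.left)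
      (fun i j W a b hab => by
        rw [← etale_comp_left_assoc, hab, etale_comp_left_assoc])
    refine etale_hom_ext ((hu _ fun z => rfl).trans (hu _ fun z => ?_).symm)
    have := hinj (q z) (p z ≫ g) (p z ≫ f) (by rw [res_comp, res_comp, h])
    exact congrArg (fun m : V z ⟶ repEtale F => m.left) this
  · intro s
    choose f hf using fun z => hsurj (q z) (res F (p z) s)
    obtain ⟨g, hg, -⟩ := existsUnique_glue_hom V p hcov (fun z => (f z).left)
      (fun i j W a b hab => by
        have := hinj (a ≫ q i) (a ≫ f i) (b ≫ f j) (by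
          rw [res_comp, res_comp, hf, hf, ← res_comp, ← res_comp, hab])
        exact congrArg (fun m : W ⟶ repEtale F => m.left) this)
    have hg' : g ≫ (repEtale F).hom = Z.hom := by
      obtain ⟨_, -, hu⟩ := existsUnique_glue_hom V p hcov (fun z => (V z).hom)
        (fun i j W a b hab => by rw [etale_w, etale_w])
      refine (hu _ fun z => ?_).trans (hu _ fun z => etale_w (p z)).symm
      rw [reassoc_of% hg z, etale_w]
    let m : Z ⟶ repEtale F := etaleHom g hg'
    have hm (z) : p z ≫ m = f z := etale_hom_ext (hg z)
    let S : Sieve Z :=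
      { arrows := fun W r => res F r (res F m ξ) = res F r s
        downward_closed := fun {W W' r} hr t => by
          rw [res_comp, hr, ← res_comp] }
    refine ⟨m, hF.sec_ext (S := S) (hF.mem_of_zariski fun z => ?_) fun W r hr => hr⟩
    refine ⟨V z, p z, v z, ?_, ho z, hv z⟩
    change res F _ _ = _
    rw [← res_comp, hm, hf]

end IsLocallyFiniteSheaf

end
end TameSite

/-! ### The group structure on the representing scheme. -/

namespace TameSite
noncomputable section

open MonoidalCategory CartesianMonoidalCategory in
/-- A Yoneda construction of commutative group objects, relative to a class of test objects. -/
theorem exists_grpObj {C : Type*} [Category* C] [CartesianMonoidalCategory C] [BraidedCategory C]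
    (P : C → Prop) (hP₁ : P (𝟙_ C)) (hP₂ : ∀ Y Z, P Y → P Z → P (Y ⊗ Z)) (G : C) (hG : P G)
    (A : ∀ Y, P Y → Type*) [∀ Y h, AddCommGroup (A Y h)]
    (r : ∀ (Y Z : C) (hY : P Y) (hZ : P Z) (_ : Y ⟶ Z), A Z hZ →+ A Y hY)
    (sec : ∀ Y (h : P Y), (Y ⟶ G) → A Y h)
    (hsec : ∀ Y Z (hY : P Y) (hZ : P Z) (f : Y ⟶ Z) (g : Z ⟶ G),
      sec Y hY (f ≫ g) = r Y Z hY hZ f (sec Z hZ g))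
    (hbij : ∀ Y h, Function.Bijective (sec Y h)) :
    ∃ (_ : GrpObj G) (_ : IsCommMonObj G), ∀ Y (h : P Y) (a b : Y ⟶ G),
      sec Y h (lift a b ≫ MonObj.mul) = sec Y h a + sec Y h b := by
  have hGG := hP₂ G G hG hG
  -- The functor is represented only on test objects satisfying `P`. This suffices because the group
  -- operations and axioms involve only finite products of copies of `G`.
  obtain ⟨m, hm⟩ := (hbij (G ⊗ G) hGG).2 (sec _ hGG (fst G G) + sec _ hGG (snd G G))
  obtain ⟨e, he⟩ := (hbij (𝟙_ C) hP₁).2 0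
  obtain ⟨i, hi⟩ := (hbij G hG).2 (-sec G hG (𝟙 G))
  have key (Y) (h : P Y) (l : Y ⟶ G ⊗ G) :
      sec Y h (l ≫ m) = sec Y h (l ≫ fst G G) + sec Y h (l ≫ snd G G) := by
    rw [hsec Y _ h hGG, hm, map_add, ← hsec, ← hsec]
  have he' (Y) (h : P Y) (l : Y ⟶ 𝟙_ C) : sec Y h (l ≫ e) = 0 := by
    rw [hsec Y _ h hP₁, he, map_zero]
  have hi' (Y) (h : P Y) (l : Y ⟶ G) : sec Y h (l ≫ i) = -sec Y h l := by
    rw [hsec Y _ h hG, hi, map_neg, ← hsec, Category.comp_id]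
  let _ : GrpObj G :=
    { one := e
      mul := m
      inv := i
      one_mul := (hbij _ (hP₂ _ _ hP₁ hG)).1 (by
        rw [key, whiskerRight_fst, whiskerRight_snd, he', zero_add, leftUnitor_hom])
      mul_one := (hbij _ (hP₂ _ _ hG hP₁)).1 (by
        rw [key, whiskerLeft_fst, whiskerLeft_snd, he', add_zero, rightUnitor_hom])
      mul_assoc := (hbij _ (hP₂ _ _ hGG hG)).1 (by
        rw [key, whiskerRight_fst, whiskerRight_snd, key, ← Category.assoc _ _ m, key,
          Category.assoc, whiskerLeft_fst, Category.assoc, whiskerLeft_snd,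
          ← Category.assoc _ _ m, key]
        simp [add_assoc])
      left_inv := (hbij _ hG).1 (by
        rw [key, he', lift_fst, lift_snd, hi, neg_add_cancel])
      right_inv := (hbij _ hG).1 (by
        rw [key, he', lift_fst, lift_snd, hi, add_neg_cancel]) }
  refine ⟨inferInstance, ⟨(hbij _ hGG).1 ?_⟩, fun Y h a b => ?_⟩
  · change sec _ _ (_ ≫ m) = sec _ _ m
    rw [key, hm, braiding_hom_fst, braiding_hom_snd, add_comm]
  · exact (key Y h _).trans (by rw [lift_fst, lift_snd])

variable {X : Scheme.{u}}

open MonoidalCategory CartesianMonoidalCategory in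
/-- Sheaves of abelian groups that are represented by an étale scheme are represented by
a commutative group scheme. -/
theorem exists_grpObj_of_bijective (F : X.Etaleᵒᵖ ⥤ AddCommGrpCat.{u + 1}) (G : X.Etale)
    (ξ : F.obj (op G))
    (hξ : ∀ Z : X.Etale, Function.Bijective fun f : Z ⟶ G => res F f ξ) :
    ∃ (_ : GrpObj (Over.mk G.hom)) (_ : IsCommMonObj (Over.mk G.hom)),
      ∃ e : ∀ U : X.Etale, F.obj (op U) ≃+
          Additive ((Scheme.Etale.forget X).obj U ⟶ Over.mk G.hom),
        ∀ ⦃U V : X.Etale⦄ (p : U ⟶ V) (a : F.obj (op V)),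
          (e U (F.map p.op a)).toMul = (Scheme.Etale.forget X).map p ≫ (e V a).toMul := by
  let T (Y : Over X) (h : Etale Y.hom) : X.Etale := ⟨Y, h⟩
  let hom (Y Z : Over X) (hY : Etale Y.hom) (hZ : Etale Z.hom) (f : Y ⟶ Z) : T Y hY ⟶ T Z hZ :=
    etaleHom f.left (Over.w f)
  let sec (Y : Over X) (h : Etale Y.hom) (f : Y ⟶ Over.mk G.hom) : F.obj (op (T Y h)) :=
    res F (etaleHom (V := G) f.left (Over.w f)) ξ
  have hsec (Y Z : Over X) (hY : Etale Y.hom) (hZ : Etale Z.hom) (f : Y ⟶ Z)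
      (g : Z ⟶ Over.mk G.hom) : sec Y hY (f ≫ g) = res F (hom Y Z hY hZ f) (sec Z hZ g) := by
    change res F _ ξ = res F _ (res F _ ξ)
    rw [← res_comp]
    rfl
  have hbij (Y : Over X) (h : Etale Y.hom) : Function.Bijective (sec Y h) := by
    constructor
    · intro f g hfg
      have := (hξ (T Y h)).1 hfg
      exact Over.OverMorphism.ext (congrArg (fun m : T Y h ⟶ G => m.left) this)
    · intro s
      obtain ⟨f, hf⟩ := (hξ (T Y h)).2 s
      exact ⟨Over.homMk f.left (etale_w f), hf⟩
  obtain ⟨h1, h2, H⟩ := exists_grpObj (C := Over X) (fun Y => Etale Y.hom)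
    (inferInstanceAs (Etale (𝟙 X)))
    (fun Y Z hY hZ => by
      rw [Over.tensorObj_hom]
      infer_instance) (Over.mk G.hom) G.prop
    (fun Y h => F.obj (op (T Y h))) (fun Y Z hY hZ f => res F (hom Y Z hY hZ f)) sec hsec hbij
  refine ⟨h1, h2, fun U => AddEquiv.symm
    { toEquiv := Additive.toMul.trans (Equiv.ofBijective _ (hbij _ U.prop))
      map_add' := fun a b => H _ _ _ _ }, ?_⟩
  intro U V p a
  refine (hbij _ U.prop).1 ?_
  have h3 (W : X.Etale) (b : F.obj (op W)) :
      sec _ W.prop ((Equiv.ofBijective _ (hbij _ W.prop)).symm b) = b :=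
    (Equiv.ofBijective _ (hbij _ W.prop)).apply_symm_apply b
  refine (h3 U _).trans (Eq.trans ?_ (hsec _ _ U.prop V.prop _ _).symm)
  exact congrArg (res F p) (h3 V a).symm

end
end TameSite

namespace TameSite
noncomputable section

/-! ### Valuations and morphisms -/

/-- The homomorphism of valuation rings induced by a homomorphism of fields. -/
def comapHom {K L : Type u} [Field K] [Field L] (i : K →+* L) (w : ValuationSubring L) :
    w.comap i →+* w :=
  (i.comp (w.comap i).subtype).codRestrict w.toSubring fun a => a.2

lemma IsSValuation.of_comap {K L : Type u} [Field K] [Field L] {X Y S : Scheme.{u}}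
    {x : Spec (.of K) ⟶ X} {y : Spec (.of L) ⟶ Y} {s : X ⟶ S} {t : Y ⟶ S} (i : K →+* L)
    (h : y ≫ t = Spec.map (CommRingCat.ofHom i) ≫ x ≫ s) {w : ValuationSubring L}
    (hw : IsSValuation x s (w.comap i)) : IsSValuation y t w := by
  obtain ⟨φ, hφ⟩ := hw
  refine ⟨Spec.map (CommRingCat.ofHom (comapHom i w)) ≫ φ, ?_⟩
  rw [h, ← hφ, ← Spec.map_comp_assoc, ← Spec.map_comp_assoc]
  rfl

/-- The spectrum of the local ring `w` lands in any affine open that contains the image of its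
closed point. On that open, a ring map to `K` whose composite to `L` lands in `w` lands in `w.comap
i`. -/
lemma exists_comap_specMap {K L : Type u} [Field K] [Field L] {S : Scheme.{u}} (i : K →+* L)
    (w : ValuationSubring L) (x : Spec (.of K) ⟶ S) (φ : Spec (.of w) ⟶ S)
    (h : Spec.map (CommRingCat.ofHom w.subtype) ≫ φ = Spec.map (CommRingCat.ofHom i) ≫ x) :
    ∃ ψ : Spec (.of (w.comap i)) ⟶ S,
      Spec.map (CommRingCat.ofHom (w.comap i).subtype) ≫ ψ = x := by
  obtain ⟨_, ⟨V, hV, rfl⟩, hzV, -⟩ := S.isBasis_affineOpens.exists_subset_of_mem_open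
    (Set.mem_univ (φ (IsLocalRing.closedPoint w))) isOpen_univ
  have hφ : φ ⁻¹ᵁ V = ⊤ := (IsLocalRing.closed_point_mem_iff).1 hzV
  have hφ' : Set.range φ ⊆ Set.range hV.fromSpec := by
    rintro _ ⟨a, rfl⟩
    rw [hV.range_fromSpec]
    exact hφ.ge (Set.mem_univ a)
  have hx : Set.range x ⊆ Set.range hV.fromSpec := by
    rintro _ ⟨a, rfl⟩
    let b : Spec (.of L) := IsLocalRing.closedPoint L
    obtain rfl : Spec.map (CommRingCat.ofHom i) b = a := Subsingleton.elim _ _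
    rw [← Scheme.Hom.comp_apply, ← h, Scheme.Hom.comp_apply]
    exact hφ' ⟨_, rfl⟩
  have := hV.isOpenImmersion_fromSpec
  let φ' := IsOpenImmersion.lift hV.fromSpec φ hφ'
  let x' := IsOpenImmersion.lift hV.fromSpec x hx
  have h1 : φ' ≫ hV.fromSpec = φ := IsOpenImmersion.lift_fac _ _ _
  have h2 : x' ≫ hV.fromSpec = x := IsOpenImmersion.lift_fac _ _ _
  have h3 : Spec.map (CommRingCat.ofHom w.subtype) ≫ φ' = Spec.map (CommRingCat.ofHom i) ≫ x' := by
    rw [← cancel_mono hV.fromSpec, Category.assoc, Category.assoc, h1, h2, h]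
  obtain ⟨g, hg⟩ := Spec.map_surjective φ'
  obtain ⟨k, hk⟩ := Spec.map_surjective x'
  rw [← hg, ← hk, ← Spec.map_comp, ← Spec.map_comp] at h3
  have h4 (b) : (g.hom b : L) = i (k.hom b) := ConcreteCategory.congr_hom (Spec.map_injective h3) b
  let m : Γ(S, V) →+* w.comap i := k.hom.codRestrict (w.comap i).toSubring fun b => by
    change i (k.hom b) ∈ w
    rw [← h4]
    exact (g.hom b).2
  refine ⟨Spec.map (CommRingCat.ofHom m) ≫ hV.fromSpec, ?_⟩
  rw [← Spec.map_comp_assoc, ← h2, ← hk]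
  rfl

lemma IsSValuation.comap {K L : Type u} [Field K] [Field L] {X Y S : Scheme.{u}}
    {x : Spec (.of K) ⟶ X} {y : Spec (.of L) ⟶ Y} {s : X ⟶ S} {t : Y ⟶ S} (i : K →+* L)
    (h : y ≫ t = Spec.map (CommRingCat.ofHom i) ≫ x ≫ s) {w : ValuationSubring L}
    (hw : IsSValuation y t w) : IsSValuation x s (w.comap i) := by
  obtain ⟨φ, hφ⟩ := hw
  exact exists_comap_specMap i w (x ≫ s) φ (hφ.trans h)

lemma fromSpecResidueField_comp {X Y S : Scheme.{u}} (f : Y ⟶ X) (s : X ⟶ S) (y : Y) :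
    Y.fromSpecResidueField y ≫ f ≫ s =
      Spec.map (f.residueFieldMap y) ≫ X.fromSpecResidueField (f y) ≫ s := by
  rw [← Category.assoc, ← Scheme.Hom.SpecMap_residueFieldMap_fromSpecResidueField, Category.assoc]

/-- Both directions serve: the forward one to lift valuations into a covering, the backward one to
push a valuation of the representing scheme down to `X`. -/
lemma map_mem_val_iff {X Y S : Scheme.{u}} (f : Y ⟶ X) (s : X ⟶ S) (t : Y ⟶ S) (ht : f ≫ s = t)
    (q : ValuedPoint Y) : q.map f ∈ Val s ↔ q ∈ Val t := by
  subst ht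
  exact ⟨fun h => IsSValuation.of_comap _ (fromSpecResidueField_comp f s q.1) h,
    fun h => IsSValuation.comap _ (fromSpecResidueField_comp f s q.1) h⟩

/-! ### The tame topology -/

variable {X S : Scheme.{u}} (s : X ⟶ S)

lemma exists_map_eq_of_isOpenImmersion {U V : Scheme.{u}} (p : V ⟶ U) [IsOpenImmersion p]
    (y : V) (q : ValuedPoint U) (h : p y = q.1) : ∃ r : ValuedPoint V, r.map p = q := by
  obtain ⟨x, v⟩ := q
  obtain rfl : p y = x := h
  let i : U.residueField (p y) ≅ V.residueField y := asIso (p.residueFieldMap y)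
  refine ⟨⟨y, v.comap i.inv.hom⟩, ?_⟩
  have : (v.comap i.inv.hom).comap (p.residueFieldMap y).hom = v := by
    ext a
    change i.inv.hom (i.hom.hom a) ∈ v ↔ a ∈ v
    rw [Iso.hom_inv_id_apply]
  exact Sigma.ext rfl (heq_of_eq this)

/-- Open immersions induce isomorphisms of residue fields, so valuations lift uniquely along them
without ramification. -/
theorem zariski_le_tameTopology : zariskiTopologyOnEtale X ≤ tameTopology s := by
  intro T S hS
  rw [mem_zariskiTopologyOnEtale_iff] at hS
  let R : Presieve T := fun V p => S p ∧ IsOpenImmersion p.left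
  have hR : R ∈ tamePrecoverage s T := by
    refine ⟨fun x => ?_, fun q hq => ?_⟩
    · obtain ⟨V, p, y, h, ho, hy⟩ := hS x
      exact ⟨V, p, y, ⟨h, ho⟩, hy⟩
    · obtain ⟨V, p, y, h, ho, hy⟩ := hS q.1
      obtain ⟨r, rfl⟩ := exists_map_eq_of_isOpenImmersion p.left y q hy
      refine ⟨V, p, ⟨h, ho⟩, r, ?_, rfl, ?_⟩
      · exact (map_mem_val_iff p.left (T.hom ≫ s) _ (by rw [etale_w_assoc]) r).1 hq
      · exact isTamelyRamified_of_bijective _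
          (ConcreteCategory.bijective_of_isIso (p.left.residueFieldMap r.1)) _
  refine (tameTopology s).superset_covering ?_ (Precoverage.generate_mem_toGrothendieck hR)
  rintro V _ ⟨W, a, b, hb, rfl⟩
  exact S.downward_closed hb.1 a

/-! ### Charts of locally constant sheaves -/

section Charts

variable {F : X.Etaleᵒᵖ ⥤ AddCommGrpCat.{u + 1}} {U : X.Etale} {A : AddCommGrpCat.{u + 1}}

/-- An étale `U`-scheme from a morphism of étale `X`-schemes. -/
abbrev overEtale {V : X.Etale} (p : V ⟶ U) : U.left.Etale := Scheme.Etale.mk p.left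

/-- The sections of a presheaf on `X` in terms of the restriction to `U`. -/
def resHom (e : restrict F U ≅ constantEtaleSheaf U.left A) {V : X.Etale} (p : V ⟶ U) :
    F.obj (op V) →+ (constantEtaleSheaf U.left A).obj (op (overEtale p)) :=
  (e.hom.app (op (overEtale p))).hom.comp
    (res F (etaleHom (U := (etaleMap U.hom U.prop).obj (overEtale p)) (V := V) (𝟙 V.left)
      ((Category.id_comp _).trans (etale_w p).symm)))

lemma res_bijective_of_isIso {V W : X.Etale} (p : V ⟶ W) [IsIso p] :
    Function.Bijective (res F p) :=
  ConcreteCategory.bijective_of_isIso (F.map p.op)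

lemma isIso_etale {V W : X.Etale} (p : V ⟶ W) [IsIso p.left] : IsIso p :=
  ⟨etaleHom (inv p.left) (by rw [← etale_w p, IsIso.inv_hom_id_assoc]),
    etale_hom_ext (IsIso.hom_inv_id p.left), etale_hom_ext (IsIso.inv_hom_id p.left)⟩

variable (e : restrict F U ≅ constantEtaleSheaf U.left A)

lemma resHom_bijective {V : X.Etale} (p : V ⟶ U) : Function.Bijective (resHom e p) := by
  have h : IsIso (etaleHom (U := (etaleMap U.hom U.prop).obj (overEtale p)) (V := V) (𝟙 V.left)
      ((Category.id_comp _).trans (etale_w p).symm)) := by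
    apply +allowSynthFailures isIso_etale
    exact inferInstanceAs (IsIso (𝟙 V.left))
  exact (ConcreteCategory.bijective_of_isIso (e.hom.app (op (overEtale p)))).comp
    (res_bijective_of_isIso _)

lemma resHom_res {V W : X.Etale} (p : V ⟶ U) (q : W ⟶ V) (t : F.obj (op V)) :
    resHom e (q ≫ p) (res F q t) = (constantEtaleSheaf U.left A).map
      (etaleHom (U := overEtale (q ≫ p)) (V := overEtale p) q.left rfl).op (resHom e p t) := by
  let r : overEtale (q ≫ p) ⟶ overEtale p := etaleHom q.left rfl
  have h := ConcreteCategory.congr_hom (e.hom.naturality r.op)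
    (res F (etaleHom (U := (etaleMap U.hom U.prop).obj (overEtale p)) (V := V) (𝟙 V.left)
      ((Category.id_comp _).trans (etale_w p).symm)) t)
  refine Eq.trans ?_ h
  change (e.hom.app _).hom _ = (e.hom.app _).hom (res F ((etaleMap U.hom U.prop).map r) _)
  refine congrArg (e.hom.app _).hom ((res_comp F _ _ _).symm.trans (Eq.trans ?_ (res_comp F _ _ _)))
  exact congrArg (fun m => res F m t)
    (etale_hom_ext ((Category.id_comp _).trans (Category.comp_id _).symm))

include e in
/-- The sections of a sheaf that is isomorphic to a constant sheaf. -/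
theorem exists_constant_sections : ∃ c : A → F.obj (op U),
    (∀ (V : X.Etale) (p : V ⟶ U) (t : F.obj (op V)) (v : V.left), ∃ (V' : X.Etale) (q : V' ⟶ V)
      (v' : V'.left) (a : A), IsOpenImmersion q.left ∧ q.left v' = v ∧
      res F q t = res F (q ≫ p) (c a)) ∧
    ∀ (V : X.Etale) (p : V ⟶ U) (a b : A), Nonempty V.left →
      res F p (c a) = res F p (c b) → a = b := by
  let G := constantEtaleSheaf U.left A
  let P : U.left.Etaleᵒᵖ ⥤ AddCommGrpCat.{u + 1} := (Functor.const _).obj A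
  -- The sheafification map is locally injective and locally surjective. The sections `c a` are the
  -- images of the constant sections, transported through `e`.
  let θ : P ⟶ G := toSheafify (zariskiTopologyOnEtale U.left) P
  have hi : Presheaf.IsLocallyInjective (zariskiTopologyOnEtale U.left) θ :=
    inferInstanceAs (Presheaf.IsLocallyInjective _ (toSheafify _ P))
  have hs : Presheaf.IsLocallySurjective (zariskiTopologyOnEtale U.left) θ :=
    inferInstanceAs (Presheaf.IsLocallySurjective _ (toSheafify _ P))
  have hθ {V W : U.left.Etale} (q : W ⟶ V) (a : A) :
      G.map q.op ((θ.app (op V)).hom a) = (θ.app (op W)).hom a :=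
    (ConcreteCategory.congr_hom (θ.naturality q.op) a).symm
  choose c hc using fun a : A => (resHom_bijective e (𝟙 U)).2 ((θ.app _).hom a)
  have hc' {V : X.Etale} (p : V ⟶ U) (a : A) : resHom e p (res F p (c a)) = (θ.app _).hom a := by
    have h := resHom_res e (𝟙 U) p (c a)
    rw [hc] at h
    have h' := h.trans (hθ _ a)
    have key (r : V ⟶ U) (hr : r = p) (h : resHom e r (res F p (c a)) = (θ.app _).hom a) :
        resHom e p (res F p (c a)) = (θ.app _).hom a := by
      subst hr
      exact h
    exact key _ (Category.comp_id p) h'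
  refine ⟨c, fun V p t v => ?_, fun V p a b hV h => ?_⟩
  · have h := (mem_zariskiTopologyOnEtale_iff _).1
      (Presheaf.imageSieve_mem (zariskiTopologyOnEtale U.left) θ (resHom e p t)) v
    obtain ⟨W, q, y, ⟨a, ha⟩, hq, hy⟩ := h
    let q₀ : W.left ⟶ V.left := q.left
    have : IsOpenImmersion q₀ := hq
    let q' : etaleOver V q₀ ⟶ V := etaleOverHom V q₀
    refine ⟨etaleOver V q₀, q', y, a, hq, hy, (resHom_bijective e (q' ≫ p)).1 ?_⟩
    refine (resHom_res e p q' t).trans (Eq.trans ?_ (hc' (q' ≫ p) _).symm)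
    let r : overEtale (q' ≫ p) ⟶ W := etaleHom (𝟙 W.left)
      ((Category.id_comp _).trans (etale_w q).symm)
    have h1 := congrArg (G.map r.op).hom ha
    refine Eq.trans (Eq.trans ?_ h1.symm) (hθ r a)
    have h2 : etaleHom (U := overEtale (q' ≫ p)) (V := overEtale p) q'.left rfl = r ≫ q :=
      etale_hom_ext (Category.id_comp _).symm
    exact (congrArg (fun m => (G.map m.op).hom (resHom e p t)) h2).trans
      (ConcreteCategory.congr_hom (G.map_comp q.op r.op) (resHom e p t))
  · have h1 : (θ.app (op (overEtale p))).hom a = (θ.app (op (overEtale p))).hom b :=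
      (hc' p _).symm.trans ((congrArg (resHom e p) h).trans (hc' p _))
    obtain ⟨v⟩ := hV
    obtain ⟨W, q, y, hq, -⟩ := (mem_zariskiTopologyOnEtale_iff _).1
      (Presheaf.equalizerSieve_mem (zariskiTopologyOnEtale U.left) θ _ _ h1) v
    exact hq

include e in
/-- A sheaf that is isomorphic to a constant sheaf with finite group has a chart. -/
theorem exists_isChart_of_finite [Finite A] : ∃ (n : ℕ) (c : Fin n → F.obj (op U)),
    IsChart F U c := by
  obtain ⟨c, h, h'⟩ := exists_constant_sections e
  obtain ⟨n, ⟨f⟩⟩ := Finite.exists_equiv_fin A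
  refine ⟨n, fun a => c (f.symm a), fun V p t v => ?_, fun V p a b hV hab =>
    f.symm.injective (h' V p _ _ hV hab)⟩
  obtain ⟨V', q, v', a, ho, hv, ha⟩ := h V p t v
  exact ⟨V', q, v', f a, ho, hv, by rw [ha, f.symm_apply_apply]⟩

/-- An empty member of the covering has no point at which a stalk could bound the group, but the
empty family is a chart. -/
lemma isChart_of_isEmpty (hU : IsEmpty U.left) : IsChart F U (n := 0) Fin.elim0 where
  locally_eq _ p _ v := hU.elim (p.left v)
  injective _ _ a := a.elim0

end Charts

variable {s}

theorem isLocallyFiniteSheaf_of_charts (F : TameSheaf s)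
    {R : Presieve (Scheme.Etale.mk (𝟙 X))} (hR : R ∈ tamePrecoverage s (Scheme.Etale.mk (𝟙 X)))
    (h : ∀ ⦃U : X.Etale⦄ (p : U ⟶ Scheme.Etale.mk (𝟙 X)), R p →
      ∃ (n : ℕ) (c : Fin n → F.obj.obj (op U)), IsChart F.obj U c) :
    IsLocallyFiniteSheaf F.obj (tameTopology s) where
  isSheaf := F.property
  zariski_le := zariski_le_tameTopology s
  exists_charts T := by
    let t : T ⟶ Scheme.Etale.mk (𝟙 X) := etaleHom T.hom (Category.comp_id _)
    refine ⟨(Sieve.generate R).pullback t, (tameTopology s).pullback_stable t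
      (Precoverage.generate_mem_toGrothendieck hR), ?_⟩
    rintro V p ⟨W, a, b, hb, -⟩
    obtain ⟨n, c, hc⟩ := h b hb
    exact ⟨n, _, hc.restrict a⟩

theorem hasCharts_of_charts (F : TameSheaf s)
    {R : Presieve (Scheme.Etale.mk (𝟙 X))} (hR : R ∈ tamePrecoverage s (Scheme.Etale.mk (𝟙 X)))
    (h : ∀ ⦃U : X.Etale⦄ (p : U ⟶ Scheme.Etale.mk (𝟙 X)), R p →
      ∃ (n : ℕ) (c : Fin n → F.obj.obj (op U)), IsChart F.obj U c) : HasCharts F.obj where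
  exists_chart x := by
    obtain ⟨W, p, w, hp, hw⟩ := hR.1 x
    obtain ⟨n, c, hc⟩ := h p hp
    refine ⟨W, w, n, c, ?_, hc⟩
    have := etale_w p
    rw [← this]
    exact hw
end
end TameSite

/-! ### Inverse images of presheaves as filtered colimits. -/

namespace TameSite
noncomputable section

open Limits

variable {X Y : Scheme.{u}} (f : Y ⟶ X)

/-- Base change of étale schemes is computed by base change of schemes. -/
def etaleBaseChangeForgetIso :
    etaleBaseChange f ⋙ Scheme.Etale.forget Y ≅ Scheme.Etale.forget X ⋙ Over.pullback f :=
  NatIso.ofComponents (fun A => Iso.refl _) fun {A B} g => by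
    refine (Category.comp_id _).trans (Eq.trans ?_ (Category.id_comp _).symm)
    exact Over.OverMorphism.ext (pullback.hom_ext
      ((pullback.lift_fst _ _ _).trans (pullback.lift_fst _ _ _).symm)
      ((pullback.lift_snd _ _ _).trans (pullback.lift_snd _ _ _).symm))

instance : PreservesFiniteLimits (etaleBaseChange f) := by
  have : PreservesFiniteLimits (etaleBaseChange f ⋙ Scheme.Etale.forget Y) :=
    preservesFiniteLimits_of_natIso (etaleBaseChangeForgetIso f).symm
  exact preservesFiniteLimits_of_reflects_of_preserves _ (Scheme.Etale.forget Y)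

instance : RepresentablyFlat (etaleBaseChange f) :=
  flat_of_preservesFiniteLimits _

/-- Base change preserves finite limits and is therefore representably flat. Hence the colimits that
compute the left Kan extension are filtered, and can be described elementwise. -/
instance (T : Y.Etaleᵒᵖ) : IsFiltered (CostructuredArrow (etaleBaseChange f).op T) :=
  IsFiltered.of_equivalence (structuredArrowOpEquivalence (etaleBaseChange f) T.unop)

variable {f} (F : X.Etaleᵒᵖ ⥤ AddCommGrpCat.{u + 1})

lemma exists_lan_rep (T : Y.Etale)
    (z : ((etaleBaseChange f).op.lan.obj F).obj (op T)) :
    ∃ (g : CostructuredArrow (etaleBaseChange f).op (op T)) (a : F.obj g.left),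
      ((etaleBaseChange f).op.lan.obj F).map g.hom
        ((((etaleBaseChange f).op.lanUnit.app F).app g.left) a) = z := by
  have h := Functor.isPointwiseLeftKanExtensionLeftKanExtensionUnit (etaleBaseChange f).op F (op T)
  have : PreservesFilteredColimitsOfSize.{u, u + 1} (forget AddCommGrpCat.{u + 1}) :=
    preservesFilteredColimitsOfSize_of_univLE.{u + 1, u + 1} _
  exact Concrete.isColimit_exists_rep _ h z

lemma exists_of_lan_rep_eq (T : Y.Etale) (g : CostructuredArrow (etaleBaseChange f).op (op T))
    (a b : F.obj g.left) (hab : ((etaleBaseChange f).op.lan.obj F).map g.hom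
        ((((etaleBaseChange f).op.lanUnit.app F).app g.left) a) =
      ((etaleBaseChange f).op.lan.obj F).map g.hom
        ((((etaleBaseChange f).op.lanUnit.app F).app g.left) b)) :
    ∃ (g' : CostructuredArrow (etaleBaseChange f).op (op T)) (m : g ⟶ g'),
      F.map m.left a = F.map m.left b := by
  have h := Functor.isPointwiseLeftKanExtensionLeftKanExtensionUnit (etaleBaseChange f).op F (op T)
  have : PreservesFilteredColimitsOfSize.{u, u + 1} (forget AddCommGrpCat.{u + 1}) :=
    preservesFilteredColimitsOfSize_of_univLE.{u + 1, u + 1} _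
  obtain ⟨k, m, n, hmn⟩ := Concrete.isColimit_exists_of_rep_eq _ h a b hab
  -- The two elements become equal along possibly different morphisms, which are coequalized further
  -- on.
  refine ⟨IsFiltered.coeq m n, m ≫ IsFiltered.coeqHom m n, ?_⟩
  have h1 : m ≫ IsFiltered.coeqHom m n = n ≫ IsFiltered.coeqHom m n :=
    IsFiltered.coeq_condition m n
  have key {c d e : CostructuredArrow (etaleBaseChange f).op (op T)} (r : c ⟶ d) (t : d ⟶ e)
      (x : F.obj c.left) : F.map (r ≫ t).left x = F.map t.left (F.map r.left x) := by
    rw [CostructuredArrow.comp_left, F.map_comp, CategoryTheory.comp_apply]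
  have h2 := congrArg (F.map (IsFiltered.coeqHom m n).left) hmn
  rw [key, h1, key]
  exact h2

end
end TameSite

namespace TameSite
noncomputable section

/-! ### Points with values in fields -/

lemma exists_fromSpecResidueField {K : Type u} [Field K] {X : Scheme.{u}} (x : Spec (.of K) ⟶ X) :
    ∃ (y : X) (j : X.residueField y →+* K),
      x = Spec.map (CommRingCat.ofHom j) ≫ X.fromSpecResidueField y := by
  obtain ⟨⟨y, j⟩, rfl⟩ := (Scheme.SpecToEquivOfField K X).symm.surjective x
  exact ⟨y, j.hom, rfl⟩

/-- The structure homomorphism of the residue field of a scheme over a field. -/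
def residueFieldAlgebra {k : Type u} [Field k] {V : Scheme.{u}} (f : V ⟶ Spec (.of k)) (w : V) :
    k →+* V.residueField w :=
  (Spec.preimage (V.fromSpecResidueField w ≫ f)).hom

lemma specMap_residueFieldAlgebra {k : Type u} [Field k] {V : Scheme.{u}} (f : V ⟶ Spec (.of k))
    (w : V) : Spec.map (CommRingCat.ofHom (residueFieldAlgebra f w)) =
      V.fromSpecResidueField w ≫ f :=
  Spec.map_preimage _

lemma ringHom_eq_of_specMap_eq {A B : Type u} [CommRing A] [CommRing B] {a b : A →+* B}
    (h : Spec.map (CommRingCat.ofHom a) = Spec.map (CommRingCat.ofHom b)) : a = b :=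
  congrArg CommRingCat.Hom.hom (Spec.map_injective h)

/-- The residue field of the point of `Spec k` is isomorphic to `k`, but not equal to it. The
surjection `ρ` carries facts about residue field maps over to `k`. -/
lemma residueFieldAlgebra_eq {k : Type u} [Field k] {V : Scheme.{u}} (f : V ⟶ Spec (.of k))
    (w : V) : ∃ ρ : k →+* (Spec (.of k)).residueField (f w), Function.Surjective ρ ∧
      residueFieldAlgebra f w = (f.residueFieldMap w).hom.comp ρ := by
  let c := f w
  have : c.asIdeal.IsPrime := c.isPrime
  have : c.asIdeal.IsMaximal := Ideal.isMaximal_of_isPrime c.asIdeal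
  refine ⟨(CommRingCat.ofHom (algebraMap k c.asIdeal.ResidueField) ≫
    (Scheme.Spec.residueFieldIso (.of k) c).inv).hom, ?_, ?_⟩
  · exact (ConcreteCategory.bijective_of_isIso (Scheme.Spec.residueFieldIso (.of k) c).inv).2.comp
      c.asIdeal.algebraMap_residueField_surjective
  · refine ringHom_eq_of_specMap_eq ?_
    refine (specMap_residueFieldAlgebra f w).trans ?_
    rw [← Scheme.Hom.SpecMap_residueFieldMap_fromSpecResidueField,
      ← Scheme.Spec.map_residueFieldIso_inv_eq_fromSpecResidueField, ← Spec.map_comp,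
      ← Spec.map_comp]
    rfl

lemma residueFieldMap_formallyUnramified {X Y : Scheme.{u}} (f : Y ⟶ X) [FormallyUnramified f]
    (y : Y) : (f.residueFieldMap y).hom.FormallyUnramified := by
  refine RingHom.FormallyUnramified.of_comp (f := (X.residue (f y)).hom) ?_
  have h := congrArg CommRingCat.Hom.hom (Scheme.residue_residueFieldMap f y)
  change (X.residue (f y) ≫ f.residueFieldMap y).hom.FormallyUnramified
  rw [h]
  exact (FormallyUnramified.stalkMap f y).comp
    (RingHom.FormallyUnramified.of_surjective (Y.residue_surjective y))

lemma residueFieldMap_essFiniteType {X Y : Scheme.{u}} (f : Y ⟶ X) [LocallyOfFiniteType f]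
    (y : Y) : (f.residueFieldMap y).hom.EssFiniteType := by
  refine RingHom.EssFiniteType.of_comp (X.residue (f y)).hom ?_
  have h := congrArg CommRingCat.Hom.hom (Scheme.residue_residueFieldMap f y)
  change (X.residue (f y) ≫ f.residueFieldMap y).hom.EssFiniteType
  rw [h]
  exact (LocallyOfFiniteType.stalkMap f y).comp
    (RingHom.FiniteType.of_surjective _ (Y.residue_surjective y)).essFiniteType

lemma finite_isSeparable_of_formallyUnramified {k L : Type u} [Field k] [Field L] [Algebra k L]
    (h : (algebraMap k L).FormallyUnramified) (h' : (algebraMap k L).EssFiniteType) :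
    FiniteDimensional k L ∧ Algebra.IsSeparable k L := by
  rw [RingHom.formallyUnramified_algebraMap] at h
  rw [RingHom.essFiniteType_algebraMap] at h'
  exact ⟨Algebra.FormallyUnramified.finite_of_free k L, Algebra.FormallyUnramified.isSeparable k L⟩

lemma residueFieldAlgebra_formallyUnramified {k : Type u} [Field k] {V : Scheme.{u}}
    (f : V ⟶ Spec (.of k)) [Etale f] (w : V) :
    (residueFieldAlgebra f w).FormallyUnramified ∧ (residueFieldAlgebra f w).EssFiniteType := by
  obtain ⟨ρ, hρ, h⟩ := residueFieldAlgebra_eq f w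
  rw [h]
  exact ⟨(RingHom.FormallyUnramified.of_surjective hρ).comp (residueFieldMap_formallyUnramified f w),
    (RingHom.FiniteType.of_surjective _ hρ).essFiniteType.comp (residueFieldMap_essFiniteType f w)⟩

/-! ### The tame site of a tame point -/

namespace TamePoint

variable {X S : Scheme.{u}} {s : X ⟶ S} (P : TamePoint s)

/-- The final object of the site of a tame point. -/
abbrev final : (Spec (.of P.k)).Etale := Scheme.Etale.mk (𝟙 (Spec (.of P.k)))

-- The residue field at `p r.1` is `k`, because `t` is a section of `a`. The residue field at `r.1`
-- is then a finite separable extension of `k` with a tamely ramified extension of the valuation,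
-- hence also `k`, which gives the lift.
variable {P} in
lemma exists_lift_of_isTamelyRamified {U V : Scheme.{u}} (p : V ⟶ U) (a : U ⟶ Spec (.of P.k))
    [Etale (p ≫ a)] (t : Spec (.of P.k) ⟶ U) (hta : t ≫ a = 𝟙 _) (r : ValuedPoint V)
    (j : U.residueField (p r.1) →+* P.k)
    (hj : t = Spec.map (CommRingCat.ofHom j) ≫ U.fromSpecResidueField (p r.1))
    (hr : P.v.comap j = r.2.comap (p.residueFieldMap r.1).hom)
    (h : IsTamelyRamified (p.residueFieldMap r.1).hom r.2) :
    ∃ t' : Spec (.of P.k) ⟶ V, t' ≫ p = t := by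
  obtain ⟨w, vw⟩ := r
  dsimp only at j hj hr h
  let i₀ := residueFieldAlgebra a (p w)
  have h0 : j.comp i₀ = RingHom.id P.k := by
    refine ringHom_eq_of_specMap_eq ?_
    rw [CommRingCat.ofHom_comp, Spec.map_comp, specMap_residueFieldAlgebra, ← Category.assoc, ← hj,
      hta]
    exact (Spec.map_id _).symm
  have h0' (a) : j (i₀ a) = a := RingHom.congr_fun h0 a
  have hi₀ : Function.Bijective i₀ := ⟨i₀.injective, fun a => ⟨j a, j.injective (h0' _)⟩⟩
  let i := (p.residueFieldMap w).hom.comp i₀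
  have hi : i = residueFieldAlgebra (p ≫ a) w := by
    refine ringHom_eq_of_specMap_eq ?_
    rw [specMap_residueFieldAlgebra, fromSpecResidueField_comp, ← specMap_residueFieldAlgebra,
      ← Spec.map_comp]
    rfl
  let algi : Algebra P.k (V.residueField w) := i.toAlgebra
  have hu := residueFieldAlgebra_formallyUnramified (p ≫ a) w
  rw [← hi] at hu
  obtain ⟨hfin, hsep⟩ := finite_isSeparable_of_formallyUnramified (k := P.k)
    (L := V.residueField w) hu.1 hu.2
  have hsurj : Function.Surjective i := P.surjective_of_isTamelyRamified
    (V.residueField w) vw (by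
      ext b
      change i₀ b ∈ vw.comap (p.residueFieldMap w).hom ↔ _
      rw [← hr, ValuationSubring.mem_comap, h0'])
    (IsTamelyRamified.comp_of_bijective hi₀ h)
  let e := RingEquiv.ofBijective i ⟨i.injective, hsurj⟩
  let i' : V.residueField w →+* P.k := e.symm
  have hi' : i'.comp i = RingHom.id P.k := RingHom.ext fun a => e.symm_apply_apply a
  have hij : i'.comp (p.residueFieldMap w).hom = j := by
    ext a
    obtain ⟨b, rfl⟩ := hi₀.2 a
    exact (RingHom.congr_fun hi' b).trans (h0' b).symm
  refine ⟨Spec.map (CommRingCat.ofHom i') ≫ V.fromSpecResidueField w, ?_⟩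
  rw [hj, Category.assoc, ← Scheme.Hom.SpecMap_residueFieldMap_fromSpecResidueField,
    ← Category.assoc, ← Spec.map_comp, ← hij]
  rfl

lemma isSValuation_of_retraction {U : Scheme.{u}} (a : U ⟶ Spec (.of P.k))
    (t : Spec (.of P.k) ⟶ U) (hta : t ≫ a = 𝟙 _) (x : U) (j : U.residueField x →+* P.k)
    (hj : t = Spec.map (CommRingCat.ofHom j) ≫ U.fromSpecResidueField x) :
    IsSValuation (U.fromSpecResidueField x) (a ≫ P.toSpecValuationRing) (P.v.comap j) := by
  refine IsSValuation.comap (y := 𝟙 (Spec (.of P.k))) (t := P.toSpecValuationRing) j ?_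
    ⟨𝟙 _, by rw [Category.comp_id, Category.id_comp]; rfl⟩
  rw [← Category.assoc, ← hj, ← Category.assoc, hta]

/-- The point `t` carries the valuation of `P`, restricted to its residue field, and a tame covering
contains a tamely ramified valued point above it. -/
lemma exists_factor_of_mem {U : (Spec (.of P.k)).Etale} {R : Presieve U}
    (hR : R ∈ tamePrecoverage P.toSpecValuationRing U) (t : P.final ⟶ U) :
    ∃ (V : (Spec (.of P.k)).Etale) (p : V ⟶ U) (t' : P.final ⟶ V), R p ∧ t' ≫ p = t := by
  have key (q : ValuedPoint U.left) (j : U.left.residueField q.1 →+* P.k)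
      (hj : t.left = Spec.map (CommRingCat.ofHom j) ≫ U.left.fromSpecResidueField q.1)
      (hq : P.v.comap j = q.2) : ∃ (V : (Spec (.of P.k)).Etale) (p : V ⟶ U) (t' : P.final ⟶ V),
        R p ∧ t' ≫ p = t := by
    have hq' : q ∈ Val (U.hom ≫ P.toSpecValuationRing) := by
      change IsSValuation _ _ _
      rw [← hq]
      exact P.isSValuation_of_retraction U.hom t.left (etale_w t) q.1 j hj
    obtain ⟨V, p, hp, r, -, rfl, ht⟩ := hR.2 q hq'
    have : Etale (p.left ≫ U.hom) := by
      rw [etale_w]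
      exact V.prop
    obtain ⟨t', ht'⟩ := exists_lift_of_isTamelyRamified p.left U.hom t.left (etale_w t) r j hj hq ht
    refine ⟨V, p, etaleHom t' ?_, hp, etale_hom_ext ht'⟩
    rw [← etale_w p]
    exact (Category.assoc _ _ _).symm.trans ((congrArg (· ≫ U.hom) ht').trans (etale_w t))
  obtain ⟨u, j, hj⟩ := exists_fromSpecResidueField (K := P.k) t.left
  exact key ⟨u, P.v.comap j⟩ j hj rfl

lemma eq_top_of_mem {U : Sieve P.final} (hU : U ∈ tameTopology P.toSpecValuationRing P.final) :
    U (𝟙 _) := by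
  -- The sieves that contain every morphism from the final object form a topology, and it contains
  -- the tame coverings since these split.
  let J : GrothendieckTopology (Spec (.of P.k)).Etale :=
    { sieves := fun U => {S | ∀ t : P.final ⟶ U, S t}
      top_mem' := fun _ _ => trivial
      pullback_stable' := fun _ _ _ f hS t => hS (t ≫ f)
      transitive' := fun U S hS R hR t => by simpa using hR (hS t) (𝟙 _) }
  have h : tameTopology P.toSpecValuationRing ≤ J := by
    refine Precoverage.toGrothendieck_le_iff_le_toPrecoverage.2 fun U R hR t => ?_
    obtain ⟨V, p, t', hp, ht⟩ := P.exists_factor_of_mem hR t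
    exact ⟨V, t', p, hp, ht⟩
  exact h _ hU (𝟙 _)

/-- Local injectivity and local surjectivity hold globally on the final object, because its only
covering sieve is the maximal one. -/
lemma toSheafify_bijective (G : (Spec (.of P.k)).Etaleᵒᵖ ⥤ AddCommGrpCat.{u + 1}) :
    Function.Bijective ((toSheafify (tameTopology P.toSpecValuationRing) G).app (op P.final)) := by
  constructor
  · intro a b h
    have := P.eq_top_of_mem (Presheaf.equalizerSieve_mem _ (toSheafify _ G) _ _ h)
    change G.map (𝟙 _) a = G.map (𝟙 _) b at this
    simpa using this
  · intro a
    obtain ⟨b, hb⟩ := P.eq_top_of_mem (Presheaf.imageSieve_mem _ (toSheafify _ G) a)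
    refine ⟨b, hb.trans ?_⟩
    simp

end TamePoint
end
end TameSite

namespace TameSite
noncomputable section

namespace TamePoint

open Limits

variable {X S : Scheme.{u}} {s : X ⟶ S} (P : TamePoint s)

/-! ### Evaluation of sections in the stalk -/

/-- The point of an étale `X`-scheme `U` given by a section of its base change. -/
def point {U : X.Etale} (τ : P.final ⟶ (etaleBaseChange P.x).obj U) : Spec (.of P.k) ⟶ U.left :=
  τ.left ≫ pullback.fst U.hom P.x


variable {P}

lemma point_comp_hom {U : X.Etale} (τ : P.final ⟶ (etaleBaseChange P.x).obj U) :
    P.point τ ≫ U.hom = P.x := by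
  refine (Category.assoc _ _ _).trans ((congrArg (τ.left ≫ ·) pullback.condition).trans ?_)
  exact (Category.assoc _ _ _).symm.trans
    ((congrArg (· ≫ P.x) (etale_w τ)).trans (Category.id_comp _))

lemma point_injective {U : X.Etale} {τ τ' : P.final ⟶ (etaleBaseChange P.x).obj U}
    (h : P.point τ = P.point τ') : τ = τ' :=
  etale_hom_ext (pullback.hom_ext h ((etale_w τ).trans (etale_w τ').symm))

variable (P) in
lemma exists_point {U : X.Etale} (t : Spec (.of P.k) ⟶ U.left) (ht : t ≫ U.hom = P.x) :
    ∃ τ : P.final ⟶ (etaleBaseChange P.x).obj U, P.point τ = t := by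
  have ht' : t ≫ U.hom = 𝟙 (Spec (.of P.k)) ≫ P.x := ht.trans (Category.id_comp _).symm
  exact ⟨etaleHom (pullback.lift t (𝟙 _) ht') (pullback.lift_snd _ _ _), pullback.lift_fst _ _ _⟩

variable (P) (F : TameSheaf s)

/-- The value of a section in the stalk. -/
def ev {U : X.Etale} (τ : P.final ⟶ (etaleBaseChange P.x).obj U) :
    F.obj.obj (op U) →+ P.stalk F :=
  ((toSheafify (tameTopology P.toSpecValuationRing)
    ((etaleBaseChange P.x).op.lan.obj F.obj)).app (op P.final)).hom.comp
  ((((etaleBaseChange P.x).op.lan.obj F.obj).map τ.op).hom.comp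
    (((etaleBaseChange P.x).op.lanUnit.app F.obj).app (op U)).hom)

lemma ev_surjective (z : P.stalk F) : ∃ (U : X.Etale)
    (τ : P.final ⟶ (etaleBaseChange P.x).obj U) (a : F.obj.obj (op U)), P.ev F τ a = z := by
  obtain ⟨z, rfl⟩ := (P.toSheafify_bijective _).2 z
  obtain ⟨g, a, rfl⟩ := exists_lan_rep F.obj P.final z
  exact ⟨g.left.unop, g.hom.unop, a, rfl⟩

lemma exists_res_eq_of_ev_eq {U : X.Etale} (τ : P.final ⟶ (etaleBaseChange P.x).obj U)
    {a b : F.obj.obj (op U)} (h : P.ev F τ a = P.ev F τ b) : ∃ (V : X.Etale) (p : V ⟶ U)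
      (_ : P.final ⟶ (etaleBaseChange P.x).obj V), res F.obj p a = res F.obj p b := by
  obtain ⟨g, m, hm⟩ := exists_of_lan_rep_eq F.obj P.final (CostructuredArrow.mk τ.op) a b
    ((P.toSheafify_bijective _).1 h)
  exact ⟨g.left.unop, m.left.unop, g.hom.unop, hm⟩

lemma ev_res {U V : X.Etale} (τ : P.final ⟶ (etaleBaseChange P.x).obj V) (p : V ⟶ U)
    (a : F.obj.obj (op U)) : P.ev F τ (res F.obj p a) =
      P.ev F (τ ≫ (etaleBaseChange P.x).map p) a := by
  refine congrArg ((toSheafify (tameTopology P.toSpecValuationRing)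
    ((etaleBaseChange P.x).op.lan.obj F.obj)).app (op P.final)).hom ?_
  have h := ConcreteCategory.congr_hom
    (((etaleBaseChange P.x).op.lanUnit.app F.obj).naturality p.op) a
  have h' := congrArg (((etaleBaseChange P.x).op.lan.obj F.obj).map τ.op).hom h
  refine h'.trans ?_
  change _ = ((etaleBaseChange P.x).op.lan.obj F.obj).map
    (((etaleBaseChange P.x).map p).op ≫ τ.op) _
  rw [Functor.map_comp]
  rfl

end TamePoint

/-! ### Finiteness of sections -/

/-- Distinct homomorphisms to `k` are linearly independent in a finite-dimensional space of linear
maps. -/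
lemma finite_algHom (k A : Type*) [Field k] [CommRing A] [Algebra k A] [Module.Finite k A] :
    Finite (A →ₐ[k] k) :=
  (linearIndependent_toLinearMap k A k).finite

lemma finite_retraction {k : Type u} [Field k] {Z : Scheme.{u}} (g : Z ⟶ Spec (.of k))
    [IsFinite g] : Finite {t : Spec (.of k) ⟶ Z // t ≫ g = 𝟙 _} := by
  have : IsAffine Z := isAffine_of_isAffineHom g
  obtain ⟨i, hi⟩ := Spec.map_surjective (Z.isoSpec.inv ≫ g)
  have hfin : IsFinite (Z.isoSpec.inv ≫ g) := inferInstance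
  rw [← hi, IsFinite.SpecMap_iff] at hfin
  let alg : Algebra k Γ(Z, ⊤) := i.hom.toAlgebra
  have : Module.Finite k Γ(Z, ⊤) := hfin
  have := finite_algHom k Γ(Z, ⊤)
  have key (t : {t : Spec (.of k) ⟶ Z // t ≫ g = 𝟙 _}) : ∃ ψ : Γ(Z, ⊤) →ₐ[k] k,
      t.1 = Spec.map (CommRingCat.ofHom ψ.toRingHom) ≫ Z.isoSpec.inv := by
    obtain ⟨t, ht⟩ := t
    obtain ⟨ψ, hψ⟩ := Spec.map_surjective (t ≫ Z.isoSpec.hom)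
    have h : i ≫ ψ = 𝟙 _ := by
      refine Spec.map_injective ?_
      rw [Spec.map_comp, hψ, hi, Category.assoc, Iso.hom_inv_id_assoc, ht, Spec.map_id]
    refine ⟨⟨ψ.hom, fun r => ConcreteCategory.congr_hom h r⟩, ?_⟩
    change t = Spec.map ψ ≫ _
    rw [hψ, Category.assoc, Iso.hom_inv_id, Category.comp_id]
  choose ψ hψ using key
  exact Finite.of_injective ψ fun t t' h => Subtype.ext (by rw [hψ t, hψ t', h])

lemma finite_section {k : Type u} [Field k] {X Y : Scheme.{u}} (f : Y ⟶ X) [IsFinite f]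
    (x : Spec (.of k) ⟶ X) : Finite {t : Spec (.of k) ⟶ Y // t ≫ f = x} := by
  have := finite_retraction (Limits.pullback.snd f x)
  refine Finite.of_injective (β := {t : Spec (.of k) ⟶ Limits.pullback f x //
    t ≫ Limits.pullback.snd f x = 𝟙 _}) (fun t => ⟨Limits.pullback.lift t.1 (𝟙 _) (by
      rw [t.2, Category.id_comp]), Limits.pullback.lift_snd _ _ _⟩) fun t t' h => ?_
  have h' := congrArg (· ≫ Limits.pullback.fst f x) (congrArg Subtype.val h)
  exact Subtype.ext ((Limits.pullback.lift_fst _ _ _).symm.trans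
    (h'.trans (Limits.pullback.lift_fst _ _ _)))

/-! ### Finite stalks -/

variable {X S : Scheme.{u}} {s : X ⟶ S} (F : TameSheaf s)

/-- Let `ξ` be the section given by the identity of `G`. Every section is a pullback of `ξ`, so each
element of the stalk is the value of `ξ` at a `k`-point of `G` over `P.x`, and there are finitely
many such points. -/
theorem hasFiniteStalks_of_isRepresentedBy (G : Over X) [GrpObj G] [IsCommMonObj G]
    (hG : IsFiniteTameCover s G.hom) (h : IsRepresentedBy F G) : HasFiniteStalks F := by
  intro P
  obtain ⟨e, he⟩ := h
  have := hG.etale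
  have := hG.isFinite
  let E : X.Etale := Scheme.Etale.mk G.hom
  let ξ : F.obj.obj (op E) := (e E).symm (Additive.ofMul (Over.homMk (𝟙 G.left)))
  have hrep {U : X.Etale} (a : F.obj.obj (op U)) : ∃ f : U ⟶ E, res F.obj f ξ = a := by
    let m : (Scheme.Etale.forget X).obj U ⟶ G := (e U a).toMul
    refine ⟨etaleHom m.left (Over.w m), (e U).injective (Additive.toMul.injective ?_)⟩
    refine (he _ ξ).trans ?_
    rw [(e E).apply_symm_apply]
    exact Over.OverMorphism.ext (Category.comp_id _)
  have := finite_section G.hom P.x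
  have key (t : {t : Spec (.of P.k) ⟶ G.left // t ≫ G.hom = P.x}) :
    ∃ τ : P.final ⟶ (etaleBaseChange P.x).obj E, P.point τ = t.1 := P.exists_point (U := E) t.1 t.2
  choose τ hτ using key
  refine Finite.of_surjective (fun t => P.ev F (τ t) ξ) fun z => ?_
  obtain ⟨U, τ', a, rfl⟩ := P.ev_surjective F z
  obtain ⟨f, rfl⟩ := hrep a
  refine ⟨⟨P.point (τ' ≫ (etaleBaseChange P.x).map f), TamePoint.point_comp_hom _⟩, ?_⟩
  dsimp only
  rw [TamePoint.ev_res]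
  exact congrArg (fun σ => P.ev F σ ξ) (TamePoint.point_injective (hτ _))

/-- The tame point given by a morphism from the spectrum of a separably closed field and the
trivial valuation. -/
def TamePoint.ofIsSepClosed (Ω : Type u) [Field Ω] [IsSepClosed Ω] (x : Spec (.of Ω) ⟶ X) :
    TamePoint s where
  k := Ω
  x := x
  v := ⊤
  isSValuation := by
    let σ : Ω →+* (⊤ : ValuationSubring Ω) :=
      (RingHom.id Ω).codRestrict (⊤ : ValuationSubring Ω).toSubring fun _ => trivial
    refine ⟨Spec.map (CommRingCat.ofHom σ) ≫ x ≫ s, ?_⟩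
    rw [← Spec.map_comp_assoc]
    exact (congrArg (· ≫ x ≫ s) (Spec.map_id _)).trans (Category.id_comp _)
  surjective_of_isTamelyRamified L _ _ _ _ _ _ _ := IsSepClosed.algebraMap_surjective Ω L

/-- The group `A` injects into the stalk at a geometric point over `y` with trivial valuation. If
two constant sections have equal values there, they agree on an étale neighbourhood, which is
nonempty, and so they are equal. -/
theorem finite_of_hasFiniteStalks (h : HasFiniteStalks F) {U : X.Etale} {A : AddCommGrpCat.{u + 1}}
    (e : restrict F.obj U ≅ constantEtaleSheaf U.left A) (y : U.left) : Finite A := by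
  obtain ⟨c, -, hc⟩ := exists_constant_sections e
  let Ω := SeparableClosure (U.left.residueField y)
  let t : Spec (.of Ω) ⟶ U.left := Spec.map (CommRingCat.ofHom (algebraMap (U.left.residueField y) Ω)) ≫
    U.left.fromSpecResidueField y
  let P : TamePoint s := .ofIsSepClosed Ω (t ≫ U.hom)
  obtain ⟨τ, -⟩ := P.exists_point t rfl
  have := h P
  refine Finite.of_injective (fun a => P.ev F τ (c a)) fun a b hab => ?_
  obtain ⟨V, p, σ, hp⟩ := P.exists_res_eq_of_ev_eq F τ hab
  exact hc V p a b ⟨P.point σ (IsLocalRing.closedPoint Ω)⟩ hp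

/-- A locally constant sheaf with finite stalks has charts. -/
theorem exists_charts_of_hasFiniteStalks (hF : IsLocallyConstant F) (h : HasFiniteStalks F) :
    ∃ R ∈ tamePrecoverage s (Scheme.Etale.mk (𝟙 X)),
      ∀ ⦃U : X.Etale⦄ (p : U ⟶ Scheme.Etale.mk (𝟙 X)), R p →
        ∃ (n : ℕ) (c : Fin n → F.obj.obj (op U)), IsChart F.obj U c := by
  obtain ⟨R, hR, H⟩ := hF
  refine ⟨R, hR, fun U p hp => ?_⟩
  obtain ⟨A, ⟨e⟩⟩ := H p hp
  rcases isEmpty_or_nonempty U.left with hU | ⟨⟨y⟩⟩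
  · exact ⟨0, _, isChart_of_isEmpty hU⟩
  · have := finite_of_hasFiniteStalks F h e y
    exact exists_isChart_of_finite e

end
end TameSite

/-! ### Tameness of the representing scheme. -/

namespace TameSite
noncomputable section

lemma exists_residueFieldMap_of_map_eq {X Y : Scheme.{u}} (f : Y ⟶ X) [Etale f] (r : ValuedPoint Y)
    {Q : ValuedPoint X} (h : r.map f = Q) : ∃ i : X.residueField Q.1 →+* Y.residueField r.1,
      Spec.map (CommRingCat.ofHom i) ≫ X.fromSpecResidueField Q.1 =
        Y.fromSpecResidueField r.1 ≫ f ∧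
      r.2.comap i = Q.2 ∧ (i.FormallyUnramified ∧ i.EssFiniteType) ∧
      (IsTamelyRamified (f.residueFieldMap r.1).hom r.2 → IsTamelyRamified i r.2) := by
  subst h
  exact ⟨_, Scheme.Hom.SpecMap_residueFieldMap_fromSpecResidueField f r.1, rfl,
    ⟨residueFieldMap_formallyUnramified f r.1, residueFieldMap_essFiniteType f r.1⟩, id⟩

/-- Comparing images of the unique point shows that the `M`-point `t` lies at `y`, so it comes from
a homomorphism on the residue field of `y`. -/
lemma exists_factor_of_specMap_comp_eq {M Ω : Type u} [Field M] [Field Ω]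
    {Y : Scheme.{u}} (y : Y) (σ : Y.residueField y →+* Ω) (α : M →+* Ω) (t : Spec (.of M) ⟶ Y)
    (h : Spec.map (CommRingCat.ofHom σ) ≫ Y.fromSpecResidueField y =
      Spec.map (CommRingCat.ofHom α) ≫ t) : ∃ τ : Y.residueField y →+* M, σ = α.comp τ := by
  obtain ⟨y', j, rfl⟩ := exists_fromSpecResidueField t
  obtain rfl : y = y' := by
    obtain ⟨ω⟩ : Nonempty (Spec (.of Ω)) := ⟨IsLocalRing.closedPoint Ω⟩
    have := congrArg (fun m : Spec (.of Ω) ⟶ Y => m ω) h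
    dsimp only at this
    rwa [← Category.assoc, Scheme.Hom.comp_apply, Scheme.Hom.comp_apply,
      Scheme.fromSpecResidueField_apply, Scheme.fromSpecResidueField_apply] at this
  refine ⟨j, ringHom_eq_of_specMap_eq ?_⟩
  rw [← cancel_mono (Y.fromSpecResidueField y), h, ← Category.assoc, ← Spec.map_comp]
  rfl

/-- Tame ramification at a point of `Y` follows from tame ramification at a point of `U` if all
geometric points of the product of `Y` and `U` come from morphisms `U ⟶ Y`. -/
theorem isTamelyRamified_of_forall_geometric_point {X Y U : Scheme.{u}} (g : Y ⟶ X) [Etale g]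
    (m : U ⟶ X) [Etale m] (q : ValuedPoint Y) (r : ValuedPoint U) (hr : r.map m = q.map g)
    (h : IsTamelyRamified (m.residueFieldMap r.1).hom r.2)
    (H : ∀ (Ω : Type u) [Field Ω] (a : Spec (.of Ω) ⟶ Y) (b : Spec (.of Ω) ⟶ U),
      a ≫ g = b ≫ m → ∃ f : U ⟶ Y, a = b ≫ f) :
    IsTamelyRamified (g.residueFieldMap q.1).hom q.2 := by
  obtain ⟨i, hi, hiv, hiu, hit⟩ := exists_residueFieldMap_of_map_eq m r hr
  obtain ⟨j, hj, hjv, hju, hjt⟩ : ∃ j : X.residueField (q.map g).1 →+* Y.residueField q.1,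
      Spec.map (CommRingCat.ofHom j) ≫ X.fromSpecResidueField (q.map g).1 =
        Y.fromSpecResidueField q.1 ≫ g ∧
      q.2.comap j = (q.map g).2 ∧ (j.FormallyUnramified ∧ j.EssFiniteType) ∧
      j = (g.residueFieldMap q.1).hom :=
    ⟨_, Scheme.Hom.SpecMap_residueFieldMap_fromSpecResidueField g q.1, rfl,
      ⟨residueFieldMap_formallyUnramified g q.1, residueFieldMap_essFiniteType g q.1⟩, rfl⟩
  change IsTamelyRamified (K := X.residueField (q.map g).1) (g.residueFieldMap q.1).hom q.2
  rw [← hjt]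
  have ht := hit h
  clear hjt hr h hit
  -- The base point becomes a variable, so both residue fields are extensions of literally the same
  -- field.
  generalize q.map g = Q at i hi hiv hiu ht j hj hjv hju
  let algL : Algebra (X.residueField Q.1) (Y.residueField q.1) := j.toAlgebra
  let algM : Algebra (X.residueField Q.1) (U.residueField r.1) := i.toAlgebra
  obtain ⟨-, hL⟩ := finite_isSeparable_of_formallyUnramified
    (k := X.residueField Q.1) (L := Y.residueField q.1) hju.1 hju.2
  obtain ⟨-, hM⟩ := finite_isSeparable_of_formallyUnramified
    (k := X.residueField Q.1) (L := U.residueField r.1) hiu.1 hiu.2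
  refine IsTamelyRamified.of_forall_factors (K := X.residueField Q.1)
    (L := Y.residueField q.1) (M := U.residueField r.1) q.2 r.2
    (hjv.trans hiv.symm) ht fun σ hσ => ?_
  let Ω := SeparableClosure (U.residueField r.1)
  let α : U.residueField r.1 →+* Ω := algebraMap (U.residueField r.1) Ω
  -- An embedding `σ` over the base field is a geometric point of `Y` compatible with one of `U`. By
  -- `H` it factors through `U ⟶ Y`, hence through the residue field at `r.1`.
  obtain ⟨f, hf⟩ := H Ω
    (Spec.map (CommRingCat.ofHom σ) ≫ Y.fromSpecResidueField q.1)
    (Spec.map (CommRingCat.ofHom α) ≫ U.fromSpecResidueField r.1) (by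
      rw [Category.assoc, Category.assoc, ← hi, ← hj, ← Category.assoc,
        ← Category.assoc, ← Spec.map_comp, ← Spec.map_comp]
      exact congrArg (fun m => Spec.map (CommRingCat.ofHom m) ≫ X.fromSpecResidueField Q.1) hσ)
  exact exists_factor_of_specMap_comp_eq q.1 σ α (U.fromSpecResidueField r.1 ≫ f)
    (hf.trans (Category.assoc _ _ _))

variable {X : Scheme.{u}} {F : X.Etaleᵒᵖ ⥤ AddCommGrpCat.{u + 1}}

/-- A geometric point of the product of a representing object and a chart is given by a section
of the chart. -/
lemma exists_point_eq_comp {G U : X.Etale} {ξ : F.obj (op G)}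
    (hξ : ∀ Z, Function.Bijective fun f : Z ⟶ G => res F f ξ) {n : ℕ} {c : Fin n → F.obj (op U)}
    (hc : IsChart F U c) {Ω : Type u} [Field Ω] (a : Spec (.of Ω) ⟶ G.left)
    (b : Spec (.of Ω) ⟶ U.left) (hab : a ≫ G.hom = b ≫ U.hom) :
    ∃ f : U ⟶ G, a = b ≫ f.left := by
  let T : X.Etale := Scheme.Etale.mk (𝟙 X)
  let tG : G ⟶ T := etaleHom G.hom (Category.comp_id _)
  let tU : U ⟶ T := etaleHom U.hom (Category.comp_id _)
  let z : Spec (.of Ω) ⟶ (etalePullback tG tU).left := (isPullback_etalePullback tG tU).lift a b hab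
  have hz1 : z ≫ (etaleFst tG tU).left = a := (isPullback_etalePullback tG tU).lift_fst _ _ _
  have hz2 : z ≫ (etaleSnd tG tU).left = b := (isPullback_etalePullback tG tU).lift_snd _ _ _
  -- Near the geometric point of the product, the pullback of `ξ` equals some chart section `c k`.
  -- By representability, `c k` is the pullback of `ξ` along some `f : U ⟶ G`, so there the first
  -- projection is the second followed by `f`.
  obtain ⟨V, q, v, k, hq, hv, hk⟩ := hc.locally_eq _ (etaleSnd tG tU)
    (res F (etaleFst tG tU) ξ) (z (IsLocalRing.closedPoint Ω))
  obtain ⟨f, hf⟩ := (hξ U).2 (c k)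
  refine ⟨f, ?_⟩
  have h1 : q ≫ etaleFst tG tU = (q ≫ etaleSnd tG tU) ≫ f := by
    refine (hξ V).1 ?_
    dsimp only at hf ⊢
    rw [res_comp, hk, res_comp F _ f, hf]
  have hr : Set.range z ⊆ Set.range q.left := by
    rintro _ ⟨w, rfl⟩
    obtain rfl : w = IsLocalRing.closedPoint Ω := Subsingleton.elim _ _
    exact ⟨v, hv⟩
  let z' := IsOpenImmersion.lift q.left z hr
  have hz' : z' ≫ q.left = z := IsOpenImmersion.lift_fac _ _ _
  have h2 := congrArg (fun m : V ⟶ G => z' ≫ m.left) h1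
  rw [← hz1, ← hz2, ← hz']
  exact (Category.assoc _ _ _).trans (h2.trans (by simp))

variable {S : Scheme.{u}} (s : X ⟶ S)

/-- The scheme representing a locally constant sheaf is tamely ramified over the base. -/
theorem isTamelyRamified_of_charts {R : Presieve (Scheme.Etale.mk (𝟙 X))}
    (hR : R ∈ tamePrecoverage s (Scheme.Etale.mk (𝟙 X)))
    (h : ∀ ⦃U : X.Etale⦄ (p : U ⟶ Scheme.Etale.mk (𝟙 X)), R p →
      ∃ (n : ℕ) (c : Fin n → F.obj (op U)), IsChart F U c)
    {G : X.Etale} {ξ : F.obj (op G)} (hξ : ∀ Z, Function.Bijective fun f : Z ⟶ G => res F f ξ)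
    (q : ValuedPoint G.left) (hq : q ∈ Val (G.hom ≫ s)) :
    IsTamelyRamified (G.hom.residueFieldMap q.1).hom q.2 := by
  have : Etale G.hom := G.prop
  have hQ : q.map G.hom ∈ Val (𝟙 X ≫ s) := by
    rw [Category.id_comp]
    exact (map_mem_val_iff G.hom s _ rfl q).2 hq
  -- The covering supplies a tamely ramified valued point above the image of `q` in `X`, on a member
  -- with a chart.
  obtain ⟨U, p, hp, r, -, hr, ht⟩ := hR.2 (q.map G.hom) hQ
  obtain ⟨n, c, hc⟩ := h p hp
  have hpU : p.left = U.hom := (Category.comp_id _).symm.trans (etale_w p)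
  let m : U.left ⟶ X := p.left
  have : Etale m := by
    change Etale p.left
    rw [hpU]
    exact U.prop
  refine isTamelyRamified_of_forall_geometric_point G.hom m q r hr ht fun Ω _ a b hab => ?_
  obtain ⟨f, hf⟩ := exists_point_eq_comp hξ hc a b (hab.trans (congrArg (b ≫ ·) hpU))
  exact ⟨f.left, hf⟩

end
end TameSite

theorem mainTheorem7 {X S : Scheme.{u}} (s : X ⟶ S) [ConnectedSpace X]
    (F : TameSite.TameSheaf s) (hF : TameSite.IsLocallyConstant F) :
    TameSite.HasFiniteStalks F ↔
      ∃ (G : Over X) (_ : GrpObj G) (_ : IsCommMonObj G),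
        TameSite.IsFiniteTameCover s G.hom ∧ TameSite.IsRepresentedBy F G := by
  constructor
  · intro h
    obtain ⟨R, hR, H⟩ := TameSite.exists_charts_of_hasFiniteStalks F hF h
    have hlf := TameSite.isLocallyFiniteSheaf_of_charts F hR H
    have := TameSite.hasCharts_of_charts F hR H
    obtain ⟨ξ, hξ⟩ := hlf.exists_representing_section
    obtain ⟨hG, hG', he⟩ := TameSite.exists_grpObj_of_bijective F.obj (TameSite.repEtale F.obj) ξ hξ
    refine ⟨Over.mk (TameSite.repSchemeHom F.obj), hG, hG', ⟨?_, ?_, ?_⟩, he⟩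
    · exact inferInstanceAs (IsFinite (TameSite.repSchemeHom F.obj))
    · exact inferInstanceAs (Etale (TameSite.repSchemeHom F.obj))
    · exact TameSite.isTamelyRamified_of_charts s hR H hξ
  · rintro ⟨G, _, _, hG, h⟩
    exact TameSite.hasFiniteStalks_of_isRepresentedBy F G hG h
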